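/- **Setting.** Let $0<\alpha<1$ and $0<\gamma\le\alpha$. For a finite set $B\subset\mathbb N$, $B\ne\varnothing$, let $\mathbb T_B$ be the set of rooted trees with leaves labelled by $B$ in which the root has degree $1$ and no vertex has degree $2$; write $[n]=\{1,\dots,n\}$ and $\mathbb T_n=\mathbb T_{[n]}$. The edge at the root is counted as an edge (it is the only edge, and a leaf edge, if $n=1$). A sequence of random trees $(T_n,n\ge1)$, $T_n\in\mathbb T_n$, results from the *alpha-gamma growth rules* if for all $n\ge2$, conditionally given $T_1,\dots,T_n$, the tree $T_{n+1}$ is obtained as follows. Assign weight $1-\alpha$ to each edge of $T_n$ adjacent to a leaf, weight $\gamma$ to each other edge, and weight $(c-1)\alpha-\gamma$ to each vertex of degree $c+1\ge3$. Select an edge or a branch point with probability proportional to its weight. If an edge $a\to c$ (directed away from the root) is selected, replace it by $a\to b$, $b\to c$, $b\to n+1$, with a new branch point $b$ and a new leaf $n+1$; if a branch point $v$ is selected, add an edge $v\to n+1$ to a new leaf $n+1$. For $1\le k\le n$ let $S(T_n,[k])$ be the subtree of $T_n$ spanned by the root and the leaves $1,\dots,k$, and let $R(T_n,[k])$ be the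 tree obtained from it by removing the degree-2 vertices, with the graph distances in $T_n$ as edge lengths. Let $W_{n,k}$ be the number of leaves of $T_n$ in those components of $T_n\setminus S(T_n,[k])$ that are attached to the edges of $R(T_n,[k])$, that is, to vertices of degree $2$ in $S(T_n,[k])$. **Proposition.** Let $(T_n,n\ge1)$ result from the alpha-gamma growth rules and let $k\ge1$. Then there are random variables $W_k$, $L_k$ and $D_k=(D_{k,e})_{e}$, indexed by the edges $e$ of $T_k$, on the same probability space, such that the following holds. Conditionally given $T_k$, with $k+\ell$ the number of edges of $T_k$, the variables $W_k,L_k,D_k$ are independent, and * $W_k\sim\mathrm{beta}\big(k(1-\alpha)+\ell\gamma,\ (k-1)\alpha-\ell\gamma\big)$, where $\mathrm{beta}(a,0)$ is the point mass at $1$; * $L_k$ has density $\dfrac{\Gamma(1+k(1-\alpha)+\ell\gamma)}{\Gamma(1+\ell+k(1-\alpha)/\gamma)}\,s^{\ell+k(1-\alpha)/\gamma}g_\gamma(s)$ on $(0,\infty)$, where $g_\gamma$ is the Mittag-Leffler density, the density of $\sigma_1^{-\gamma}$ for a subordinator $\sigma$ with $\mathbb E(e^{-\lambda\sigma_1})=e^{-\lambda^\gamma}$,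 $\lambda\ge 0$; * $D_k$ is Dirichlet distributed, with parameter $(1-\alpha)/\gamma$ for each edge adjacent to a leaf and parameter $1$ for each other edge. Moreover, if $\mathcal R_k$ denotes the tree with shape $T_k$ in which each edge $e$ has length $L_kW_k^\gamma D_{k,e}$, then almost surely $$\big(n^{-\gamma}R(T_n,[k]),\ n^{-1}W_{n,k}\big)\longrightarrow(\mathcal R_k,\ W_k)\qquad\text{as }n\to\infty,$$ where the first components (with all edge lengths of $R(T_n,[k])$ multiplied by $n^{-\gamma}$) are regarded as rooted compact $\mathbb R$-trees and converge in the Gromov–Hausdorff distance between rooted compact metric spaces. Furthermore, almost surely, $R(T_n,[k])$ has shape $T_k$ for all $n\ge k$, and each edge length of $n^{-\gamma}R(T_n,[k])$ converges to the length of the corresponding edge of $\mathcal R_k$. -/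

import Mathlib

open MeasureTheory ProbabilityTheory Filter Topology
open scoped ENNReal

namespace AlphaGamma

/-! ### Leaf-labelled rooted trees

A rooted tree with leaves labelled by a finite set `B ⊆ ℕ` is encoded by its set of vertices other
than the root, a vertex being identified with the set of labels of the leaves above it. The root
is an additional vertex, joined by an edge to the common ancestor `B`. Every vertex `A` other than
the root has exactly one edge `C → A` from its parent; this edge is also denoted by `A`. -/

/-- `t` is (the set of non-root vertices of) a tree in `𝕋_B`. -/
structure IsFragTree (B : Finset ℕ) (t : Finset (Finset ℕ)) : Prop where
  nonempty : ∀ A ∈ t, A.Nonempty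
  subset : ∀ A ∈ t, A ⊆ B
  ancestor_mem : B ∈ t
  leaf_mem : ∀ i ∈ B, {i} ∈ t
  laminar : ∀ A ∈ t, ∀ C ∈ t, Disjoint A C ∨ A ⊆ C ∨ C ⊆ A

/-- The children of the vertex `A` in a family `s` of vertices: the maximal members of `s` strictly
included in `A`. The degree of `A` is the number of its children plus one. -/
def children (s : Finset (Finset ℕ)) (A : Finset ℕ) : Finset (Finset ℕ) :=
  s.filter fun C => C ⊂ A ∧ ∀ D ∈ s, C ⊆ D → D ⊂ A → D = C

/-- Branch points of `t`: the vertices, other than the root, that are not leaves. -/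
def branchPoints (t : Finset (Finset ℕ)) : Finset (Finset ℕ) :=
  t.filter fun A => 2 ≤ A.card

/-! ### The growth rules -/

/-- The tree obtained from `t` by adding to the branch point `v` an edge to a new leaf `j`. -/
def insertAtVertex (t : Finset (Finset ℕ)) (v : Finset ℕ) (j : ℕ) : Finset (Finset ℕ) :=
  insert {j} (t.image fun C => if v ⊆ C then insert j C else C)

/-- The tree obtained from `t` by replacing the edge `a → c` above the parent `a` of `c` by
`a → b`, `b → c`, `b → j`, where `b` is a new branch point and `j` a new leaf. -/
def insertAtEdge (t : Finset (Finset ℕ)) (c : Finset ℕ) (j : ℕ) : Finset (Finset ℕ) :=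
  insert c (insertAtVertex t c j)

/-- Weight of the edge `A`: `1 - α` if it is adjacent to a leaf, `γ` otherwise. -/
noncomputable def edgeWeight (α γ : ℝ) (A : Finset ℕ) : ℝ :=
  if A.card = 1 then 1 - α else γ

/-- Weight `(c - 1) α - γ` of a branch point with `c` children, that is, of degree `c + 1`. -/
noncomputable def vertexWeight (α γ : ℝ) (t : Finset (Finset ℕ)) (v : Finset ℕ) : ℝ :=
  (((children t v).card : ℝ) - 1) * α - γ

/-- The sum of the weights of all edges and all branch points of `t`. -/
noncomputable def totalWeight (α γ : ℝ) (t : Finset (Finset ℕ)) : ℝ :=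
  ∑ A ∈ t, edgeWeight α γ A + ∑ v ∈ branchPoints t, vertexWeight α γ t v

/-- Probability that the tree `t` turns into `t'` when the new leaf `j` is added: an edge or a
branch point of `t` is selected with probability proportional to the weights. -/
noncomputable def growthProb (α γ : ℝ) (t : Finset (Finset ℕ)) (j : ℕ)
    (t' : Finset (Finset ℕ)) : ℝ :=
  (∑ A ∈ t, (if insertAtEdge t A j = t' then edgeWeight α γ A else 0) +
    ∑ v ∈ branchPoints t, (if insertAtVertex t v j = t' then vertexWeight α γ t v else 0)) /
  totalWeight α γ t

/-- `(T n, n ≥ 1)` is a sequence of random trees, `T n` having leaves labelled `1, …, n`, that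
results from the alpha-gamma growth rules: given `T 1, …, T n`, `n ≥ 2`, the tree `T (n + 1)` has
conditional distribution `growthProb α γ (T n) (n + 1)`. The trees `T 1` and `T 2` are the only
trees with the leaf labels `{1}` and `{1, 2}`; the value `T 0` plays no role. -/
structure IsAlphaGammaSequence {Ω : Type*} [MeasurableSpace Ω] (α γ : ℝ) (P : Measure Ω)
    (T : ℕ → Ω → Finset (Finset ℕ)) : Prop where
  tree : ∀ n, 1 ≤ n → ∀ ω, IsFragTree (Finset.Icc 1 n) (T n ω)
  measurable : ∀ n, 1 ≤ n → ∀ t, MeasurableSet (T n ⁻¹' {t})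
  growth : ∀ n, 2 ≤ n → ∀ t : ℕ → Finset (Finset ℕ),
    P {ω | ∀ i ∈ Finset.Icc 1 (n + 1), T i ω = t i} =
      P {ω | ∀ i ∈ Finset.Icc 1 n, T i ω = t i} *
        ENNReal.ofReal (growthProb α γ (t n) (n + 1) (t (n + 1)))

/-! ### Reduced trees -/

/-- The vertices, other than the root, of the subtree of `t` spanned by the root and the leaves in
`K`, including those that have degree `2` in this subtree. -/
def skeleton (t : Finset (Finset ℕ)) (K : Finset ℕ) : Finset (Finset ℕ) :=
  t.filter fun A => (A ∩ K).Nonempty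

/-- The vertices of the spanned subtree, other than the root, that do not have degree `2` in it. -/
def retained (t : Finset (Finset ℕ)) (K : Finset ℕ) : Finset (Finset ℕ) :=
  (skeleton t K).filter fun A => (children (skeleton t K) A).card + 1 ≠ 2

/-- The reduced tree `R(t, K)` without edge lengths, as a tree with leaf labels `K`: a retained
vertex is identified with the set of labels in `K` above it. -/
def reducedShape (t : Finset (Finset ℕ)) (K : Finset ℕ) : Finset (Finset ℕ) :=
  (retained t K).image fun A => A ∩ K

/-- The length of the edge `C` of `R(t, K)`: the graph distance in `t` between the retained vertex
`A` that represents `C` and the next retained vertex below `A` (or the root if there is none),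
that is, the number of edges `E` of `t` on the path between these two vertices. -/
def reducedLength (t : Finset (Finset ℕ)) (K C : Finset ℕ) : ℕ :=
  ((skeleton t K).filter fun E => ∃ A ∈ retained t K, A ∩ K = C ∧ A ⊆ E ∧
    ∀ D ∈ retained t K, A ⊂ D → E ⊂ D).card

/-- The number of leaves `i ∈ B ∖ K` of `t` in subtrees attached to the edges of `R(t, K)`, that is,
such that the vertex `A` of the spanned subtree to which the subtree containing `i` is attached
(the last vertex of the spanned subtree on the path from the root to `i`) has degree `2` in the
spanned subtree. -/
def edgeLeafCount (t : Finset (Finset ℕ)) (B K : Finset ℕ) : ℕ :=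
  ((B \ K).filter fun i => ∃ A ∈ skeleton t K, A ∉ retained t K ∧ i ∈ A ∧
    ∀ C ∈ skeleton t K, i ∈ C → A ⊆ C).card

/-! ### Trees with edge lengths as rooted real trees, and the Gromov-Hausdorff distance -/

/-- The space in which trees with edge lengths are embedded, one coordinate for each edge. -/
abbrev EllOne : Type := lp (fun _ : Finset ℕ => ℝ) 1

/-- The point at distance `s` from the lower end of the edge `A` in the tree `t` with edge lengths
`η`: starting from the root `0`, the path to it runs through the full length of each edge `C ⊃ A`,
in the coordinate direction of that edge, and then through length `s` in the direction of `A`. -/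
noncomputable def edgePoint (t : Finset (Finset ℕ)) (η : Finset ℕ → ℝ) (A : Finset ℕ) (s : ℝ) :
    EllOne :=
  ∑ C ∈ t.filter (fun C => A ⊂ C), lp.single 1 C (η C) + lp.single 1 A s

/-- The real tree given by the tree `t` with edge lengths `η`, with root `0`. On it the `ℓ¹`
distance is the length of the path between two points. -/
def realTree (t : Finset (Finset ℕ)) (η : Finset ℕ → ℝ) : Set EllOne :=
  insert 0 {x | ∃ A ∈ t, ∃ s ∈ Set.Icc 0 (η A), x = edgePoint t η A s}

/-- The root of `realTree t η`. -/
noncomputable def treeRoot (t : Finset (Finset ℕ)) (η : Finset ℕ → ℝ) : realTree t η :=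
  ⟨0, Set.mem_insert _ _⟩

/-- The Gromov-Hausdorff distance between rooted compact metric spaces: the infimum of the Hausdorff
distances of isometric images in a common metric space in which the two roots agree. -/
noncomputable def rootedGHDist {X Y : Type} [MetricSpace X] [MetricSpace Y] (x₀ : X) (y₀ : Y) : ℝ :=
  sInf {r : ℝ | ∃ (E : Type) (_ : MetricSpace E) (f : X → E) (g : Y → E),
    Isometry f ∧ Isometry g ∧ f x₀ = g y₀ ∧
      r = Metric.hausdorffDist (Set.range f) (Set.range g)}

/-! ### The limiting distributions -/

/-- The distribution `beta(a, b)`, with the usual convention `beta(a, 0) = δ₁`. -/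
noncomputable def betaLaw (a b : ℝ) : Measure ℝ :=
  if b = 0 then Measure.dirac 1 else betaMeasure a b

/-- `S` is the distribution of `σ₁` for a subordinator `σ` with Laplace exponent `x ↦ x ^ γ`. -/
structure IsStableLaw (γ : ℝ) (S : Measure ℝ) : Prop where
  prob : IsProbabilityMeasure S
  nonneg : S (Set.Iio 0) = 0
  laplace : ∀ x : ℝ, 0 ≤ x → ∫ y, Real.exp (-(x * y)) ∂S = Real.exp (-(x ^ γ))

/-- `g` is (a version of) the Mittag-Leffler density `g_γ`: the density on `(0, ∞)` of `σ₁ ^ (-γ)`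
for a subordinator `σ` with Laplace exponent `x ↦ x ^ γ`. -/
structure IsMittagLefflerDensity (γ : ℝ) (g : ℝ → ℝ) : Prop where
  measurable : Measurable g
  nonneg : ∀ s, 0 ≤ g s
  density : ∃ S : Measure ℝ, IsStableLaw γ S ∧
    S.map (fun y => y ^ (-γ)) =
      (volume.restrict (Set.Ioi 0)).withDensity fun s => ENNReal.ofReal (g s)

/-- The measure on `(0, ∞)` with density
`Γ(1 + k (1 - α) + ℓ γ) / Γ(1 + ℓ + k (1 - α) / γ) * s ^ (ℓ + k (1 - α) / γ) * g s`. -/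
noncomputable def lengthLaw (α γ k ℓ : ℝ) (g : ℝ → ℝ) : Measure ℝ :=
  (volume.restrict (Set.Ioi 0)).withDensity fun s => ENNReal.ofReal
    (Real.Gamma (1 + k * (1 - α) + ℓ * γ) / Real.Gamma (1 + ℓ + k * (1 - α) / γ) *
      s ^ (ℓ + k * (1 - α) / γ) * g s)

open Classical in
/-- The unnormalised density of the coordinates other than `i₀` under a Dirichlet distribution. -/
noncomputable def dirichletDensity {ι : Type*} [Fintype ι] (a : ι → ℝ) (i₀ : ι)
    (x : {i // i ≠ i₀} → ℝ) : ℝ :=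
  if (∀ i, 0 < x i) ∧ ∑ i, x i < 1 then
    (∏ i, x i ^ (a i - 1)) * (1 - ∑ i, x i) ^ (a i₀ - 1)
  else 0

open Classical in
/-- The Dirichlet distribution with parameters `a` on `{x : ι → [0, 1] | ∑ i, x i = 1}`: the
coordinates other than `i₀` have a density proportional to `dirichletDensity a i₀`, and the
coordinates sum to `1`. (The measure does not depend on the choice of `i₀`.) -/
noncomputable def dirichletLaw {ι : Type*} [Fintype ι] (a : ι → ℝ) (i₀ : ι) : Measure (ι → ℝ) :=
  let μ : Measure ({i // i ≠ i₀} → ℝ) :=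
    volume.withDensity fun x => ENNReal.ofReal (dirichletDensity a i₀ x)
  ((μ Set.univ)⁻¹ • μ).map fun x i => if h : i = i₀ then 1 - ∑ j, x j else x ⟨i, h⟩

/-- Dirichlet parameters of the edge length proportions: `(1 - α) / γ` for edges adjacent to leaves
and `1` for the other edges. -/
noncomputable def edgeParam (α γ : ℝ) (A : Finset ℕ) : ℝ :=
  if A.card = 1 then (1 - α) / γ else 1

end AlphaGamma

/-! The growth of the reduced tree is a two-level Pólya urn. For an edge `C` of the reduced tree let
`x_C` be its number of edges of `T n`, shifted so that `γ x_C` is their total weight (`edgeVar`).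
Let `Y` be the total weight of all places where an insertion attaches the new leaf to an edge of the
reduced tree (`groupVar`). A weight count shows that `Y` is a constant plus the leaf count `W_{n,k}`
(`sum_weight_onEdge`) and that all weights add up to `n - α` (`totalWeight_eq`). A selection with
weight `γ x_C` raises `x_C` and `Y` by one, one with the rest of the weight `Y` raises `Y` alone,
and any other changes nothing.

Hence the product of the rising factorials of order `c_C` of `x_C` and of order `m` of `Y + γ ∑ c_C`
is an eigenfunction of the growth rules (`growthSum_growthPoly`). Normalised by a ratio of Gamma
functions it is a nonnegative martingale, so it converges almost surely. The linear cases give the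
limits of all edge lengths and of the mass. The square of such a polynomial is dominated by the one
with doubled orders, so second moments are bounded, means pass to the limit, and every joint moment
of the limits is explicit (`lintegral_limit`).

These moments are those of `(W, (L W^γ D_e)_e)` for independent beta, tilted Mittag-Leffler and
Dirichlet variables. That vector has a finite exponential moment, so its law is determined by its
moments (`ext_of_lintegral_monomial`), and inverting the map `(W, L, D) ↦ (W, L W^γ D)` yields the
claimed law. All this is done under `P` conditioned on the value of `T k`.

Two matters are independent of the urn. The Mittag-Leffler density must be shown to exist: it is
built from products of beta powers, whose moments converge, and recognised by multiplying with a
power of an exponential variable (`exists_isMittagLefflerDensity`). Gromov–Hausdorff convergence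
follows from that of the edge lengths, because trees of one shape embed together in `ℓ¹` with the
root at `0`. -/

namespace AlphaGamma

/-! ### Combinatorics of spanned and reduced trees in terms of traces `A ∩ K` -/

section Combinatorics

variable {B K : Finset ℕ} {t : Finset (Finset ℕ)}

theorem mem_skeleton {A : Finset ℕ} : A ∈ skeleton t K ↔ A ∈ t ∧ (A ∩ K).Nonempty := by
  simp [skeleton]

theorem IsFragTree.nested (h : IsFragTree B t) {A C : Finset ℕ} (hA : A ∈ t) (hC : C ∈ t)
    {i : ℕ} (hiA : i ∈ A) (hiC : i ∈ C) : A ⊆ C ∨ C ⊆ A := by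
  rcases h.laminar A hA C hC with hd | hs
  · exact absurd hiC (Finset.disjoint_left.1 hd hiA)
  · exact hs

theorem mem_children {s : Finset (Finset ℕ)} {A C : Finset ℕ} :
    C ∈ children s A ↔ C ∈ s ∧ C ⊂ A ∧ ∀ D ∈ s, C ⊆ D → D ⊂ A → D = C := by
  simp [children]

/-- Every vertex strictly above `A` is above a child of `A`. -/
theorem exists_mem_children {s : Finset (Finset ℕ)} {A D : Finset ℕ} (hD : D ∈ s) (hDA : D ⊂ A) :
    ∃ C ∈ children s A, D ⊆ C := by
  obtain ⟨C, hC, hmax⟩ := (s.filter fun C => D ⊆ C ∧ C ⊂ A).exists_max_image Finset.card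
    ⟨D, by simp [hD, hDA]⟩
  simp only [Finset.mem_filter] at hC hmax
  refine ⟨C, mem_children.2 ⟨hC.1, hC.2.2, fun E hE hCE hEA => ?_⟩, hC.2.1⟩
  exact (Finset.eq_of_subset_of_card_le hCE (hmax E ⟨hE, hC.2.1.trans hCE, hEA⟩)).symm

theorem IsFragTree.children_eq_of_mem (h : IsFragTree B t) {s : Finset (Finset ℕ)} (hs : s ⊆ t)
    {A C C' : Finset ℕ} (hC : C ∈ children s A) (hC' : C' ∈ children s A) {i : ℕ} (hi : i ∈ C)
    (hi' : i ∈ C') : C = C' := by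
  rw [mem_children] at hC hC'
  rcases h.nested (hs hC.1) (hs hC'.1) hi hi' with hle | hle
  · exact (hC.2.2 _ hC'.1 hle hC'.2.1).symm
  · exact hC'.2.2 _ hC.1 hle hC.2.1

theorem skeleton_subset : skeleton t K ⊆ t := Finset.filter_subset _ _

/-- A single child must contain all labels in `A ∩ K`. Conversely, the child below a vertex with the
full trace of `A` shares a label in `K` with every other child, so it is the only one. Degree 2 thus
becomes a condition on traces, which insertions preserve. -/
theorem IsFragTree.card_children_skeleton (h : IsFragTree B t) (hK : K ⊆ B) {A : Finset ℕ}
    (hA : A ∈ skeleton t K) :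
    (children (skeleton t K) A).card = 1 ↔ ∃ D ∈ t, D ∩ K = A ∩ K ∧ D ⊂ A := by
  constructor
  · intro hc
    obtain ⟨C, hC⟩ := Finset.card_eq_one.1 hc
    have hCm : C ∈ children (skeleton t K) A := by simp [hC]
    obtain ⟨hCs, hCA, -⟩ := mem_children.1 hCm
    refine ⟨C, skeleton_subset hCs, ?_, hCA⟩
    refine Finset.Subset.antisymm (Finset.inter_subset_inter_right hCA.1) fun i hi => ?_
    rw [Finset.mem_inter] at hi ⊢
    have hs : {i} ∈ skeleton t K :=
      mem_skeleton.2 ⟨h.leaf_mem i (hK hi.2), ⟨i, by simp [hi.2]⟩⟩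
    rcases eq_or_ne ({i} : Finset ℕ) A with he | he
    · subst he
      have := (mem_skeleton.1 hCs).2
      rw [Finset.ssubset_singleton_iff] at hCA
      simp [hCA] at this
    · obtain ⟨C', hC', hiC'⟩ := exists_mem_children hs
        (Finset.ssubset_iff_subset_ne.2 ⟨by simpa using hi.1, he⟩)
      rw [hC, Finset.mem_singleton] at hC'
      subst hC'
      exact ⟨by simpa using hiC', hi.2⟩
  · rintro ⟨D, hD, hDK, hDA⟩
    have hDs : D ∈ skeleton t K := mem_skeleton.2 ⟨hD, hDK ▸ (mem_skeleton.1 hA).2⟩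
    obtain ⟨C, hC, hDC⟩ := exists_mem_children hDs hDA
    refine Finset.card_eq_one.2 ⟨C, Finset.eq_singleton_iff_unique_mem.2 ⟨hC, fun C' hC' => ?_⟩⟩
    obtain ⟨i, hi⟩ := (mem_skeleton.1 (mem_children.1 hC').1).2
    rw [Finset.mem_inter] at hi
    have hiA : i ∈ A ∩ K := Finset.mem_inter.2 ⟨(mem_children.1 hC').2.1.1 hi.1, hi.2⟩
    rw [← hDK, Finset.mem_inter] at hiA
    exact h.children_eq_of_mem skeleton_subset hC' hC hi.1 (hDC hiA.1)

/-- The retained vertices are the minimal vertices with a given non-empty trace on `K`. -/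
theorem IsFragTree.mem_retained (h : IsFragTree B t) (hK : K ⊆ B) {A : Finset ℕ} :
    A ∈ retained t K ↔ A ∈ skeleton t K ∧ ∀ D ∈ t, D ∩ K = A ∩ K → ¬ D ⊂ A := by
  rw [retained, Finset.mem_filter]
  refine and_congr_right fun hA => ?_
  have := h.card_children_skeleton hK hA
  constructor
  · intro hc D hD hDK hDA
    exact hc (by rw [this.2 ⟨D, hD, hDK, hDA⟩])
  · intro hc h2
    obtain ⟨D, hD, hDK, hDA⟩ := this.1 (by omega)
    exact hc D hD hDK hDA

theorem IsFragTree.exists_retained (h : IsFragTree B t) (hK : K ⊆ B) {A : Finset ℕ}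
    (hA : A ∈ skeleton t K) : ∃ D ∈ retained t K, D ∩ K = A ∩ K ∧ D ⊆ A := by
  obtain ⟨D, hD, hmin⟩ := (t.filter fun D => D ∩ K = A ∩ K ∧ D ⊆ A).exists_min_image Finset.card
    ⟨A, by simp [skeleton_subset hA]⟩
  simp only [Finset.mem_filter] at hD hmin
  refine ⟨D, (h.mem_retained hK).2 ⟨mem_skeleton.2 ⟨hD.1, hD.2.1 ▸ (mem_skeleton.1 hA).2⟩,
    fun E hE hEK hED => ?_⟩, hD.2⟩
  have := hmin E ⟨hE, hEK.trans hD.2.1, hED.1.trans hD.2.2⟩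
  exact absurd (Finset.card_lt_card hED) (by omega)

/-- With `reducedLength_eq` this removes children and retained vertices from the picture: the
vertices of the reduced tree are the nonempty values of the trace map `A ↦ A ∩ K`, and its edges are
the fibres. -/
theorem IsFragTree.reducedShape_eq (h : IsFragTree B t) (hK : K ⊆ B) :
    reducedShape t K = (t.image fun A => A ∩ K).erase ∅ := by
  ext C
  simp only [reducedShape, Finset.mem_image, Finset.mem_erase]
  constructor
  · rintro ⟨A, hA, rfl⟩
    have hs := mem_skeleton.1 (Finset.mem_filter.1 hA).1
    exact ⟨hs.2.ne_empty, A, hs.1, rfl⟩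
  · rintro ⟨hne, A, hA, rfl⟩
    obtain ⟨D, hD, hDK, -⟩ :=
      h.exists_retained hK (mem_skeleton.2 ⟨hA, Finset.nonempty_iff_ne_empty.2 hne⟩)
    exact ⟨D, hD, hDK⟩

/-- Moving from the retained vertex of trace `C` towards the root, the trace stays `C` until the
next retained vertex is reached, which is the minimal vertex of a strictly larger trace. -/
theorem IsFragTree.reducedLength_eq (h : IsFragTree B t) (hK : K ⊆ B) {C : Finset ℕ}
    (hC : C.Nonempty) : reducedLength t K C = (t.filter fun E => E ∩ K = C).card := by
  rw [reducedLength]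
  congr 1
  ext E
  simp only [Finset.mem_filter]
  constructor
  · rintro ⟨hE, A, hA, rfl, hAE, hmax⟩
    refine ⟨skeleton_subset hE, ?_⟩
    have hsub : A ∩ K ⊆ E ∩ K := Finset.inter_subset_inter_right hAE
    by_contra hne
    obtain ⟨D, hD, hDK, hDE⟩ := h.exists_retained hK hE
    -- If `E` had a trace larger than that of `A`, the retained vertex `D` of that trace would
    -- separate `A` from `E`; the maximality `hmax` then forces `E ⊂ D`, against `D ⊆ E`.
    have hDA : A ⊂ D := by
      obtain ⟨i, hi⟩ := hC
      have hiD : i ∈ D ∩ K := by rw [hDK]; exact hsub hi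
      rw [Finset.mem_inter] at hi hiD
      rcases h.nested (skeleton_subset (Finset.mem_filter.1 hA).1)
        (skeleton_subset (Finset.mem_filter.1 hD).1) hi.1 hiD.1 with hle | hle
      · refine Finset.ssubset_iff_subset_ne.2 ⟨hle, ?_⟩
        rintro rfl
        exact hne hDK.symm
      · exact absurd (Finset.Subset.antisymm (hDK ▸ Finset.inter_subset_inter_right hle) hsub) hne
    exact (hmax D hD hDA).2 hDE
  · rintro ⟨hE, rfl⟩
    have hEs : E ∈ skeleton t K := mem_skeleton.2 ⟨hE, hC⟩
    obtain ⟨A, hA, hAK, hAE⟩ := h.exists_retained hK hEs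
    refine ⟨hEs, A, hA, hAK, hAE, fun D hD hAD => ?_⟩
    obtain ⟨hDs, hDmin⟩ := (h.mem_retained hK).1 hD
    obtain ⟨i, hi⟩ := hC
    have hiA := hi
    rw [← hAK, Finset.mem_inter] at hiA
    rw [Finset.mem_inter] at hi
    have hDE : ¬ D ⊆ E := by
      intro hDE
      have h1 : A ∩ K = D ∩ K := Finset.Subset.antisymm (Finset.inter_subset_inter_right hAD.1)
        (hAK ▸ Finset.inter_subset_inter_right hDE)
      exact hDmin A (skeleton_subset (Finset.mem_filter.1 hA).1) h1 hAD
    rcases h.nested hE (skeleton_subset hDs) hi.1 (hAD.1 hiA.1) with hle | hle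
    · exact ⟨hle, hDE⟩
    · exact absurd hle hDE

/-- The vertex `v` lies on an edge of the reduced tree `R(t, K)` as a vertex of degree `2` in the
spanned subtree, or in a subtree attached to such a vertex. -/
def OnEdge (t : Finset (Finset ℕ)) (K v : Finset ℕ) : Prop :=
  ∃ A ∈ t, ∃ E ∈ t, v ⊆ A ∧ ¬ v ⊆ E ∧ A ∩ K = E ∩ K ∧ (A ∩ K).Nonempty

open Classical in
-- If `A` and `E` have the same nonempty trace and `i` is in `A` but not in `E`, then the smallest
-- vertex of the spanned subtree containing `i` lies strictly between `E` and the root and has the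
-- trace of `E`. So it has degree 2, and `i` hangs off an edge.
theorem IsFragTree.edgeLeafCount_eq (h : IsFragTree B t) (hK : K ⊆ B) :
    edgeLeafCount t B K = ((B \ K).filter fun i => OnEdge t K {i}).card := by
  rw [edgeLeafCount]
  congr 1
  refine Finset.filter_congr fun i _ => ?_
  constructor
  · rintro ⟨A, hA, hAr, hiA, hmin⟩
    rw [h.mem_retained hK] at hAr
    push Not at hAr
    obtain ⟨D, hD, hDK, hDA⟩ := hAr hA
    refine ⟨A, skeleton_subset hA, D, hD, by simpa using hiA, fun hiD => ?_, hDK.symm,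
      (mem_skeleton.1 hA).2⟩
    exact hDA.2 (hmin D (mem_skeleton.2 ⟨hD, hDK ▸ (mem_skeleton.1 hA).2⟩) (by simpa using hiD))
  · rintro ⟨A', hA', E, hE, hiA', hiE, hK', hne⟩
    rw [Finset.singleton_subset_iff] at hiA' hiE
    obtain ⟨A, hA, hmin⟩ := ((skeleton t K).filter fun A => i ∈ A).exists_min_image Finset.card
      ⟨A', Finset.mem_filter.2 ⟨mem_skeleton.2 ⟨hA', hne⟩, hiA'⟩⟩
    simp only [Finset.mem_filter] at hA hmin
    have hle : ∀ C ∈ skeleton t K, i ∈ C → A ⊆ C := by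
      intro C hC hiC
      rcases h.nested (skeleton_subset hA.1) (skeleton_subset hC) hA.2 hiC with hl | hl
      · exact hl
      · rw [Finset.eq_of_subset_of_card_le hl (hmin C ⟨hC, hiC⟩)]
    have hAA' := hle A' (mem_skeleton.2 ⟨hA', hne⟩) hiA'
    obtain ⟨x, hx⟩ := (mem_skeleton.1 hA.1).2
    have hxE : x ∈ E ∩ K := hK' ▸ Finset.inter_subset_inter_right hAA' hx
    rw [Finset.mem_inter] at hx hxE
    have hEA : E ⊂ A := by
      rcases h.nested hE (skeleton_subset hA.1) hxE.1 hx.1 with hl | hl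
      · exact ⟨hl, fun hAE => hiE (hAE hA.2)⟩
      · exact absurd (hl hA.2) hiE
    refine ⟨A, hA.1, fun hr => ?_, hA.2, hle⟩
    refine ((h.mem_retained hK).1 hr).2 E hE ?_ hEA
    exact Finset.Subset.antisymm (Finset.inter_subset_inter_right hEA.1)
      (hK' ▸ Finset.inter_subset_inter_right hAA')

/-! ### Insertion of a leaf -/

/-- The effect of a new leaf `j` above `v` on the vertex `C`. -/
def grow (v : Finset ℕ) (j : ℕ) (C : Finset ℕ) : Finset ℕ := if v ⊆ C then insert j C else C

theorem grow_inter {v C : Finset ℕ} {j : ℕ} (hj : j ∉ K) : grow v j C ∩ K = C ∩ K := by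
  unfold grow
  split_ifs
  · rw [Finset.insert_inter_of_notMem hj]
  · rfl

theorem mem_grow_of_ne {v C : Finset ℕ} {i j : ℕ} (hij : i ≠ j) : i ∈ grow v j C ↔ i ∈ C := by
  unfold grow
  split_ifs <;> simp [hij]

theorem mem_grow_self {v C : Finset ℕ} {j : ℕ} (hj : j ∉ C) : j ∈ grow v j C ↔ v ⊆ C := by
  unfold grow
  split_ifs with h <;> simp [h, hj]

theorem subset_grow {v C : Finset ℕ} {j : ℕ} : C ⊆ grow v j C := by
  unfold grow
  split_ifs <;> simp

theorem grow_erase {v C : Finset ℕ} {j : ℕ} (hj : j ∉ C) : (grow v j C).erase j = C := by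
  unfold grow
  split_ifs <;> simp [hj]

theorem grow_mono {v C D : Finset ℕ} {j : ℕ} (hCD : C ⊆ D) : grow v j C ⊆ grow v j D := by
  unfold grow
  split_ifs with h1 h2
  · exact Finset.insert_subset_insert _ hCD
  · exact absurd (h1.trans hCD) h2
  · exact hCD.trans (Finset.subset_insert _ _)
  · exact hCD

theorem mem_insertAtVertex {v A : Finset ℕ} {j : ℕ} :
    A ∈ insertAtVertex t v j ↔ A = {j} ∨ ∃ C ∈ t, grow v j C = A := by
  simp [insertAtVertex, grow]

theorem mem_insertAtEdge {c A : Finset ℕ} {j : ℕ} :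
    A ∈ insertAtEdge t c j ↔ A = c ∨ A = {j} ∨ ∃ C ∈ t, grow c j C = A := by
  rw [insertAtEdge, Finset.mem_insert, mem_insertAtVertex]

theorem IsFragTree.notMem {A : Finset ℕ} {j : ℕ} (h : IsFragTree B t) (hj : j ∉ B) (hA : A ∈ t) :
    j ∉ A := fun hjA => hj (h.subset A hA hjA)

theorem grow_injOn {v : Finset ℕ} {j : ℕ} (h : IsFragTree B t) (hj : j ∉ B) {C D : Finset ℕ}
    (hC : C ∈ t) (hD : D ∈ t) (he : grow v j C = grow v j D) : C = D := by
  rw [← grow_erase (v := v) (h.notMem hj hC), he, grow_erase (h.notMem hj hD)]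

theorem disjoint_grow {v C D : Finset ℕ} {j : ℕ} (hjC : j ∉ C) (hjD : j ∉ D)
    (hCD : Disjoint C D) (hv : v.Nonempty) : Disjoint (grow v j C) (grow v j D) := by
  rw [Finset.disjoint_left] at hCD ⊢
  intro i hi hi'
  rcases eq_or_ne i j with rfl | hij
  · rw [mem_grow_self hjC] at hi
    rw [mem_grow_self hjD] at hi'
    obtain ⟨x, hx⟩ := hv
    exact hCD (hi hx) (hi' hx)
  · exact hCD ((mem_grow_of_ne hij).1 hi) ((mem_grow_of_ne hij).1 hi')

theorem disjoint_singleton_grow {v C : Finset ℕ} {j : ℕ} :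
    Disjoint {j} (grow v j C) ∨ ({j} : Finset ℕ) ⊆ grow v j C := by
  by_cases hj : j ∈ grow v j C
  · exact Or.inr (by simpa using hj)
  · exact Or.inl (by simpa using hj)

theorem grow_of_not_subset {v C : Finset ℕ} {j : ℕ} (h : ¬ v ⊆ C) : grow v j C = C := if_neg h

theorem grow_of_subset {v C : Finset ℕ} {j : ℕ} (h : v ⊆ C) : grow v j C = insert j C := if_pos h

theorem IsFragTree.laminar_insertAtVertex {v : Finset ℕ} {j : ℕ} (h : IsFragTree B t)
    (hj : j ∉ B) (hv : v ∈ t) {A C : Finset ℕ} (hA : A ∈ insertAtVertex t v j)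
    (hC : C ∈ insertAtVertex t v j) : Disjoint A C ∨ A ⊆ C ∨ C ⊆ A := by
  rcases mem_insertAtVertex.1 hA with rfl | ⟨A, hA', rfl⟩ <;>
    rcases mem_insertAtVertex.1 hC with rfl | ⟨C, hC', rfl⟩
  · exact Or.inr (Or.inl subset_rfl)
  · rcases disjoint_singleton_grow (v := v) (C := C) (j := j) with h | h
    · exact Or.inl h
    · exact Or.inr (Or.inl h)
  · rcases disjoint_singleton_grow (v := v) (C := A) (j := j) with h | h
    · exact Or.inl h.symm
    · exact Or.inr (Or.inr h)
  · rcases h.laminar A hA' C hC' with hd | hd | hd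
    · exact Or.inl (disjoint_grow (h.notMem hj hA') (h.notMem hj hC') hd (h.nonempty v hv))
    · exact Or.inr (Or.inl (grow_mono hd))
    · exact Or.inr (Or.inr (grow_mono hd))

theorem IsFragTree.subset_of_mem_insertAtVertex {v : Finset ℕ} {j : ℕ} (h : IsFragTree B t)
    {A : Finset ℕ} (hA : A ∈ insertAtVertex t v j) : A ⊆ insert j B := by
  rcases mem_insertAtVertex.1 hA with rfl | ⟨C, hC, rfl⟩
  · simp
  · unfold grow
    split_ifs
    · exact Finset.insert_subset_insert _ (h.subset C hC)
    · exact (h.subset C hC).trans (Finset.subset_insert _ _)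

theorem IsFragTree.nonempty_of_mem_insertAtVertex {v : Finset ℕ} {j : ℕ} (h : IsFragTree B t)
    {A : Finset ℕ} (hA : A ∈ insertAtVertex t v j) : A.Nonempty := by
  rcases mem_insertAtVertex.1 hA with rfl | ⟨C, hC, rfl⟩
  · simp
  · exact (h.nonempty C hC).mono subset_grow

theorem IsFragTree.ancestor_mem_insertAtVertex {v : Finset ℕ} {j : ℕ} (h : IsFragTree B t)
    (hv : v ∈ t) : insert j B ∈ insertAtVertex t v j :=
  mem_insertAtVertex.2 (Or.inr ⟨B, h.ancestor_mem, grow_of_subset (h.subset v hv)⟩)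

theorem IsFragTree.insertAtVertex {v : Finset ℕ} {j : ℕ} (h : IsFragTree B t) (hj : j ∉ B)
    (hv : v ∈ branchPoints t) : IsFragTree (insert j B) (insertAtVertex t v j) where
  nonempty A hA := h.nonempty_of_mem_insertAtVertex hA
  subset A hA := h.subset_of_mem_insertAtVertex hA
  ancestor_mem := h.ancestor_mem_insertAtVertex (Finset.mem_filter.1 hv).1
  leaf_mem i hi := by
    rw [mem_insertAtVertex]
    rcases Finset.mem_insert.1 hi with rfl | hi
    · exact Or.inl rfl
    · refine Or.inr ⟨{i}, h.leaf_mem i hi, grow_of_not_subset fun hvi => ?_⟩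
      have := Finset.card_le_card hvi
      have := (Finset.mem_filter.1 hv).2
      simp at *
      omega
  laminar A hA C hC := h.laminar_insertAtVertex hj (Finset.mem_filter.1 hv).1 hA hC

theorem IsFragTree.laminar_insertAtEdge {c : Finset ℕ} {j : ℕ} (h : IsFragTree B t)
    (hj : j ∉ B) (hc : c ∈ t) {A : Finset ℕ} (hA : A ∈ AlphaGamma.insertAtVertex t c j) :
    Disjoint c A ∨ c ⊆ A ∨ A ⊆ c := by
  rcases mem_insertAtVertex.1 hA with rfl | ⟨A, hA', rfl⟩
  · exact Or.inl (by simpa using h.notMem hj hc)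
  · by_cases hcA : c ⊆ A
    · exact Or.inr (Or.inl (hcA.trans subset_grow))
    · rw [grow_of_not_subset hcA]
      exact h.laminar c hc A hA'

theorem IsFragTree.insertAtEdge {c : Finset ℕ} {j : ℕ} (h : IsFragTree B t) (hj : j ∉ B)
    (hc : c ∈ t) : IsFragTree (insert j B) (insertAtEdge t c j) where
  nonempty A hA := by
    rcases Finset.mem_insert.1 hA with rfl | hA
    · exact h.nonempty _ hc
    · exact h.nonempty_of_mem_insertAtVertex hA
  subset A hA := by
    rcases Finset.mem_insert.1 hA with rfl | hA
    · exact (h.subset _ hc).trans (Finset.subset_insert _ _)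
    · exact h.subset_of_mem_insertAtVertex hA
  ancestor_mem := Finset.mem_insert_of_mem (h.ancestor_mem_insertAtVertex hc)
  leaf_mem i hi := by
    rw [mem_insertAtEdge]
    rcases Finset.mem_insert.1 hi with rfl | hi
    · exact Or.inr (Or.inl rfl)
    · by_cases hci : c ⊆ {i}
      · rcases Finset.subset_singleton_iff.1 hci with h0 | h0
        · exact absurd h0 (h.nonempty c hc).ne_empty
        · exact Or.inl h0.symm
      · exact Or.inr (Or.inr ⟨{i}, h.leaf_mem i hi, grow_of_not_subset hci⟩)
  laminar A hA C hC := by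
    rcases Finset.mem_insert.1 hA with rfl | hA <;> rcases Finset.mem_insert.1 hC with rfl | hC
    · exact Or.inr (Or.inl subset_rfl)
    · exact h.laminar_insertAtEdge hj hc hC
    · rcases h.laminar_insertAtEdge hj hc hA with hd | hd | hd
      · exact Or.inl hd.symm
      · exact Or.inr (Or.inr hd)
      · exact Or.inr (Or.inl hd)
    · exact h.laminar_insertAtVertex hj hc hA hC

/-- The label set `c` survives in `insertAtEdge` as the upper end of the split edge, while the new
branch point is `insert j c`. That `c` is not already present makes the insertion lengthen an edge
by exactly one. -/
theorem notMem_insertAtVertex {c : Finset ℕ} {j : ℕ} (hjc : j ∉ c) :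
    c ∉ insertAtVertex t c j := by
  intro hA
  rcases mem_insertAtVertex.1 hA with rfl | ⟨C, -, he⟩
  · simp at hjc
  · by_cases hcC : c ⊆ C
    · rw [grow_of_subset hcC] at he
      exact hjc (he ▸ Finset.mem_insert_self j C)
    · rw [grow_of_not_subset hcC] at he
      exact hcC he.symm.subset

/-- The trace on `K` of the vertices of the tree with a new leaf. -/
theorem image_inter_insertAtVertex {v : Finset ℕ} {j : ℕ} (hj : j ∉ K) :
    ((AlphaGamma.insertAtVertex t v j).image fun A => A ∩ K).erase ∅ =
      (t.image fun A => A ∩ K).erase ∅ := by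
  ext C
  simp only [Finset.mem_erase, Finset.mem_image, mem_insertAtVertex]
  refine and_congr_right fun hne => ?_
  constructor
  · rintro ⟨A, rfl | ⟨D, hD, rfl⟩, rfl⟩
    · exact absurd (Finset.singleton_inter_of_notMem hj) hne
    · exact ⟨D, hD, (grow_inter hj).symm⟩
  · rintro ⟨D, hD, rfl⟩
    exact ⟨_, Or.inr ⟨D, hD, rfl⟩, grow_inter hj⟩

theorem IsFragTree.reducedShape_insertAtVertex {v : Finset ℕ} {j : ℕ} (h : IsFragTree B t)
    (hK : K ⊆ B) (hj : j ∉ B) (hv : v ∈ branchPoints t) :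
    reducedShape (AlphaGamma.insertAtVertex t v j) K = reducedShape t K := by
  rw [(h.insertAtVertex hj hv).reducedShape_eq (hK.trans (Finset.subset_insert _ _)),
    h.reducedShape_eq hK, image_inter_insertAtVertex fun hjK => hj (hK hjK)]

theorem IsFragTree.reducedShape_insertAtEdge {c : Finset ℕ} {j : ℕ} (h : IsFragTree B t)
    (hK : K ⊆ B) (hj : j ∉ B) (hc : c ∈ t) :
    reducedShape (AlphaGamma.insertAtEdge t c j) K = reducedShape t K := by
  rw [(h.insertAtEdge hj hc).reducedShape_eq (hK.trans (Finset.subset_insert _ _)),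
    h.reducedShape_eq hK, AlphaGamma.insertAtEdge, Finset.image_insert,
    ← image_inter_insertAtVertex (t := t) (v := c) fun hjK => hj (hK hjK),
    Finset.insert_eq_of_mem]
  exact Finset.mem_image.2 ⟨grow c j c, mem_insertAtVertex.2 (Or.inr ⟨c, hc, rfl⟩),
    grow_inter fun hjK => hj (hK hjK)⟩

theorem IsFragTree.card_filter_insertAtVertex {v C : Finset ℕ} {j : ℕ} (h : IsFragTree B t)
    (hK : K ⊆ B) (hj : j ∉ B) (hC : C.Nonempty) :
    ((AlphaGamma.insertAtVertex t v j).filter fun E => E ∩ K = C).card =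
      (t.filter fun E => E ∩ K = C).card := by
  have hjK : j ∉ K := fun hjK => hj (hK hjK)
  rw [← Finset.card_image_of_injOn (s := t.filter fun E => E ∩ K = C) (f := grow v j)]
  · congr 1
    ext A
    simp only [Finset.mem_filter, Finset.mem_image, mem_insertAtVertex]
    constructor
    · rintro ⟨rfl | ⟨D, hD, rfl⟩, rfl⟩
      · simp [Finset.singleton_inter_of_notMem hjK] at hC
      · exact ⟨D, ⟨hD, (grow_inter hjK).symm⟩, rfl⟩
    · rintro ⟨D, ⟨hD, rfl⟩, rfl⟩
      exact ⟨Or.inr ⟨D, hD, rfl⟩, grow_inter hjK⟩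
  · intro D hD E hE he
    exact grow_injOn h hj (Finset.mem_filter.1 hD).1 (Finset.mem_filter.1 hE).1 he

theorem IsFragTree.reducedLength_insertAtVertex {v C : Finset ℕ} {j : ℕ} (h : IsFragTree B t)
    (hK : K ⊆ B) (hj : j ∉ B) (hv : v ∈ branchPoints t) (hC : C.Nonempty) :
    reducedLength (AlphaGamma.insertAtVertex t v j) K C = reducedLength t K C := by
  rw [(h.insertAtVertex hj hv).reducedLength_eq (hK.trans (Finset.subset_insert _ _)) hC,
    h.reducedLength_eq hK hC, h.card_filter_insertAtVertex hK hj hC]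

theorem IsFragTree.reducedLength_insertAtEdge {c C : Finset ℕ} {j : ℕ} (h : IsFragTree B t)
    (hK : K ⊆ B) (hj : j ∉ B) (hc : c ∈ t) (hC : C.Nonempty) :
    reducedLength (AlphaGamma.insertAtEdge t c j) K C =
      reducedLength t K C + if c ∩ K = C then 1 else 0 := by
  rw [(h.insertAtEdge hj hc).reducedLength_eq (hK.trans (Finset.subset_insert _ _)) hC,
    h.reducedLength_eq hK hC, ← h.card_filter_insertAtVertex (v := c) hK hj hC,
    AlphaGamma.insertAtEdge, Finset.filter_insert]
  split_ifs with hcC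
  · rw [Finset.card_insert_of_notMem]
    exact fun hm => notMem_insertAtVertex (h.notMem hj hc) (Finset.mem_filter.1 hm).1
  · rfl

theorem onEdge_singleton {i : ℕ} : OnEdge t K {i} ↔
    ∃ A ∈ t, ∃ E ∈ t, i ∈ A ∧ i ∉ E ∧ A ∩ K = E ∩ K ∧ (A ∩ K).Nonempty := by
  simp [OnEdge]

/-- Whether the leaf `i` hangs off an edge depends only on which pairs of a nonempty trace and a
membership status of `i` occur among the vertices, and an insertion changes neither for old leaves.
-/
theorem onEdge_congr_of_ne {t' : Finset (Finset ℕ)} {i : ℕ}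
    (h1 : ∀ A ∈ t, ∃ A' ∈ t', A' ∩ K = A ∩ K ∧ (i ∈ A' ↔ i ∈ A))
    (h2 : ∀ A' ∈ t', (A' ∩ K).Nonempty → ∃ A ∈ t, A ∩ K = A' ∩ K ∧ (i ∈ A ↔ i ∈ A')) :
    OnEdge t' K {i} ↔ OnEdge t K {i} := by
  rw [onEdge_singleton, onEdge_singleton]
  constructor
  · rintro ⟨A', hA', E', hE', hi, hi', he, hn⟩
    obtain ⟨A, hA, hAK, hiA⟩ := h2 A' hA' hn
    obtain ⟨E, hE, hEK, hiE⟩ := h2 E' hE' (he ▸ hn)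
    exact ⟨A, hA, E, hE, hiA.2 hi, fun h => hi' (hiE.1 h), by rw [hAK, hEK, he], hAK ▸ hn⟩
  · rintro ⟨A', hA', E', hE', hi, hi', he, hn⟩
    obtain ⟨A, hA, hAK, hiA⟩ := h1 A' hA'
    obtain ⟨E, hE, hEK, hiE⟩ := h1 E' hE'
    exact ⟨A, hA, E, hE, hiA.2 hi, fun h => hi' (hiE.1 h), by rw [hAK, hEK, he], hAK ▸ hn⟩

theorem onEdge_insertAtVertex_of_ne {v : Finset ℕ} {i j : ℕ} (hjK : j ∉ K) (hij : i ≠ j) :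
    OnEdge (insertAtVertex t v j) K {i} ↔ OnEdge t K {i} := by
  refine onEdge_congr_of_ne (fun A hA => ⟨grow v j A, mem_insertAtVertex.2 (Or.inr ⟨A, hA, rfl⟩),
    grow_inter hjK, mem_grow_of_ne hij⟩) fun A hA hn => ?_
  rcases mem_insertAtVertex.1 hA with rfl | ⟨A, hA', rfl⟩
  · simp [Finset.singleton_inter_of_notMem hjK] at hn
  · exact ⟨A, hA', (grow_inter hjK).symm, (mem_grow_of_ne hij).symm⟩

theorem onEdge_insertAtEdge_of_ne {c : Finset ℕ} {i j : ℕ} (hc : c ∈ t) (hjK : j ∉ K)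
    (hij : i ≠ j) : OnEdge (insertAtEdge t c j) K {i} ↔ OnEdge t K {i} := by
  refine onEdge_congr_of_ne (fun A hA => ⟨grow c j A, mem_insertAtEdge.2
    (Or.inr (Or.inr ⟨A, hA, rfl⟩)), grow_inter hjK, mem_grow_of_ne hij⟩) fun A hA hn => ?_
  rcases mem_insertAtEdge.1 hA with rfl | rfl | ⟨A, hA', rfl⟩
  · exact ⟨_, hc, rfl, Iff.rfl⟩
  · simp [Finset.singleton_inter_of_notMem hjK] at hn
  · exact ⟨A, hA', (grow_inter hjK).symm, (mem_grow_of_ne hij).symm⟩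

/-- The new label lies in `grow v j C` exactly when `v ⊆ C`, so the new leaf inherits the position
of `v`. For this reason `OnEdge` is defined for all vertices and not just for leaves. -/
theorem IsFragTree.onEdge_insertAtVertex_self {v : Finset ℕ} {j : ℕ} (h : IsFragTree B t)
    (hK : K ⊆ B) (hj : j ∉ B) :
    OnEdge (AlphaGamma.insertAtVertex t v j) K {j} ↔ OnEdge t K v := by
  have hjK : j ∉ K := fun hjK => hj (hK hjK)
  rw [onEdge_singleton]
  constructor
  · rintro ⟨A', hA', E', hE', hi, hi', he, hn⟩
    rcases mem_insertAtVertex.1 hA' with rfl | ⟨A, hA, rfl⟩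
    · simp [Finset.singleton_inter_of_notMem hjK] at hn
    rcases mem_insertAtVertex.1 hE' with rfl | ⟨E, hE, rfl⟩
    · simp at hi'
    rw [mem_grow_self (h.notMem hj hA)] at hi
    rw [mem_grow_self (h.notMem hj hE)] at hi'
    rw [grow_inter hjK] at he hn
    rw [grow_inter hjK] at he
    exact ⟨A, hA, E, hE, hi, hi', he, hn⟩
  · rintro ⟨A, hA, E, hE, hi, hi', he, hn⟩
    refine ⟨grow v j A, mem_insertAtVertex.2 (Or.inr ⟨A, hA, rfl⟩), grow v j E,
      mem_insertAtVertex.2 (Or.inr ⟨E, hE, rfl⟩), ?_, ?_, ?_, ?_⟩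
    · rwa [mem_grow_self (h.notMem hj hA)]
    · rwa [mem_grow_self (h.notMem hj hE)]
    · rw [grow_inter hjK, grow_inter hjK, he]
    · rwa [grow_inter hjK]

/-- The additional alternative comes from the split edge: `c` and `insert j c` have the same trace
and are separated by `j`, so if that trace is nonempty the new leaf hangs off an edge of the reduced
tree. -/
theorem IsFragTree.onEdge_insertAtEdge_self {c : Finset ℕ} {j : ℕ} (h : IsFragTree B t)
    (hK : K ⊆ B) (hj : j ∉ B) (hc : c ∈ t) :
    OnEdge (AlphaGamma.insertAtEdge t c j) K {j} ↔ (c ∩ K).Nonempty ∨ OnEdge t K c := by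
  have hjK : j ∉ K := fun hjK => hj (hK hjK)
  constructor
  · rw [onEdge_singleton]
    rintro ⟨A', hA', E', hE', hi, hi', he, hn⟩
    rcases Finset.mem_insert.1 hA' with rfl | hA'
    · exact absurd hi (h.notMem hj hc)
    rcases Finset.mem_insert.1 hE' with rfl | hE'
    · exact Or.inl (he ▸ hn)
    · exact Or.inr ((h.onEdge_insertAtVertex_self hK hj).1
        (onEdge_singleton.2 ⟨A', hA', E', hE', hi, hi', he, hn⟩))
  · rintro (hn | hoe)
    · rw [onEdge_singleton]
      refine ⟨grow c j c, mem_insertAtEdge.2 (Or.inr (Or.inr ⟨c, hc, rfl⟩)), c,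
        mem_insertAtEdge.2 (Or.inl rfl), ?_, h.notMem hj hc, grow_inter hjK, ?_⟩
      · rw [mem_grow_self (h.notMem hj hc)]
      · rwa [grow_inter hjK]
    · obtain ⟨A, hA, E, hE, hr⟩ := (h.onEdge_insertAtVertex_self (v := c) hK hj).2 hoe
      exact ⟨A, Finset.mem_insert_of_mem hA, E, Finset.mem_insert_of_mem hE, hr⟩

open Classical in
theorem IsFragTree.edgeLeafCount_insertAtVertex {v : Finset ℕ} {j : ℕ} (h : IsFragTree B t)
    (hK : K ⊆ B) (hj : j ∉ B) (hv : v ∈ branchPoints t) :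
    edgeLeafCount (AlphaGamma.insertAtVertex t v j) (insert j B) K =
      edgeLeafCount t B K + if OnEdge t K v then 1 else 0 := by
  have hjK : j ∉ K := fun hjK => hj (hK hjK)
  rw [(h.insertAtVertex hj hv).edgeLeafCount_eq (hK.trans (Finset.subset_insert _ _)),
    h.edgeLeafCount_eq hK, Finset.insert_sdiff_of_notMem _ hjK, Finset.filter_insert,
    h.onEdge_insertAtVertex_self hK hj]
  have : (B \ K).filter (fun i => OnEdge (AlphaGamma.insertAtVertex t v j) K {i}) =
      (B \ K).filter (fun i => OnEdge t K {i}) := by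
    refine Finset.filter_congr fun i hi => onEdge_insertAtVertex_of_ne hjK ?_
    rintro rfl
    exact hj (Finset.mem_sdiff.1 hi).1
  rw [this]
  split_ifs
  · exact Finset.card_insert_of_notMem (by simp [hj])
  · rfl

open Classical in
theorem IsFragTree.edgeLeafCount_insertAtEdge {c : Finset ℕ} {j : ℕ} (h : IsFragTree B t)
    (hK : K ⊆ B) (hj : j ∉ B) (hc : c ∈ t) :
    edgeLeafCount (AlphaGamma.insertAtEdge t c j) (insert j B) K =
      edgeLeafCount t B K + if (c ∩ K).Nonempty ∨ OnEdge t K c then 1 else 0 := by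
  have hjK : j ∉ K := fun hjK => hj (hK hjK)
  rw [(h.insertAtEdge hj hc).edgeLeafCount_eq (hK.trans (Finset.subset_insert _ _)),
    h.edgeLeafCount_eq hK, Finset.insert_sdiff_of_notMem _ hjK, Finset.filter_insert,
    h.onEdge_insertAtEdge_self hK hj hc]
  have : (B \ K).filter (fun i => OnEdge (AlphaGamma.insertAtEdge t c j) K {i}) =
      (B \ K).filter (fun i => OnEdge t K {i}) := by
    refine Finset.filter_congr fun i hi => onEdge_insertAtEdge_of_ne hc hjK ?_
    rintro rfl
    exact hj (Finset.mem_sdiff.1 hi).1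
  rw [this]
  split_ifs
  · exact Finset.card_insert_of_notMem (by simp [hj])
  · rfl

end Combinatorics
end AlphaGamma

namespace AlphaGamma

/-! ### Weight counts -/

section Weights

variable {B K : Finset ℕ} {t : Finset (Finset ℕ)} {α γ : ℝ}

theorem mem_branchPoints {A : Finset ℕ} : A ∈ branchPoints t ↔ A ∈ t ∧ 2 ≤ A.card := by
  simp [branchPoints]

theorem IsFragTree.one_le_card (h : IsFragTree B t) {A : Finset ℕ} (hA : A ∈ t) : 1 ≤ A.card :=
  Finset.card_pos.2 (h.nonempty A hA)

theorem IsFragTree.mem_branchPoints_of_ssubset (h : IsFragTree B t) {A D : Finset ℕ} (hA : A ∈ t)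
    (hD : D ∈ t) (hDA : D ⊂ A) : A ∈ branchPoints t := by
  refine mem_branchPoints.2 ⟨hA, ?_⟩
  have := Finset.card_lt_card hDA
  have := h.one_le_card hD
  omega

theorem IsFragTree.parent_unique (h : IsFragTree B t) {D v w : Finset ℕ} (hv : v ∈ t)
    (hw : w ∈ t) (hDv : D ∈ children t v) (hDw : D ∈ children t w) : v = w := by
  rw [mem_children] at hDv hDw
  obtain ⟨i, hi⟩ := h.nonempty D hDv.1
  by_contra hne
  rcases h.nested hv hw (hDv.2.1.1 hi) (hDw.2.1.1 hi) with hs | hs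
  · exact hDv.2.1.ne (hDw.2.2 v hv hDv.2.1.1 (hs.ssubset_of_ne hne)).symm
  · exact hDw.2.1.ne (hDv.2.2 w hw hDw.2.1.1 (hs.ssubset_of_ne (Ne.symm hne))).symm

theorem IsFragTree.exists_parent (h : IsFragTree B t) {D : Finset ℕ} (hD : D ∈ t) (hDB : D ≠ B) :
    ∃ v ∈ branchPoints t, D ∈ children t v := by
  obtain ⟨v, hv, hmin⟩ := (t.filter fun v => D ⊂ v).exists_min_image Finset.card
    ⟨B, by simp [h.ancestor_mem, (h.subset D hD).ssubset_of_ne hDB]⟩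
  simp only [Finset.mem_filter] at hv hmin
  refine ⟨v, h.mem_branchPoints_of_ssubset hv.1 hD hv.2,
    mem_children.2 ⟨hD, hv.2, fun E hE hDE hEv => ?_⟩⟩
  by_contra hne
  have := hmin E ⟨hE, hDE.ssubset_of_ne (Ne.symm hne)⟩
  have := Finset.card_lt_card hEv
  omega

theorem IsFragTree.sum_card_children (h : IsFragTree B t) {S : Finset (Finset ℕ)} (hS : S ⊆ t)
    (p : Finset ℕ → Prop) [DecidablePred p] :
    ∑ v ∈ S, ((children t v).filter p).card =
      (S.biUnion fun v => (children t v).filter p).card := by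
  rw [Finset.card_biUnion]
  intro v hv w hw hne
  rw [Function.onFun, Finset.disjoint_left]
  intro D hD hD'
  exact hne (h.parent_unique (hS hv) (hS hw) (Finset.mem_filter.1 hD).1 (Finset.mem_filter.1 hD').1)

/-- Every vertex other than the ancestor `B` is a child of exactly one vertex, and that vertex is a
branch point. -/
theorem IsFragTree.sum_card_children_branchPoints (h : IsFragTree B t) :
    ∑ v ∈ branchPoints t, (children t v).card + 1 = t.card := by
  have := h.sum_card_children (S := branchPoints t) (Finset.filter_subset _ _) (fun _ => True)
  simp only [Finset.filter_true] at this
  rw [this, ← Finset.card_erase_add_one h.ancestor_mem]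
  congr 2
  ext D
  simp only [Finset.mem_biUnion, Finset.mem_erase]
  constructor
  · rintro ⟨v, hv, hD⟩
    rw [mem_children] at hD
    refine ⟨?_, hD.1⟩
    rintro rfl
    exact hD.2.1.2 (h.subset v (mem_branchPoints.1 hv).1)
  · rintro ⟨hne, hD⟩
    exact h.exists_parent hD hne

theorem IsFragTree.card_leaves (h : IsFragTree B t) :
    (t.filter fun A => A.card = 1).card = B.card := by
  rw [← Finset.card_image_of_injective B Finset.singleton_injective]
  congr 1
  ext A
  simp only [Finset.mem_filter, Finset.mem_image, Finset.card_eq_one]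
  constructor
  · rintro ⟨hA, i, rfl⟩
    exact ⟨i, by simpa using h.subset _ hA, rfl⟩
  · rintro ⟨i, hi, rfl⟩
    exact ⟨h.leaf_mem i hi, i, rfl⟩

theorem sum_edgeWeight (s : Finset (Finset ℕ)) : ∑ A ∈ s, edgeWeight α γ A =
    (s.filter fun A => A.card = 1).card * (1 - α) +
      (s.filter fun A => ¬ A.card = 1).card * γ := by
  simp only [edgeWeight, Finset.sum_ite, Finset.sum_const, nsmul_eq_mul]

theorem sum_vertexWeight (s : Finset (Finset ℕ)) : ∑ v ∈ s, vertexWeight α γ t v =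
    (∑ v ∈ s, ((children t v).card : ℝ)) * α - s.card * (α + γ) := by
  simp only [vertexWeight, Finset.sum_sub_distrib, ← Finset.sum_mul, Finset.sum_const,
    nsmul_eq_mul, mul_one]
  ring

theorem IsFragTree.filter_card_ne_one (h : IsFragTree B t) {s : Finset (Finset ℕ)} (hs : s ⊆ t) :
    (s.filter fun A => ¬ A.card = 1) = s.filter fun A => 2 ≤ A.card := by
  refine Finset.filter_congr fun A hA => ?_
  have := h.one_le_card (hs hA)
  omega

/-- With `N` leaves and `b` branch points the edges weigh `N (1 - α) + b γ`. The branch points have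
`N + b - 1` children altogether and so weigh `(N - 1) α - b γ`. The dependence on `b` cancels. -/
theorem IsFragTree.totalWeight_eq (h : IsFragTree B t) : totalWeight α γ t = B.card - α := by
  have h1 := h.sum_card_children_branchPoints
  have h2 := Finset.card_filter_add_card_filter_not (s := t) (fun A => A.card = 1)
  rw [h.card_leaves] at h2
  rw [totalWeight, sum_edgeWeight, sum_vertexWeight, h.card_leaves,
    h.filter_card_ne_one subset_rfl] at *
  change B.card + (branchPoints t).card = _ at h2
  change _ + ((branchPoints t).card : ℝ) * γ + _ = _
  have h1' : ∑ v ∈ branchPoints t, ((children t v).card : ℝ) = t.card - 1 := by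
    rw [← h1]; push_cast; ring
  have h2' : (t.card : ℝ) = B.card + (branchPoints t).card := by exact_mod_cast h2.symm
  rw [h1', h2']
  ring

/-- A child is a proper subset, and a label that it misses belongs to a second child. This makes the
weight of a branch point at least `α - γ`. -/
theorem IsFragTree.two_le_card_children (h : IsFragTree B t) {v : Finset ℕ}
    (hv : v ∈ branchPoints t) : 2 ≤ (children t v).card := by
  obtain ⟨hvt, hv2⟩ := mem_branchPoints.1 hv
  have key : ∀ i ∈ v, ∃ C ∈ children t v, i ∈ C := by
    intro i hi
    obtain ⟨C, hC, hiC⟩ := exists_mem_children (h.leaf_mem i (h.subset v hvt hi))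
      ((Finset.singleton_subset_iff.2 hi).ssubset_of_ne (by rintro rfl; simp at hv2))
    exact ⟨C, hC, by simpa using hiC⟩
  obtain ⟨i, hi⟩ := h.nonempty v hvt
  obtain ⟨C, hC, hiC⟩ := key i hi
  obtain ⟨x, hx, hxC⟩ := Finset.exists_of_ssubset (mem_children.1 hC).2.1
  obtain ⟨C', hC', hxC'⟩ := key x hx
  exact Finset.one_lt_card.2 ⟨C, hC, C', hC', by rintro rfl; exact hxC hxC'⟩

theorem IsFragTree.vertexWeight_nonneg (h : IsFragTree B t) (hα : 0 ≤ α) (hγα : γ ≤ α)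
    {v : Finset ℕ} (hv : v ∈ branchPoints t) : 0 ≤ vertexWeight α γ t v := by
  have : (2 : ℝ) ≤ (children t v).card := by exact_mod_cast h.two_le_card_children hv
  rw [vertexWeight]
  nlinarith

theorem edgeWeight_pos (hα1 : α < 1) (hγ : 0 < γ) (A : Finset ℕ) : 0 < edgeWeight α γ A := by
  rw [edgeWeight]
  split_ifs <;> linarith

/-- The total weight of the edges of `t` that form the edge `C` of the reduced tree. -/
theorem IsFragTree.sum_edgeWeight_trace (h : IsFragTree B t) (hK : K ⊆ B) {C : Finset ℕ}
    (hC : C ∈ reducedShape t K) : ∑ E ∈ t.filter (fun E => E ∩ K = C), edgeWeight α γ E =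
      edgeWeight α γ C + γ * ((reducedLength t K C : ℝ) - 1) := by
  rw [h.reducedShape_eq hK, Finset.mem_erase] at hC
  have hne : C.Nonempty := Finset.nonempty_iff_ne_empty.2 hC.1
  rw [h.reducedLength_eq hK hne]
  have hCK : ∀ E, E ∩ K = C → C ⊆ E ∧ C ⊆ K := by
    rintro E rfl
    exact ⟨Finset.inter_subset_left, Finset.inter_subset_right⟩
  obtain ⟨A, hA, hAC⟩ := Finset.mem_image.1 hC.2
  -- Only `C` itself can be a singleton among the edges with trace `C`. It is then a leaf edge of
  -- weight `1 - α`, while all other edges of the fibre weigh `γ`.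
  by_cases hC1 : C.card = 1
  · have hmem : C ∈ t.filter (fun E => E ∩ K = C) := by
      obtain ⟨i, rfl⟩ := Finset.card_eq_one.1 hC1
      have hi : i ∈ K := by simpa using (hCK A hAC).2
      simp [h.leaf_mem i (hK hi), hi]
    rw [← Finset.add_sum_erase _ _ hmem, ← Finset.card_erase_add_one hmem,
      Finset.sum_congr rfl (g := fun _ => γ)]
    · simp only [Finset.sum_const, nsmul_eq_mul]
      push_cast
      ring
    · intro E hE
      simp only [Finset.mem_erase, Finset.mem_filter] at hE
      rw [edgeWeight, if_neg]
      have := Finset.card_lt_card ((hCK E hE.2.2).1.ssubset_of_ne (Ne.symm hE.1))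
      omega
  · rw [Finset.sum_congr rfl (g := fun _ => γ)]
    · rw [edgeWeight, if_neg hC1]
      simp only [Finset.sum_const, nsmul_eq_mul]
      ring
    · intro E hE
      simp only [Finset.mem_filter] at hE
      rw [edgeWeight, if_neg]
      have := Finset.card_le_card (hCK E hE.2).1
      have := hne.card_pos
      omega

theorem IsFragTree.onEdge_of_mem_skeleton (h : IsFragTree B t) (hK : K ⊆ B) {v : Finset ℕ}
    (hv : v ∈ skeleton t K) : OnEdge t K v ↔ v ∉ retained t K := by
  rw [h.mem_retained hK]
  push Not
  constructor
  · rintro ⟨A, hA, E, hE, hvA, hvE, he, -⟩ -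
    obtain ⟨x, hx⟩ := (mem_skeleton.1 hv).2
    have hsub : v ∩ K ⊆ E ∩ K := he ▸ Finset.inter_subset_inter_right hvA
    have hEv : E ⊆ v := (h.nested hE (skeleton_subset hv) (Finset.mem_inter.1 (hsub hx)).1
      (Finset.mem_inter.1 hx).1).resolve_right hvE
    exact ⟨E, hE, Finset.Subset.antisymm (Finset.inter_subset_inter_right hEv) hsub, hEv, hvE⟩
  · intro hr
    obtain ⟨D, hD, hDK, hDv⟩ := hr hv
    exact ⟨v, skeleton_subset hv, D, hD, subset_rfl, hDv.2, hDK.symm, (mem_skeleton.1 hv).2⟩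

theorem IsFragTree.card_skeleton (h : IsFragTree B t) (hK : K ⊆ B) :
    ∑ C ∈ reducedShape t K, reducedLength t K C = (skeleton t K).card := by
  rw [Finset.card_eq_sum_card_fiberwise (f := fun A => A ∩ K) (t := reducedShape t K)]
  · refine Finset.sum_congr rfl fun C hC => ?_
    rw [h.reducedShape_eq hK, Finset.mem_erase] at hC
    have hne : C.Nonempty := Finset.nonempty_iff_ne_empty.2 hC.1
    rw [h.reducedLength_eq hK hne, skeleton, Finset.filter_filter]
    congr 1
    refine Finset.filter_congr fun E _ => ?_
    constructor
    · rintro rfl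
      exact ⟨hne, rfl⟩
    · exact fun h => h.2
  · intro A hA
    rw [h.reducedShape_eq hK]
    have := mem_skeleton.1 hA
    simp only [Finset.coe_erase, Finset.coe_image, Set.mem_sdiff, Set.mem_image,
      Set.mem_singleton_iff]
    exact ⟨⟨A, this.1, rfl⟩, this.2.ne_empty⟩

theorem IsFragTree.card_retained (h : IsFragTree B t) (hK : K ⊆ B) :
    (reducedShape t K).card = (retained t K).card := by
  rw [reducedShape, Finset.card_image_of_injOn]
  intro A hA D hD he
  obtain ⟨hAs, hA'⟩ := (h.mem_retained hK).1 hA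
  obtain ⟨hDs, hD'⟩ := (h.mem_retained hK).1 hD
  change A ∩ K = D ∩ K at he
  obtain ⟨i, hi⟩ := (mem_skeleton.1 hAs).2
  by_contra hne
  rcases h.nested (skeleton_subset hAs) (skeleton_subset hDs) (Finset.mem_inter.1 hi).1
    (Finset.mem_inter.1 (he ▸ hi)).1 with hs | hs
  · exact hD' A (skeleton_subset hAs) he (hs.ssubset_of_ne hne)
  · exact hA' D (skeleton_subset hDs) he.symm (hs.ssubset_of_ne (Ne.symm hne))

/-- A vertex of the tree containing `D` but not `v` must be `D`, because `D` is a child of `v`, and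
`D` has empty trace. So nothing with nonempty trace distinguishes `D` from `v`, and `OnEdge` is
constant along pendant subtrees. -/
theorem IsFragTree.onEdge_parent (h : IsFragTree B t) {v D : Finset ℕ}
    (hD : D ∈ children t v) (hDK : ¬ (D ∩ K).Nonempty) (hvt : v ∈ t) :
    OnEdge t K v ↔ OnEdge t K D := by
  obtain ⟨hDt, hDv, hmax⟩ := mem_children.1 hD
  obtain ⟨x, hx⟩ := h.nonempty D hDt
  constructor
  · rintro ⟨A, hA, E, hE, hvA, hvE, he, hn⟩
    refine ⟨A, hA, E, hE, hDv.1.trans hvA, fun hDE => ?_, he, hn⟩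
    have hEv : E ⊆ v := (h.nested hE hvt (hDE hx) (hDv.1 hx)).resolve_right hvE
    have := hmax E hE hDE ⟨hEv, hvE⟩
    subst this
    exact hDK (he ▸ hn)
  · rintro ⟨A, hA, E, hE, hDA, hDE, he, hn⟩
    refine ⟨A, hA, E, hE, ?_, fun hvE => hDE (hDv.1.trans hvE), he, hn⟩
    by_contra hvA
    have hAv : A ⊆ v := (h.nested hA hvt (hDA hx) (hDv.1 hx)).resolve_right hvA
    have := hmax A hA hDA ⟨hAv, hvA⟩
    subst this
    exact hDK hn

open Classical in
/-- The total weight of the edges and branch points at which an insertion leads to a leaf attached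
to an edge of the reduced tree. -/
theorem IsFragTree.sum_weight_onEdge (h : IsFragTree B t) (hK : K ⊆ B) :
    ∑ A ∈ t.filter (fun A => (A ∩ K).Nonempty ∨ OnEdge t K A), edgeWeight α γ A +
      ∑ v ∈ (branchPoints t).filter (fun v => OnEdge t K v), vertexWeight α γ t v =
    ∑ C ∈ reducedShape t K, edgeWeight α γ C + edgeLeafCount t B K := by
  -- `S2` holds the degree-2 vertices of the spanned subtree, `off` the vertices of the subtrees
  -- hanging off them, `P` the branch points concerned. The edges contribute the weight of the
  -- reduced tree, `γ |S2|`, and the edges of `off`. Since `P` is `S2` together with the non-leaves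
  -- of `off`, and its elements have `|off| + |S2|` children, all multiples of `γ` cancel and each
  -- leaf of `off` ends up with weight `(1 - α) + α = 1`.
  set S2 := skeleton t K \ retained t K with hS2
  set off := t.filter (fun A => ¬ (A ∩ K).Nonempty ∧ OnEdge t K A) with hoff
  set P := (branchPoints t).filter (fun v => OnEdge t K v) with hP
  have hS2P : S2 ⊆ P := by
    intro v hv
    obtain ⟨hvs, hvr⟩ := Finset.mem_sdiff.1 hv
    have hoe := (h.onEdge_of_mem_skeleton hK hvs).2 hvr
    rw [h.mem_retained hK] at hvr
    push Not at hvr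
    obtain ⟨D, hD, -, hDv⟩ := hvr hvs
    exact Finset.mem_filter.2
      ⟨h.mem_branchPoints_of_ssubset (skeleton_subset hvs) hD hDv, hoe⟩
  have hPt : P ⊆ t := (Finset.filter_subset _ _).trans (Finset.filter_subset _ _)
  -- edges
  have e1 : ∑ A ∈ t.filter (fun A => (A ∩ K).Nonempty ∨ OnEdge t K A), edgeWeight α γ A =
      ∑ A ∈ skeleton t K, edgeWeight α γ A + ∑ A ∈ off, edgeWeight α γ A := by
    rw [← Finset.sum_union]
    · congr 1
      ext A
      simp only [skeleton, hoff, Finset.mem_filter, Finset.mem_union]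
      tauto
    · rw [Finset.disjoint_left]
      intro A hA hA'
      exact (Finset.mem_filter.1 hA').2.1 (mem_skeleton.1 hA).2
  have e2 : ∑ A ∈ skeleton t K, edgeWeight α γ A =
      ∑ C ∈ reducedShape t K, edgeWeight α γ C + γ * S2.card := by
    have hmaps : ∀ A ∈ skeleton t K, A ∩ K ∈ reducedShape t K := by
      intro A hA
      rw [h.reducedShape_eq hK, Finset.mem_erase]
      have := mem_skeleton.1 hA
      exact ⟨this.2.ne_empty, Finset.mem_image.2 ⟨A, this.1, rfl⟩⟩
    have hcard : (S2.card : ℝ) = ∑ C ∈ reducedShape t K, ((reducedLength t K C : ℝ) - 1) := by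
      have hsub : retained t K ⊆ skeleton t K := Finset.filter_subset _ _
      rw [Finset.sum_sub_distrib, ← Nat.cast_sum, h.card_skeleton hK, Finset.sum_const,
        h.card_retained hK, hS2, Finset.card_sdiff_of_subset hsub,
        Nat.cast_sub (Finset.card_le_card hsub)]
      simp
    rw [← Finset.sum_fiberwise_of_maps_to hmaps, hcard, Finset.mul_sum, ← Finset.sum_add_distrib]
    refine Finset.sum_congr rfl fun C hC => ?_
    rw [← h.sum_edgeWeight_trace hK hC, skeleton, Finset.filter_filter]
    congr 1
    refine Finset.filter_congr fun E _ => ⟨fun h => h.2, ?_⟩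
    rintro rfl
    rw [h.reducedShape_eq hK, Finset.mem_erase] at hC
    exact ⟨Finset.nonempty_iff_ne_empty.2 hC.1, rfl⟩
  -- children
  have c1 : ∑ v ∈ P, (children t v).card = off.card + S2.card := by
    have hsplit : ∀ v, (children t v).card =
        ((children t v).filter fun D => ¬ (D ∩ K).Nonempty).card +
          ((children t v).filter fun D => (D ∩ K).Nonempty).card := fun v => by
      rw [add_comm, Finset.card_filter_add_card_filter_not]
    rw [Finset.sum_congr rfl fun v _ => hsplit v, Finset.sum_add_distrib]
    congr 1
    · rw [h.sum_card_children hPt]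
      congr 1
      ext D
      simp only [Finset.mem_biUnion, Finset.mem_filter, hP, hoff]
      constructor
      · rintro ⟨v, ⟨hv, hoe⟩, hD, hDK⟩
        exact ⟨(mem_children.1 hD).1, hDK,
          (h.onEdge_parent hD hDK (mem_branchPoints.1 hv).1).1 hoe⟩
      · rintro ⟨hD, hDK, hoe⟩
        have hDB : D ≠ B := by
          rintro rfl
          obtain ⟨A, hA, E, -, -, -, -, x, hx⟩ := hoe
          rw [Finset.mem_inter] at hx
          exact hDK ⟨x, Finset.mem_inter.2 ⟨h.subset A hA hx.1, hx.2⟩⟩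
        obtain ⟨v, hv, hDv⟩ := h.exists_parent hD hDB
        exact ⟨v, ⟨hv, (h.onEdge_parent hDv hDK (mem_branchPoints.1 hv).1).2 hoe⟩, hDv, hDK⟩
    -- Children with labels in `K`: a vertex of degree 2 has exactly one, a vertex outside the
    -- spanned subtree has none.
    · rw [← Finset.sum_subset hS2P, Finset.card_eq_sum_ones]
      · refine Finset.sum_congr rfl fun v hv => ?_
        obtain ⟨hvs, hvr⟩ := Finset.mem_sdiff.1 hv
        have hc : (children (skeleton t K) v).card = 1 := by
          by_contra hc
          exact hvr (Finset.mem_filter.2 ⟨hvs, by omega⟩)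
        rw [← hc]
        congr 1
        ext D
        rw [Finset.mem_filter, mem_children, mem_children, mem_skeleton]
        constructor
        · rintro ⟨⟨hD, hDv, hmax⟩, hn⟩
          exact ⟨⟨hD, hn⟩, hDv, fun E hE => hmax E (skeleton_subset hE)⟩
        · rintro ⟨⟨hD, hn⟩, hDv, hmax⟩
          exact ⟨⟨hD, hDv, fun E hE hDE => hmax E (mem_skeleton.2
            ⟨hE, hn.mono (Finset.inter_subset_inter_right hDE)⟩) hDE⟩, hn⟩
      · intro v hv hv2
        have hvs : v ∉ skeleton t K := by
          intro hvs
          exact hv2 (Finset.mem_sdiff.2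
            ⟨hvs, (h.onEdge_of_mem_skeleton hK hvs).1 (Finset.mem_filter.1 hv).2⟩)
        rw [Finset.card_eq_zero, Finset.filter_eq_empty_iff]
        intro D hD hn
        exact hvs (mem_skeleton.2
          ⟨hPt hv, hn.mono (Finset.inter_subset_inter_right (mem_children.1 hD).2.1.1)⟩)
  have c2 : P.card = S2.card + (off.filter fun A => ¬ A.card = 1).card := by
    rw [← Finset.card_union_of_disjoint]
    · congr 1
      ext v
      simp only [hP, hoff, Finset.mem_union, Finset.mem_filter]
      constructor
      · rintro ⟨hv, hoe⟩
        obtain ⟨hvt, hv2⟩ := mem_branchPoints.1 hv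
        by_cases hvK : (v ∩ K).Nonempty
        · have hvs := mem_skeleton.2 ⟨hvt, hvK⟩
          exact Or.inl (Finset.mem_sdiff.2 ⟨hvs, (h.onEdge_of_mem_skeleton hK hvs).1 hoe⟩)
        · exact Or.inr ⟨⟨hvt, hvK, hoe⟩, by omega⟩
      · rintro (hv | ⟨⟨hvt, hvK, hoe⟩, h1⟩)
        · exact Finset.mem_filter.1 (hS2P hv)
        · have := h.one_le_card hvt
          exact ⟨mem_branchPoints.2 ⟨hvt, by omega⟩, hoe⟩
    · rw [Finset.disjoint_left]
      intro v hv hv'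
      exact (Finset.mem_filter.1 (Finset.mem_filter.1 hv').1).2.1
        (mem_skeleton.1 (Finset.mem_sdiff.1 hv).1).2
  have c3 : (off.filter fun A => A.card = 1).card = edgeLeafCount t B K := by
    rw [h.edgeLeafCount_eq hK, ← Finset.card_image_of_injective _
      (Finset.singleton_injective (α := ℕ))]
    congr 1
    ext A
    simp only [hoff, Finset.mem_filter, Finset.mem_image, Finset.mem_sdiff]
    constructor
    · rintro ⟨⟨hA, hAK, hoe⟩, h1⟩
      obtain ⟨i, rfl⟩ := Finset.card_eq_one.1 h1
      refine ⟨i, ⟨⟨by simpa using h.subset _ hA, fun hi => hAK ⟨i, by simp [hi]⟩⟩, hoe⟩, rfl⟩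
    · rintro ⟨i, ⟨⟨hi, hiK⟩, hoe⟩, rfl⟩
      exact ⟨⟨h.leaf_mem i hi, by simp [Finset.singleton_inter_of_notMem hiK], hoe⟩, by simp⟩
  have c4 := Finset.card_filter_add_card_filter_not (s := off) (fun A => A.card = 1)
  rw [e1, e2, sum_edgeWeight off, sum_vertexWeight, ← Nat.cast_sum, c1, c2, ← c3, ← c4]
  push_cast
  ring

end Weights
end AlphaGamma

namespace AlphaGamma

/-! ### Determination of a law on the positive orthant by its mixed moments -/

section Moments

/-- Both transforms are analytic on a vertical strip around the imaginary axis, and their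
derivatives at `0` are the moments. The identity theorem on this connected strip gives equality at
`I`, a value of the characteristic function. -/
theorem complexMGF_eq_of_moments {Ω Ω' : Type*} [MeasurableSpace Ω] [MeasurableSpace Ω']
    {μ : Measure Ω} {ν : Measure Ω'} {X : Ω → ℝ} {Y : Ω' → ℝ}
    (hX : 0 ∈ interior (integrableExpSet X μ)) (hY : 0 ∈ interior (integrableExpSet Y ν))
    (hXY : ∀ n : ℕ, ∫ ω, X ω ^ n ∂μ = ∫ ω, Y ω ^ n ∂ν) :
    complexMGF X μ Complex.I = complexMGF Y ν Complex.I := by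
  set s : Set ℝ := interior (integrableExpSet X μ) ∩ interior (integrableExpSet Y ν) with hs
  have hsc : Convex ℝ s := convex_integrableExpSet.interior.inter convex_integrableExpSet.interior
  have h0 : (0 : ℂ) ∈ {z : ℂ | z.re ∈ s} := ⟨by simpa using hX, by simpa using hY⟩
  have hf : AnalyticOnNhd ℂ (complexMGF X μ) {z | z.re ∈ s} := fun z hz =>
    analyticOnNhd_complexMGF z hz.1
  have hg : AnalyticOnNhd ℂ (complexMGF Y ν) {z | z.re ∈ s} := fun z hz =>
    analyticOnNhd_complexMGF z hz.2
  have key : ∀ n : ℕ, iteratedDeriv n (complexMGF X μ) 0 = iteratedDeriv n (complexMGF Y ν) 0 := by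
    intro n
    rw [iteratedDeriv_complexMGF (by simpa using hX), iteratedDeriv_complexMGF (by simpa using hY)]
    simp only [zero_mul, Complex.exp_zero, mul_one]
    have := hXY n
    norm_cast
  have hev : complexMGF X μ =ᶠ[𝓝 0] complexMGF Y ν := by
    have h1 := (hf 0 h0).hasFPowerSeriesAt
    have h2 := (hg 0 h0).hasFPowerSeriesAt
    simp only [key] at h1
    have h3 := h1.sub h2
    rw [sub_self] at h3
    filter_upwards [h3.eventually_eq_zero] with z hz
    exact sub_eq_zero.1 hz
  refine hf.eqOn_of_preconnected_of_eventuallyEq hg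
    (hsc.linear_preimage Complex.reLm).isPreconnected h0 hev ?_
  simpa using h0

variable {σ : Type*} [Fintype σ]

theorem ofReal_exp_eq_tsum {x : ℝ} (hx : 0 ≤ x) :
    ENNReal.ofReal (Real.exp x) = ∑' n : ℕ, ENNReal.ofReal (x ^ n / n.factorial) := by
  rw [Real.exp_eq_exp_ℝ, NormedSpace.exp_eq_tsum_div,
    ENNReal.ofReal_tsum_of_nonneg (fun n => by positivity) (Real.summable_pow_div_factorial x)]

open Classical in
theorem lintegral_sum_pow {μ : Measure (σ → ℝ)} (hμ : ∀ᵐ x ∂μ, ∀ i, 0 ≤ x i) (n : ℕ) :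
    ∫⁻ x, ENNReal.ofReal ((∑ i, x i) ^ n) ∂μ =
      ∑ c ∈ Finset.univ.piAntidiag n, (Nat.multinomial Finset.univ c : ℝ≥0∞) *
        ∫⁻ x, ENNReal.ofReal (∏ i, x i ^ c i) ∂μ := by
  have : ∀ᵐ x ∂μ, ENNReal.ofReal ((∑ i, x i) ^ n) =
      ∑ c ∈ Finset.univ.piAntidiag n, (Nat.multinomial Finset.univ c : ℝ≥0∞) *
        ENNReal.ofReal (∏ i, x i ^ c i) := by
    filter_upwards [hμ] with x hx
    rw [Finset.sum_pow_eq_sum_piAntidiag, ENNReal.ofReal_sum_of_nonneg]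
    · refine Finset.sum_congr rfl fun c _ => ?_
      rw [ENNReal.ofReal_mul (by positivity), ENNReal.ofReal_natCast]
    · intro c _
      have : 0 ≤ ∏ i, x i ^ c i := Finset.prod_nonneg fun i _ => pow_nonneg (hx i) _
      positivity
  rw [lintegral_congr_ae this, lintegral_finsetSum _ (fun c _ => by fun_prop)]
  refine Finset.sum_congr rfl fun c _ => ?_
  rw [lintegral_const_mul _ (by fun_prop)]

/-- With `lintegral_sum_pow` this writes the exponential moment as a series of nonnegative multiples
of mixed moments, so its finiteness passes between measures with equal mixed moments. -/
theorem lintegral_exp_sum {μ : Measure (σ → ℝ)} (hμ : ∀ᵐ x ∂μ, ∀ i, 0 ≤ x i) {s : ℝ}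
    (hs : 0 ≤ s) : ∫⁻ x, ENNReal.ofReal (Real.exp (s * ∑ i, x i)) ∂μ =
      ∑' n : ℕ, ENNReal.ofReal (s ^ n / n.factorial) *
        ∫⁻ x, ENNReal.ofReal ((∑ i, x i) ^ n) ∂μ := by
  have : ∀ᵐ x ∂μ, ENNReal.ofReal (Real.exp (s * ∑ i, x i)) =
      ∑' n : ℕ, ENNReal.ofReal (s ^ n / n.factorial) * ENNReal.ofReal ((∑ i, x i) ^ n) := by
    filter_upwards [hμ] with x hx
    have h0 : 0 ≤ ∑ i, x i := Finset.sum_nonneg fun i _ => hx i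
    rw [ofReal_exp_eq_tsum (mul_nonneg hs h0)]
    congr 1
    ext n
    rw [← ENNReal.ofReal_mul (by positivity)]
    congr 1
    ring
  rw [lintegral_congr_ae this, lintegral_tsum (fun n => by fun_prop)]
  congr 1
  ext n
  rw [lintegral_const_mul _ (by fun_prop)]

theorem integrable_of_le_exp {μ : Measure (σ → ℝ)} {s : ℝ}
    (he : ∫⁻ x, ENNReal.ofReal (Real.exp (s * ∑ i, x i)) ∂μ < ∞) :
    Integrable (fun x : σ → ℝ => Real.exp (s * ∑ i, x i)) μ := by
  refine ⟨by fun_prop, ?_⟩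
  rw [hasFiniteIntegral_iff_ofReal (Filter.Eventually.of_forall fun x => (Real.exp_pos _).le)]
  exact he

/-- A monomial of total degree `n` is at most `(∑ x i) ^ n`, hence at most `n! / s ^ n` times the
exponential. -/
theorem integrable_monomial {μ : Measure (σ → ℝ)} (hμ : ∀ᵐ x ∂μ, ∀ i, 0 ≤ x i) {s : ℝ}
    (hs : 0 < s) (he : ∫⁻ x, ENNReal.ofReal (Real.exp (s * ∑ i, x i)) ∂μ < ∞) (c : σ → ℕ) :
    Integrable (fun x : σ → ℝ => ∏ i, x i ^ c i) μ := by
  set n := ∑ i, c i with hn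
  refine Integrable.mono' ((integrable_of_le_exp he).const_mul (n.factorial / s ^ n))
    (Measurable.aestronglyMeasurable (by fun_prop)) ?_
  filter_upwards [hμ] with x hx
  have h0 : 0 ≤ ∑ i, x i := Finset.sum_nonneg fun i _ => hx i
  rw [Real.norm_of_nonneg (Finset.prod_nonneg fun i _ => pow_nonneg (hx i) _)]
  have h1 : ∏ i, x i ^ c i ≤ (∑ i, x i) ^ n := by
    rw [hn, ← Finset.prod_pow_eq_pow_sum]
    exact Finset.prod_le_prod (fun i _ => pow_nonneg (hx i) _) fun i _ =>
      pow_le_pow_left₀ (hx i) (Finset.single_le_sum (fun j _ => hx j) (Finset.mem_univ i)) _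
  have h2 := Real.pow_div_factorial_le_exp (s * ∑ i, x i) (by positivity) n
  rw [div_mul_eq_mul_div, le_div_iff₀ (by positivity)]
  rw [div_le_iff₀ (by positivity), mul_pow] at h2
  calc _ ≤ (∑ i, x i) ^ n * s ^ n := by gcongr
    _ ≤ _ := by linarith

/-- Two finite measures on the positive orthant with the same mixed moments are equal if one of them
has an exponential moment. -/
theorem ext_of_lintegral_monomial {μ ν : Measure (σ → ℝ)} [IsFiniteMeasure μ] [IsFiniteMeasure ν]
    (hμ : ∀ᵐ x ∂μ, ∀ i, 0 ≤ x i) (hν : ∀ᵐ x ∂ν, ∀ i, 0 ≤ x i)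
    (h : ∀ c : σ → ℕ, ∫⁻ x, ENNReal.ofReal (∏ i, x i ^ c i) ∂μ =
      ∫⁻ x, ENNReal.ofReal (∏ i, x i ^ c i) ∂ν)
    {s : ℝ} (hs : 0 < s) (he : ∫⁻ x, ENNReal.ofReal (Real.exp (s * ∑ i, x i)) ∂ν < ∞) :
    μ = ν := by
  classical
  have he' : ∫⁻ x, ENNReal.ofReal (Real.exp (s * ∑ i, x i)) ∂μ < ∞ := by
    rw [lintegral_exp_sum hν hs.le] at he
    rw [lintegral_exp_sum hμ hs.le]
    simp only [lintegral_sum_pow hμ, h]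
    simpa only [lintegral_sum_pow hν] using he
  have hint : ∀ c : σ → ℕ, ∫ x, ∏ i, x i ^ c i ∂μ = ∫ x, ∏ i, x i ^ c i ∂ν := by
    intro c
    rw [integral_eq_lintegral_of_nonneg_ae, integral_eq_lintegral_of_nonneg_ae, h]
    · filter_upwards [hν] with x hx using Finset.prod_nonneg fun i _ => pow_nonneg (hx i) _
    · exact Measurable.aestronglyMeasurable (by fun_prop)
    · filter_upwards [hμ] with x hx using Finset.prod_nonneg fun i _ => pow_nonneg (hx i) _
    · exact Measurable.aestronglyMeasurable (by fun_prop)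
  refine Measure.ext_of_charFunDual (funext fun L => ?_)
  -- Cramér–Wold: it suffices to compare the laws of linear forms `L`, and the moments of `L` are
  -- combinations of mixed moments.
  set u : σ → ℝ := fun i => L (Pi.single i 1) with hu
  have hL : ∀ x : σ → ℝ, L x = ∑ i, u i * x i := by
    intro x
    conv_lhs => rw [pi_eq_sum_univ' x]
    rw [map_sum]
    refine Finset.sum_congr rfl fun i _ => ?_
    rw [map_smul, smul_eq_mul, mul_comm]
  have hmom : ∀ {μ : Measure (σ → ℝ)}, (∀ᵐ x ∂μ, ∀ i, 0 ≤ x i) →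
      ∫⁻ x, ENNReal.ofReal (Real.exp (s * ∑ i, x i)) ∂μ < ∞ → ∀ n : ℕ,
      ∫ x, L x ^ n ∂μ = ∑ c ∈ Finset.univ.piAntidiag n,
        (Nat.multinomial Finset.univ c * ∏ i, u i ^ c i) * ∫ x, ∏ i, x i ^ c i ∂μ := by
    intro μ hμ he n
    simp only [hL, Finset.sum_pow_eq_sum_piAntidiag]
    rw [integral_finsetSum]
    · refine Finset.sum_congr rfl fun c _ => ?_
      rw [← integral_const_mul]
      simp only [mul_pow, Finset.prod_mul_distrib, mul_assoc]
    · intro c _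
      have := (integrable_monomial hμ hs he c).const_mul
        (Nat.multinomial Finset.univ c * ∏ i, u i ^ c i)
      simpa only [mul_pow, Finset.prod_mul_distrib, mul_assoc] using this
  have hexp : ∀ {μ : Measure (σ → ℝ)}, (∀ᵐ x ∂μ, ∀ i, 0 ≤ x i) →
      ∫⁻ x, ENNReal.ofReal (Real.exp (s * ∑ i, x i)) ∂μ < ∞ →
      0 ∈ interior (integrableExpSet (fun x => L x) μ) := by
    intro μ hμ he
    set U := ∑ i, |u i| with hU
    have hU0 : 0 ≤ U := Finset.sum_nonneg fun i _ => abs_nonneg _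
    rw [mem_interior_iff_mem_nhds]
    -- On the positive orthant `|L x| ≤ U ∑ x i`, so `exp (r L)` is dominated for `|r| U ≤ s`. The
    -- `+ 1` keeps the radius meaningful when `U = 0`.
    refine Filter.mem_of_superset (Metric.ball_mem_nhds 0 (ε := s / (U + 1)) (by positivity)) ?_
    intro r hr
    rw [Metric.mem_ball, dist_zero_right, Real.norm_eq_abs, lt_div_iff₀ (by positivity)] at hr
    refine Integrable.mono' (integrable_of_le_exp he) (by fun_prop) ?_
    filter_upwards [hμ] with x hx
    have h0 : 0 ≤ ∑ i, x i := Finset.sum_nonneg fun i _ => hx i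
    rw [Real.norm_of_nonneg (Real.exp_pos _).le]
    refine Real.exp_le_exp.2 ?_
    have h1 : |L x| ≤ U * ∑ i, x i := by
      rw [hL, hU, Finset.sum_mul]
      refine (Finset.abs_sum_le_sum_abs _ _).trans (Finset.sum_le_sum fun i _ => ?_)
      rw [abs_mul, abs_of_nonneg (hx i)]
      exact mul_le_mul_of_nonneg_left
        (Finset.single_le_sum (fun j _ => hx j) (Finset.mem_univ i)) (abs_nonneg _)
    calc r * L x ≤ |r| * |L x| := by rw [← abs_mul]; exact le_abs_self _
      _ ≤ |r| * (U * ∑ i, x i) := by gcongr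
      _ = (|r| * U) * ∑ i, x i := by ring
      _ ≤ s * ∑ i, x i := by
        refine mul_le_mul_of_nonneg_right ?_ h0
        nlinarith [abs_nonneg r]
  have := complexMGF_eq_of_moments (hexp hμ he') (hexp hν he) fun n => by
    rw [hmom hμ he', hmom hν he]
    simp only [hint]
  rw [charFunDual_apply, charFunDual_apply]
  simp only [complexMGF] at this
  simpa only [mul_comm Complex.I] using this

/-- Two finite measures on `[0, ∞)` with the same moments are equal if one of them has an
exponential moment. -/
theorem ext_of_lintegral_pow {μ ν : Measure ℝ} [IsFiniteMeasure μ] [IsFiniteMeasure ν]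
    (hμ : ∀ᵐ x ∂μ, 0 ≤ x) (hν : ∀ᵐ x ∂ν, 0 ≤ x)
    (h : ∀ n : ℕ, ∫⁻ x, ENNReal.ofReal (x ^ n) ∂μ = ∫⁻ x, ENNReal.ofReal (x ^ n) ∂ν)
    {s : ℝ} (hs : 0 < s) (he : ∫⁻ x, ENNReal.ofReal (Real.exp (s * x)) ∂ν < ∞) :
    μ = ν := by
  set f : ℝ → Unit → ℝ := fun x _ => x with hf
  have hfm : Measurable f := by fun_prop
  have hgm : Measurable fun x : Unit → ℝ => x () := by fun_prop
  have key : μ.map f = ν.map f := by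
    refine ext_of_lintegral_monomial (s := s) ?_ ?_ (fun c => ?_) hs ?_
    · rw [ae_map_iff hfm.aemeasurable (by measurability)]
      simpa [hf] using hμ
    · rw [ae_map_iff hfm.aemeasurable (by measurability)]
      simpa [hf] using hν
    · rw [lintegral_map (by fun_prop) hfm, lintegral_map (by fun_prop) hfm]
      simpa [hf] using h (c ())
    · rw [lintegral_map (by fun_prop) hfm]
      simpa [hf] using he
  have h2 := congrArg (fun m => Measure.map (fun x : Unit → ℝ => x ()) m) key
  rw [Measure.map_map hgm hfm, Measure.map_map hgm hfm] at h2
  have hid : (fun x : Unit → ℝ => x ()) ∘ f = id := rfl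
  rwa [hid, Measure.map_id, Measure.map_id] at h2

end Moments
end AlphaGamma

namespace AlphaGamma

/-! ### Asymptotics and a lower bound of the Gamma function -/

section Gamma

open Real in
-- Log-convexity of `Γ` between `y` and `y + 1`. The reverse estimate `rpow_le_Gamma_add` is
-- log-convexity between `y + s` and `y + s + 1`.
theorem Gamma_add_le_rpow {y s : ℝ} (hy : 0 < y) (hs0 : 0 < s) (hs1 : s < 1) :
    Gamma (y + s) ≤ Gamma y * y ^ s := by
  have h := Gamma_mul_add_mul_le_rpow_Gamma_mul_rpow_Gamma hy (add_pos hy one_pos)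
    (sub_pos.2 hs1) hs0 (by ring)
  have hG := Gamma_pos_of_pos hy
  rw [Gamma_add_one hy.ne', mul_rpow hy.le hG.le] at h
  calc _ = Gamma ((1 - s) * y + s * (y + 1)) := by ring_nf
    _ ≤ _ := h
    _ = Gamma y ^ ((1 - s) + s) * y ^ s := by rw [rpow_add hG]; ring
    _ = _ := by simp

open Real in
theorem rpow_le_Gamma_add {y s : ℝ} (hy : 0 < y) (hs0 : 0 < s) (hs1 : s < 1) :
    y * Gamma y ≤ Gamma (y + s) * (y + s) ^ (1 - s) := by
  have hys : 0 < y + s := by positivity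
  have h := Gamma_mul_add_mul_le_rpow_Gamma_mul_rpow_Gamma hys (add_pos hys one_pos)
    hs0 (sub_pos.2 hs1) (by ring)
  have hG := Gamma_pos_of_pos hys
  rw [Gamma_add_one hys.ne', mul_rpow hys.le hG.le] at h
  calc _ = Gamma (s * (y + s) + (1 - s) * (y + s + 1)) := by
        rw [← Gamma_add_one hy.ne']; ring_nf
    _ ≤ _ := h
    _ = Gamma (y + s) ^ (s + (1 - s)) * (y + s) ^ (1 - s) := by rw [rpow_add hG]; ring
    _ = _ := by simp

theorem tendsto_div_add_atTop (s : ℝ) : Tendsto (fun y : ℝ => y / (y + s)) atTop (𝓝 1) := by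
  have h1 : Tendsto (fun y : ℝ => 1 - s / (y + s)) atTop (𝓝 (1 - 0)) :=
    tendsto_const_nhds.sub (tendsto_const_nhds.div_atTop (tendsto_atTop_add_const_right _ s
      tendsto_id))
  rw [sub_zero] at h1
  refine h1.congr' ?_
  filter_upwards [eventually_gt_atTop (-s)] with y hy
  have : y + s ≠ 0 := by linarith
  field_simp
  ring

open Real in
theorem tendsto_Gamma_ratio_of_lt_one {s : ℝ} (hs0 : 0 ≤ s) (hs1 : s < 1) :
    Tendsto (fun y => Gamma (y + s) / (Gamma y * y ^ s)) atTop (𝓝 1) := by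
  rcases hs0.eq_or_lt with rfl | hs0
  · refine tendsto_const_nhds.congr' ?_
    filter_upwards [eventually_gt_atTop 0] with y hy
    have := Gamma_pos_of_pos hy
    simp [this.ne']
  have hlow : Tendsto (fun y : ℝ => (y / (y + s)) ^ (1 - s)) atTop (𝓝 1) := by
    simpa using (tendsto_div_add_atTop s).rpow_const (p := 1 - s) (Or.inl one_ne_zero)
  refine tendsto_of_tendsto_of_tendsto_of_le_of_le' hlow tendsto_const_nhds ?_ ?_
  · filter_upwards [eventually_gt_atTop 0] with y hy
    have hG := Gamma_pos_of_pos hy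
    have := rpow_le_Gamma_add hy hs0 hs1
    rw [le_div_iff₀ (by positivity), div_rpow hy.le (by positivity), div_mul_eq_mul_div,
      div_le_iff₀ (by positivity)]
    calc _ = Gamma y * y ^ (1 - s + s) := by rw [rpow_add hy]; ring
      _ = y * Gamma y := by simp [mul_comm]
      _ ≤ _ := this
  · filter_upwards [eventually_gt_atTop 0] with y hy
    have hG := Gamma_pos_of_pos hy
    rw [div_le_one (by positivity)]
    exact Gamma_add_le_rpow hy hs0 hs1

open Real in
/-- `Γ(y + s) ∼ Γ(y) y ^ s` as `y → ∞`. -/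
theorem tendsto_Gamma_ratio {s : ℝ} (hs : 0 ≤ s) :
    Tendsto (fun y => Gamma (y + s) / (Gamma y * y ^ s)) atTop (𝓝 1) := by
  -- Write `s` as integer part plus fractional part. Each unit step multiplies the ratio by `(y + n
  -- + f) / y`, which tends to `1`.
  have key : ∀ (n : ℕ) (f : ℝ), 0 ≤ f → f < 1 →
      Tendsto (fun y => Gamma (y + (n + f)) / (Gamma y * y ^ (n + f))) atTop (𝓝 1) := by
    intro n f hf0 hf1
    induction n with
    | zero => simpa using tendsto_Gamma_ratio_of_lt_one hf0 hf1
    | succ n ih =>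
      have h1 := ih.div (tendsto_div_add_atTop (n + f)) one_ne_zero
      rw [div_one] at h1
      refine h1.congr' ?_
      filter_upwards [eventually_gt_atTop 0] with y hy
      have hG := Gamma_pos_of_pos hy
      have h2 : y + (n + f) ≠ 0 := by positivity
      rw [Pi.div_apply] 
      push_cast
      rw [show y + ((n : ℝ) + 1 + f) = y + (n + f) + 1 by ring, Gamma_add_one h2,
        show (n : ℝ) + 1 + f = n + f + 1 by ring, rpow_add_one hy.ne']
      field_simp
  have := key ⌊s⌋₊ (Int.fract s) (Int.fract_nonneg s) (Int.fract_lt_one s)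
  rwa [natCast_floor_eq_intCast_floor hs, Int.floor_add_fract] at this

/-- On `[1, 2]`, monotonicity of `Γ` on `[2, ∞)` gives `y Γ(y) = Γ(y + 1) ≥ Γ(2) = 1`. This crude
bound controls the denominators of the Mittag-Leffler moments. -/
theorem half_le_Gamma {y : ℝ} (hy : 1 ≤ y) : 1 / 2 ≤ Real.Gamma y := by
  have hmono := Real.Gamma_strictMonoOn_Ici.monotoneOn
  rcases le_total y 2 with h2 | h2
  · have h1 := hmono (a := 2) (b := y + 1) (by simp) (by simp; linarith) (by linarith)
    rw [Real.Gamma_two, Real.Gamma_add_one (by linarith)] at h1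
    have hG := Real.Gamma_pos_of_pos (show 0 < y by linarith)
    nlinarith
  · have h1 := hmono (a := 2) (b := y) (by simp) (by simpa using h2) h2
    rw [Real.Gamma_two] at h1
    linarith

end Gamma

/-! ### Beta moments and Dirichlet integrals -/

section BetaDirichlet

/-- A nonzero Bochner integral certifies integrability, since the integral of a non-integrable
function is `0` by convention. Classical formulas therefore pass to `∫⁻` without a separate
integrability proof. -/
theorem lintegral_ofReal_of_integral_eq {X : Type*} [MeasurableSpace X] {μ : Measure X} {f : X → ℝ}
    (hf : 0 ≤ᵐ[μ] f) {c : ℝ} (hc : c ≠ 0) (h : ∫ x, f x ∂μ = c) :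
    ∫⁻ x, ENNReal.ofReal (f x) ∂μ = ENNReal.ofReal c := by
  rw [← h, ofReal_integral_eq_lintegral_ofReal (Integrable.of_integral_ne_zero (h ▸ hc)) hf]

theorem measurable_betaPDF (a b : ℝ) : Measurable (betaPDF a b) :=
  (measurable_betaPDFReal a b).ennreal_ofReal

/-- For `b > 0`, `x ^ s` times the density of `beta(a, b)` is a multiple of the density of `beta(a +
s, b)`. For `b = 0` both sides are `1`. -/
theorem lintegral_betaLaw_rpow {a b s : ℝ} (ha : 0 < a) (hb : 0 ≤ b) (hs : 0 ≤ s) :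
    ∫⁻ x, ENNReal.ofReal (x ^ s) ∂(betaLaw a b) =
      ENNReal.ofReal (Real.Gamma (a + s) * Real.Gamma (a + b) /
        (Real.Gamma a * Real.Gamma (a + b + s))) := by
  have has : 0 < a + s := by linarith
  have hGa := Real.Gamma_pos_of_pos ha
  have hGas := Real.Gamma_pos_of_pos has
  rcases hb.eq_or_lt with rfl | hb
  · rw [betaLaw, if_pos rfl, lintegral_dirac' _ (by fun_prop)]
    simp only [add_zero, Real.one_rpow]
    congr 1
    field_simp
  · have hGb := Real.Gamma_pos_of_pos hb
    have hGab := Real.Gamma_pos_of_pos (show 0 < a + b by linarith)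
    have hGabs := Real.Gamma_pos_of_pos (show 0 < a + b + s by linarith)
    have hpdf : ∀ x, betaPDF a b x * ENNReal.ofReal (x ^ s) =
        ENNReal.ofReal (beta (a + s) b / beta a b) * betaPDF (a + s) b x := by
      intro x
      have h1 := beta_pos ha hb
      have h2 := beta_pos has hb
      by_cases hx : 0 < x ∧ x < 1
      · rw [betaPDF_of_pos_lt_one hx.1 hx.2, betaPDF_of_pos_lt_one hx.1 hx.2,
          ← ENNReal.ofReal_mul, ← ENNReal.ofReal_mul (by positivity)]
        · congr 1
          rw [show a + s - 1 = (a - 1) + s by ring, Real.rpow_add hx.1]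
          field_simp
        · have := Real.rpow_nonneg (sub_nonneg.2 hx.2.le) (b - 1)
          have := Real.rpow_nonneg hx.1.le (a - 1)
          positivity
      · simp [betaPDF_eq, hx]
    rw [betaLaw, if_neg hb.ne', betaMeasure, lintegral_withDensity_eq_lintegral_mul _ (measurable_betaPDF a b)
      (by fun_prop)]
    simp only [Pi.mul_apply, hpdf]
    rw [lintegral_const_mul _ (measurable_betaPDF _ b), lintegral_betaPDF_eq_one has hb, mul_one, beta, beta]
    congr 1
    rw [show a + s + b = a + b + s by ring]
    field_simp

instance {a : ℝ} : IsProbabilityMeasure (betaLaw a 0) := by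
  rw [betaLaw, if_pos rfl]; infer_instance

theorem isProbabilityMeasure_betaLaw {a b : ℝ} (ha : 0 < a) (hb : 0 ≤ b) :
    IsProbabilityMeasure (betaLaw a b) := by
  rcases hb.eq_or_lt with rfl | hb
  · infer_instance
  · rw [betaLaw, if_neg hb.ne']
    exact isProbabilityMeasureBeta ha hb

theorem ae_betaLaw {a b : ℝ} : ∀ᵐ x ∂(betaLaw a b), 0 < x ∧ x ≤ 1 := by
  rw [betaLaw]
  split_ifs
  · rw [ae_dirac_iff (by measurability)]
    simp
  · rw [betaMeasure, ae_withDensity_iff (measurable_betaPDF a b)]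
    refine Filter.Eventually.of_forall fun x hx => ?_
    by_contra hn
    refine hx ?_
    rw [betaPDF_eq, if_neg (fun h => hn ⟨h.1, h.2.le⟩), ENNReal.ofReal_zero]

/-- The function `x ^ (a - 1)` on `(0, ∞)`, extended by zero. -/
noncomputable def powerDensity (a x : ℝ) : ℝ≥0∞ :=
  if 0 < x then ENNReal.ofReal (x ^ (a - 1)) else 0

@[fun_prop]
theorem measurable_powerDensity (a : ℝ) : Measurable (powerDensity a) :=
  Measurable.ite measurableSet_Ioi (by fun_prop) measurable_const

theorem powerDensity_mul_pow (a x : ℝ) (c : ℕ) :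
    powerDensity a x * ENNReal.ofReal (x ^ c) = powerDensity (a + c) x := by
  unfold powerDensity
  split_ifs with hx
  · rw [← ENNReal.ofReal_mul (by positivity), ← Real.rpow_natCast, ← Real.rpow_add hx]
    congr 2
    ring
  · simp

/-- The substitution `x = r y` turns the integral into a multiple of the total mass of `beta(a, b)`.
-/
theorem powerDensity_convolution {a b : ℝ} (ha : 0 < a) (hb : 0 < b) (r : ℝ) :
    ∫⁻ x, powerDensity a x * powerDensity b (r - x) =
      ENNReal.ofReal (beta a b) * powerDensity (a + b) r := by
  rcases le_or_gt r 0 with hr | hr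
  · rw [powerDensity, if_neg hr.not_gt, mul_zero]
    refine (lintegral_congr fun x => ?_).trans lintegral_zero
    unfold powerDensity
    split_ifs with h1 h2
    · linarith
    all_goals simp
  · have hbp := beta_pos ha hb
    have hpt : ∀ y, powerDensity a (r * y) * powerDensity b (r - r * y) =
        ENNReal.ofReal (r ^ (a + b - 2) * beta a b) * betaPDF a b y := by
      intro y
      have e1 : 0 < r * y ↔ 0 < y := mul_pos_iff_of_pos_left hr
      have e2 : 0 < r - r * y ↔ y < 1 := by
        rw [show r - r * y = r * (1 - y) by ring, mul_pos_iff_of_pos_left hr, sub_pos]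
      unfold powerDensity
      rw [betaPDF_eq]
      by_cases h : 0 < y ∧ y < 1
      · rw [if_pos (e1.2 h.1), if_pos (e2.2 h.2), if_pos h,
          ← ENNReal.ofReal_mul (Real.rpow_nonneg (e1.2 h.1).le _),
          ← ENNReal.ofReal_mul (by positivity)]
        congr 1
        rw [show r - r * y = r * (1 - y) by ring, Real.mul_rpow hr.le h.1.le,
          Real.mul_rpow hr.le (sub_nonneg.2 h.2.le),
          show a + b - 2 = (a - 1) + (b - 1) by ring, Real.rpow_add hr]
        field_simp
      · rw [if_neg h, ENNReal.ofReal_zero, mul_zero]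
        by_cases h1 : 0 < y
        · rw [if_neg (fun h2 => h ⟨h1, e2.1 h2⟩), mul_zero]
        · rw [if_neg (fun h2 => h1 (e1.1 h2)), zero_mul]
    have hvol := Real.smul_map_volume_mul_left hr.ne'
    rw [← hvol, lintegral_smul_measure, lintegral_map (by fun_prop) (by fun_prop)]
    simp only [hpt]
    rw [lintegral_const_mul _ (measurable_betaPDF a b),
      lintegral_betaPDF_eq_one ha hb, mul_one, powerDensity, if_pos hr, smul_eq_mul,
      ← ENNReal.ofReal_mul (by positivity), ← ENNReal.ofReal_mul (by positivity)]
    congr 1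
    rw [abs_of_pos hr, show a + b - 1 = (a + b - 2) + 1 by ring, Real.rpow_add_one hr.ne']
    ring

/-- Integrating out all coordinates but the first leaves a convolution of two power densities. The
total `r` is kept free because the induction applies the formula to `r - y`. -/
theorem lintegral_powerDensity_fin {n : ℕ} (b : Fin n → ℝ) (hb : ∀ i, 0 < b i) {b₀ : ℝ}
    (hb₀ : 0 < b₀) (r : ℝ) :
    ∫⁻ x : Fin n → ℝ, (∏ i, powerDensity (b i) (x i)) * powerDensity b₀ (r - ∑ i, x i) =
      ENNReal.ofReal ((∏ i, Real.Gamma (b i)) * Real.Gamma b₀ / Real.Gamma (b₀ + ∑ i, b i)) *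
        powerDensity (b₀ + ∑ i, b i) r := by
  induction n generalizing r with
  | zero =>
    have hG := Real.Gamma_pos_of_pos hb₀
    simp [hG.ne', lintegral_unique, volume_pi]
  | succ n ih =>
    rw [← ((volume_preserving_piFinSuccAbove (fun _ => ℝ) 0).symm).lintegral_comp
      (by fun_prop), Measure.volume_eq_prod, lintegral_prod _ (by fun_prop)]
    simp only [MeasurableEquiv.piFinSuccAbove_symm_apply, Fin.insertNthEquiv,
      Fin.prod_univ_succ, Fin.sum_univ_succ, Equiv.coe_fn_mk, Fin.insertNth_zero, Fin.cons_zero,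
      Fin.cons_succ, cast_eq]
    have hstep : ∀ y : ℝ, ∫⁻ x : Fin n → ℝ, (powerDensity (b 0) y *
        ∏ i, powerDensity (b i.succ) (x i)) * powerDensity b₀ (r - (y + ∑ i, x i)) =
        ENNReal.ofReal ((∏ i : Fin n, Real.Gamma (b i.succ)) * Real.Gamma b₀ /
          Real.Gamma (b₀ + ∑ i : Fin n, b i.succ)) *
        (powerDensity (b 0) y * powerDensity (b₀ + ∑ i : Fin n, b i.succ) (r - y)) := by
      intro y
      have := ih (fun i => b i.succ) (fun i => hb _) (r - y)
      rw [mul_left_comm, ← this, ← lintegral_const_mul _ (by fun_prop)]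
      refine lintegral_congr fun x => ?_
      rw [mul_assoc, sub_sub]
    simp only [hstep]
    have hs : 0 < b₀ + ∑ i : Fin n, b i.succ :=
      add_pos_of_pos_of_nonneg hb₀ (Finset.sum_nonneg fun i _ => (hb _).le)
    have hG1 := Real.Gamma_pos_of_pos hs
    have hG2 := Real.Gamma_pos_of_pos hb₀
    have hG3 : 0 < ∏ i : Fin n, Real.Gamma (b i.succ) :=
      Finset.prod_pos fun i _ => Real.Gamma_pos_of_pos (hb _)
    rw [lintegral_const_mul _ (by fun_prop), powerDensity_convolution (hb 0) hs, ← mul_assoc,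
      ← ENNReal.ofReal_mul (by positivity), beta,
      show b 0 + (b₀ + ∑ i : Fin n, b i.succ) = b₀ + (b 0 + ∑ i : Fin n, b i.succ) by ring]
    congr 2
    field_simp

theorem lintegral_powerDensity {ι : Type*} [Fintype ι] (b : ι → ℝ) (hb : ∀ i, 0 < b i) {b₀ : ℝ}
    (hb₀ : 0 < b₀) (r : ℝ) :
    ∫⁻ x : ι → ℝ, (∏ i, powerDensity (b i) (x i)) * powerDensity b₀ (r - ∑ i, x i) =
      ENNReal.ofReal ((∏ i, Real.Gamma (b i)) * Real.Gamma b₀ / Real.Gamma (b₀ + ∑ i, b i)) *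
        powerDensity (b₀ + ∑ i, b i) r := by
  set e := Fintype.equivFin ι with he
  have h1 := (volume_measurePreserving_piCongrLeft (fun _ : ι => ℝ) e.symm).lintegral_comp
    (f := fun x : ι → ℝ => (∏ i, powerDensity (b i) (x i)) * powerDensity b₀ (r - ∑ i, x i))
    (by fun_prop)
  rw [← h1]
  have h2 : ∀ (x : Fin (Fintype.card ι) → ℝ) (i : ι),
      MeasurableEquiv.piCongrLeft (fun _ : ι => ℝ) e.symm x i = x (e i) := by
    intro x i
    obtain ⟨j, rfl⟩ := e.symm.surjective i
    rw [MeasurableEquiv.coe_piCongrLeft, Equiv.piCongrLeft_apply_apply, e.apply_symm_apply]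
  have h3 := lintegral_powerDensity_fin (fun j => b (e.symm j)) (fun j => hb _) hb₀ r
  rw [Equiv.sum_comp e.symm b, Equiv.prod_comp e.symm fun i => Real.Gamma (b i)] at h3
  rw [← h3]
  refine lintegral_congr fun x => ?_
  simp only [h2]
  rw [Equiv.sum_comp e x, ← Equiv.prod_comp e fun j => powerDensity (b (e.symm j)) (x j)]
  simp

end BetaDirichlet
end AlphaGamma

namespace AlphaGamma

/-! ### Mixed moments of the Dirichlet distribution -/

section DirichletMoments

variable {ι : Type*} [Fintype ι] {a : ι → ℝ} {i₀ : ι}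

open Classical in
theorem ofReal_dirichletDensity (a : ι → ℝ) (i₀ : ι) (x : {i // i ≠ i₀} → ℝ) :
    ENNReal.ofReal (dirichletDensity a i₀ x) =
      (∏ i : {i // i ≠ i₀}, powerDensity (a i) (x i)) * powerDensity (a i₀) (1 - ∑ i, x i) := by
  unfold dirichletDensity
  split_ifs with h
  · rw [ENNReal.ofReal_mul (Finset.prod_nonneg fun i _ => Real.rpow_nonneg (h.1 i).le _),
      ENNReal.ofReal_prod_of_nonneg fun i _ => Real.rpow_nonneg (h.1 i).le _,
      powerDensity, if_pos (sub_pos.2 h.2)]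
    congr 1
    exact Finset.prod_congr rfl fun i _ => by rw [powerDensity, if_pos (h.1 i)]
  · rw [ENNReal.ofReal_zero, eq_comm, mul_eq_zero]
    by_contra hn
    push Not at hn
    refine h ⟨fun i => ?_, ?_⟩
    · by_contra hi
      exact hn.1 (Finset.prod_eq_zero (Finset.mem_univ i) (by rw [powerDensity, if_neg hi]))
    · by_contra hi
      exact hn.2 (by rw [powerDensity, if_neg (fun h => hi (sub_pos.1 h))])

/-- The point of the simplex with given coordinates other than `i₀`. -/
noncomputable def completeSimplex [DecidableEq ι] (i₀ : ι) (x : {i // i ≠ i₀} → ℝ) : ι → ℝ :=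
  fun i => if h : i = i₀ then 1 - ∑ j, x j else x ⟨i, h⟩

theorem completeSimplex_self [DecidableEq ι] (x : {i // i ≠ i₀} → ℝ) :
    completeSimplex i₀ x i₀ = 1 - ∑ j, x j := by simp [completeSimplex]

theorem completeSimplex_ne [DecidableEq ι] (x : {i // i ≠ i₀} → ℝ) (i : {i // i ≠ i₀}) :
    completeSimplex i₀ x i = x i := by simp [completeSimplex, i.2]

theorem measurable_completeSimplex [DecidableEq ι] : Measurable (completeSimplex i₀) := by
  refine measurable_pi_lambda _ fun i => ?_
  unfold completeSimplex
  by_cases h : i = i₀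
  · simp only [h, dite_true]
    fun_prop
  · simp only [h, dite_false]
    fun_prop

theorem sum_completeSimplex [DecidableEq ι] (x : {i // i ≠ i₀} → ℝ) :
    ∑ i, completeSimplex i₀ x i = 1 := by
  rw [Fintype.sum_eq_add_sum_subtype_ne _ i₀, completeSimplex_self]
  simp only [completeSimplex_ne]
  ring

open Classical in
theorem dirichletLaw_eq (a : ι → ℝ) (i₀ : ι) : dirichletLaw a i₀ =
    (((volume.withDensity fun x => ENNReal.ofReal (dirichletDensity a i₀ x)) Set.univ)⁻¹ •
      (volume.withDensity fun x => ENNReal.ofReal (dirichletDensity a i₀ x))).map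
        (completeSimplex i₀) := rfl

theorem measurable_ofReal_dirichletDensity :
    Measurable fun x => ENNReal.ofReal (dirichletDensity a i₀ x) := by
  classical
  simp only [ofReal_dirichletDensity]
  fun_prop

theorem ae_dirichletLaw : ∀ᵐ x ∂(dirichletLaw a i₀), (∀ i, 0 < x i) ∧ ∑ i, x i = 1 := by
  classical
  rw [dirichletLaw_eq, ae_map_iff measurable_completeSimplex.aemeasurable (by measurability)]
  refine Measure.ae_smul_measure ?_ _
  rw [ae_withDensity_iff measurable_ofReal_dirichletDensity]
  refine Filter.Eventually.of_forall fun x hx => ⟨fun i => ?_, sum_completeSimplex x⟩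
  have h : (∀ i, 0 < x i) ∧ ∑ i, x i < 1 := by
    by_contra hn
    refine hx ?_
    rw [dirichletDensity, if_neg, ENNReal.ofReal_zero]
    convert hn
  by_cases hi : i = i₀
  · subst hi
    rw [completeSimplex_self]
    linarith [h.2]
  · have := completeSimplex_ne x ⟨i, hi⟩
    simp only at this
    rw [this]
    exact h.1 _

open Classical in
-- Multiplying the density by a monomial of exponents `c` merely shifts the parameters from `a i` to
-- `a i + c i`. The case `c = 0` is the normalising constant.
theorem lintegral_dirichletDensity_mul (ha : ∀ i, 0 < a i) (c : ι → ℕ) :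
    ∫⁻ x, ENNReal.ofReal (∏ i, completeSimplex i₀ x i ^ c i)
        ∂(volume.withDensity fun x => ENNReal.ofReal (dirichletDensity a i₀ x)) =
      ENNReal.ofReal ((∏ i, Real.Gamma (a i + c i)) / Real.Gamma (∑ i, (a i + c i))) := by
  rw [lintegral_withDensity_eq_lintegral_mul _ measurable_ofReal_dirichletDensity]
  · have hac : ∀ i, 0 < a i + c i := fun i => add_pos_of_pos_of_nonneg (ha i) (Nat.cast_nonneg _)
    have := lintegral_powerDensity (fun i : {i // i ≠ i₀} => a i + c i) (fun i => hac i) (hac i₀) 1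
    rw [Fintype.prod_eq_mul_prod_subtype_ne _ i₀, Fintype.sum_eq_add_sum_subtype_ne _ i₀,
      mul_comm (Real.Gamma (a i₀ + c i₀))]
    rw [powerDensity, if_pos one_pos, Real.one_rpow, ENNReal.ofReal_one, mul_one] at this
    rw [← this]
    refine lintegral_congr fun x => ?_
    rw [Pi.mul_apply, Fintype.prod_eq_mul_prod_subtype_ne _ i₀, completeSimplex_self]
    simp only [completeSimplex_ne]
    by_cases h : (∀ i, 0 < x i) ∧ ∑ i, x i < 1
    · rw [ENNReal.ofReal_mul (pow_nonneg (sub_nonneg.2 h.2.le) _),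
        ENNReal.ofReal_prod_of_nonneg (fun i _ => pow_nonneg (h.1 i).le _),
        ofReal_dirichletDensity]
      simp only [← powerDensity_mul_pow, Finset.prod_mul_distrib]
      ring
    · have h0 : ∀ b : ι → ℝ, (∏ i : {i // i ≠ i₀}, powerDensity (b i) (x i)) *
          powerDensity (b i₀) (1 - ∑ i, x i) = 0 := by
        intro b
        rw [← ofReal_dirichletDensity, dirichletDensity, if_neg, ENNReal.ofReal_zero]
        convert h
      rw [ofReal_dirichletDensity, h0, h0 (fun i => a i + c i), zero_mul]
  · have := measurable_completeSimplex (i₀ := i₀)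
    fun_prop

theorem lintegral_dirichletLaw (ha : ∀ i, 0 < a i) (c : ι → ℕ) :
    ∫⁻ x, ENNReal.ofReal (∏ i, x i ^ c i) ∂(dirichletLaw a i₀) =
      ENNReal.ofReal ((∏ i, Real.Gamma (a i + c i)) / (∏ i, Real.Gamma (a i)) *
        (Real.Gamma (∑ i, a i) / Real.Gamma (∑ i, (a i + c i)))) := by
  classical
  have h0 := lintegral_dirichletDensity_mul (i₀ := i₀) ha 0
  simp only [Pi.zero_apply, pow_zero, Finset.prod_const_one, ENNReal.ofReal_one, lintegral_one,
    Nat.cast_zero, add_zero] at h0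
  have hS : 0 < ∑ i, a i := Finset.sum_pos (fun i _ => ha i) ⟨i₀, Finset.mem_univ _⟩
  have hG1 : 0 < ∏ i, Real.Gamma (a i) := Finset.prod_pos fun i _ => Real.Gamma_pos_of_pos (ha i)
  have hG2 := Real.Gamma_pos_of_pos hS
  rw [dirichletLaw_eq, lintegral_map (by fun_prop) measurable_completeSimplex,
    lintegral_smul_measure, lintegral_dirichletDensity_mul ha, h0, smul_eq_mul,
    ← ENNReal.ofReal_inv_of_pos (by positivity), ← ENNReal.ofReal_mul (by positivity)]
  congr 1
  field_simp

theorem isProbabilityMeasure_dirichletLaw (ha : ∀ i, 0 < a i) :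
    IsProbabilityMeasure (dirichletLaw a i₀) := by
  constructor
  have h := lintegral_dirichletLaw (i₀ := i₀) ha 0
  have hS : 0 < ∑ i, a i := Finset.sum_pos (fun i _ => ha i) ⟨i₀, Finset.mem_univ _⟩
  have hG1 : 0 < ∏ i, Real.Gamma (a i) := Finset.prod_pos fun i _ => Real.Gamma_pos_of_pos (ha i)
  have hG2 := Real.Gamma_pos_of_pos hS
  simpa [hG1.ne', hG2.ne'] using h

end DirichletMoments

/-! ### Moments of stable, Mittag-Leffler and tilted Mittag-Leffler laws -/

section StableMoments

variable {γ : ℝ} {g : ℝ → ℝ}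

/-- Write `Γ(p) y ^ (-p)` as the integral of `x ^ (p - 1) exp (-x y)` over `x > 0`, exchange the
integrals, insert the Laplace transform, and evaluate the integral of `x ^ (p - 1) exp (-x ^ γ)` as
`Γ(p / γ) / γ`. -/
theorem lintegral_rpow_stable {S : Measure ℝ} (hS : IsStableLaw γ S) (hγ : 0 < γ)
    (h0 : ∀ᵐ y ∂S, 0 < y) {p : ℝ} (hp : 0 < p) :
    ∫⁻ y, ENNReal.ofReal (y ^ (-p)) ∂S =
      ENNReal.ofReal (Real.Gamma (p / γ + 1) / Real.Gamma (p + 1)) := by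
  have := hS.prob
  have hG := Real.Gamma_pos_of_pos hp
  have hG' := Real.Gamma_pos_of_pos (div_pos hp hγ)
  have e1 : ∀ᵐ y ∂S, ENNReal.ofReal (y ^ (-p)) * ENNReal.ofReal (Real.Gamma p) =
      ∫⁻ x in Set.Ioi 0, ENNReal.ofReal (x ^ (p - 1)) * ENNReal.ofReal (Real.exp (-(x * y))) := by
    filter_upwards [h0] with y hy
    have h1 := Real.integral_rpow_mul_exp_neg_mul_Ioi hp hy
    rw [one_div, Real.inv_rpow hy.le, ← Real.rpow_neg hy.le] at h1
    have h2 := lintegral_ofReal_of_integral_eq (by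
      filter_upwards [ae_restrict_mem measurableSet_Ioi] with x hx
      have := Real.rpow_nonneg (le_of_lt hx) (p - 1)
      exact mul_nonneg this (Real.exp_pos _).le) (by positivity) h1
    rw [← ENNReal.ofReal_mul (by positivity), ← h2]
    refine setLIntegral_congr_fun measurableSet_Ioi fun x hx => ?_
    rw [ENNReal.ofReal_mul (Real.rpow_nonneg (le_of_lt hx) _), mul_comm y x]
  have e2 : ∀ x ∈ Set.Ioi (0 : ℝ), ∫⁻ y, ENNReal.ofReal (x ^ (p - 1)) *
      ENNReal.ofReal (Real.exp (-(x * y))) ∂S =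
      ENNReal.ofReal (x ^ (p - 1) * Real.exp (-x ^ γ)) := by
    intro x hx
    rw [lintegral_const_mul _ (by fun_prop), lintegral_ofReal_of_integral_eq
      (Filter.Eventually.of_forall fun y => (Real.exp_pos _).le) (Real.exp_pos _).ne'
      (hS.laplace x (le_of_lt hx)), ENNReal.ofReal_mul (Real.rpow_nonneg (le_of_lt hx) _)]
  have e3 := lintegral_ofReal_of_integral_eq (by
      filter_upwards [ae_restrict_mem measurableSet_Ioi] with x hx
      have := Real.rpow_nonneg (le_of_lt hx) (p - 1)
      exact mul_nonneg this (Real.exp_pos _).le) (by rw [sub_add_cancel]; positivity)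
    (integral_rpow_mul_exp_neg_rpow hγ (q := p - 1) (by linarith))
  rw [sub_add_cancel] at e3
  have key : (∫⁻ y, ENNReal.ofReal (y ^ (-p)) ∂S) * ENNReal.ofReal (Real.Gamma p) =
      ENNReal.ofReal (1 / γ * Real.Gamma (p / γ)) := by
    rw [← lintegral_mul_const _ (by fun_prop), lintegral_congr_ae e1,
      lintegral_lintegral_swap (by fun_prop), setLIntegral_congr_fun measurableSet_Ioi e2, e3]
  have hc : ∫⁻ y, ENNReal.ofReal (y ^ (-p)) ∂S =
      (∫⁻ y, ENNReal.ofReal (y ^ (-p)) ∂S) * ENNReal.ofReal (Real.Gamma p) *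
        ENNReal.ofReal (Real.Gamma p)⁻¹ := by
    rw [mul_assoc, ← ENNReal.ofReal_mul hG.le, mul_inv_cancel₀ hG.ne', ENNReal.ofReal_one, mul_one]
  rw [hc, key, ← ENNReal.ofReal_mul (by positivity), Real.Gamma_add_one hp.ne',
    Real.Gamma_add_one (div_pos hp hγ).ne']
  congr 1
  field_simp

theorem IsMittagLefflerDensity.lintegral_rpow (hg : IsMittagLefflerDensity γ g) (hγ : 0 < γ)
    {q : ℝ} (hq : 0 < q) : ∫⁻ s in Set.Ioi 0, ENNReal.ofReal (s ^ q * g s) =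
      ENNReal.ofReal (Real.Gamma (q + 1) / Real.Gamma (γ * q + 1)) := by
  obtain ⟨S, hS, hSg⟩ := hg.density
  have hgm := hg.measurable
  -- The real power `0 ^ (-γ)` is `0`, so an atom of `S` at `0` would give the pushforward mass at
  -- `0`, whereas it lives on `(0, ∞)`.
  have h0 : ∀ᵐ y ∂S, 0 < y := by
    have h1 : ∀ᵐ s ∂(S.map fun y => y ^ (-γ)), 0 < s := by
      rw [hSg]
      exact (withDensity_absolutelyContinuous _ _).ae_le (ae_restrict_mem measurableSet_Ioi)
    rw [ae_map_iff (by fun_prop) measurableSet_Ioi] at h1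
    have h2 : ∀ᵐ y ∂S, ¬ y < 0 := measure_eq_zero_iff_ae_notMem.1 hS.nonneg
    filter_upwards [h1, h2] with y hy hy0
    refine lt_of_le_of_ne (not_lt.1 hy0) ?_
    rintro rfl
    rw [Real.zero_rpow (by linarith)] at hy
    exact lt_irrefl _ hy
  have h3 := lintegral_rpow_stable hS hγ h0 (mul_pos hγ hq)
  rw [mul_div_cancel_left₀ _ hγ.ne'] at h3
  rw [← h3]
  calc _ = ∫⁻ s, ENNReal.ofReal (s ^ q) ∂(S.map fun y => y ^ (-γ)) := by
        rw [hSg, lintegral_withDensity_eq_lintegral_mul _ (by fun_prop) (by fun_prop)]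
        refine setLIntegral_congr_fun measurableSet_Ioi fun s hs => ?_
        rw [Pi.mul_apply, mul_comm, ENNReal.ofReal_mul (hg.nonneg s)]
    _ = _ := by
        rw [lintegral_map (by fun_prop) (by fun_prop)]
        refine lintegral_congr_ae ?_
        filter_upwards [h0] with y hy
        rw [← Real.rpow_mul hy.le, neg_mul]

variable {α k ℓ : ℝ}

/-- The exponent of the polynomial factor of the density of `lengthLaw`. -/
noncomputable def lengthExponent (α γ k ℓ : ℝ) : ℝ := ℓ + k * (1 - α) / γ

/-- The tilt by `s ^ Q` turns the moment of order `n` into the Mittag-Leffler moment of order `Q +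
n`, and the constant in `lengthLaw` is the reciprocal of the moment of order `Q`. -/
theorem lintegral_lengthLaw_pow (hg : IsMittagLefflerDensity γ g) (hγ : 0 < γ)
    (hQ : 0 < lengthExponent α γ k ℓ) (n : ℕ) :
    ∫⁻ s, ENNReal.ofReal (s ^ n) ∂(lengthLaw α γ k ℓ g) =
      ENNReal.ofReal (Real.Gamma (γ * lengthExponent α γ k ℓ + 1) /
        Real.Gamma (lengthExponent α γ k ℓ + 1) *
        (Real.Gamma (lengthExponent α γ k ℓ + n + 1) /
          Real.Gamma (γ * (lengthExponent α γ k ℓ + n) + 1))) := by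
  have hgm := hg.measurable
  have e : 1 + k * (1 - α) + ℓ * γ = γ * lengthExponent α γ k ℓ + 1 := by
    rw [lengthExponent]
    field_simp
    ring
  have e' : 1 + ℓ + k * (1 - α) / γ = lengthExponent α γ k ℓ + 1 := by
    rw [lengthExponent]; ring
  have e'' : ℓ + k * (1 - α) / γ = lengthExponent α γ k ℓ := rfl
  rw [lengthLaw, e, e', e'']
  set Q := lengthExponent α γ k ℓ
  have hG1 := Real.Gamma_pos_of_pos (show 0 < Q + 1 by linarith)
  have hG2 := Real.Gamma_pos_of_pos (show 0 < γ * Q + 1 by positivity)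
  rw [lintegral_withDensity_eq_lintegral_mul _ (by fun_prop) (by fun_prop),
    ENNReal.ofReal_mul (by positivity), ← hg.lintegral_rpow hγ (by positivity),
    ← lintegral_const_mul _ (by fun_prop)]
  refine setLIntegral_congr_fun measurableSet_Ioi fun s hs => ?_
  have hs' : (0 : ℝ) < s := hs
  have := hg.nonneg s
  rw [Pi.mul_apply, ← ENNReal.ofReal_mul (by positivity), ← ENNReal.ofReal_mul (by positivity),
    Real.rpow_add hs', Real.rpow_natCast]
  congr 1
  ring

theorem isProbabilityMeasure_lengthLaw (hg : IsMittagLefflerDensity γ g) (hγ : 0 < γ)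
    (hQ : 0 < lengthExponent α γ k ℓ) : IsProbabilityMeasure (lengthLaw α γ k ℓ g) := by
  have h := lintegral_lengthLaw_pow hg hγ hQ 0
  have hG1 := Real.Gamma_pos_of_pos (show 0 < lengthExponent α γ k ℓ + 1 by linarith)
  have hG2 := Real.Gamma_pos_of_pos (show 0 < γ * lengthExponent α γ k ℓ + 1 by positivity)
  constructor
  simp only [pow_zero, ENNReal.ofReal_one, lintegral_one, Nat.cast_zero, add_zero] at h
  rw [h, ← ENNReal.ofReal_one]
  congr 1
  field_simp

theorem ae_lengthLaw : ∀ᵐ s ∂(lengthLaw α γ k ℓ g), 0 < s :=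
  (withDensity_absolutelyContinuous _ _).ae_le (ae_restrict_mem measurableSet_Ioi)

theorem summable_Gamma_div_factorial {a : ℝ} (ha : 0 < a) :
    Summable fun n : ℕ => (1 / 2 : ℝ) ^ n / n.factorial * Real.Gamma (a + n) := by
  have hpos : ∀ n : ℕ, 0 < (1 / 2 : ℝ) ^ n / n.factorial * Real.Gamma (a + n) := fun n => by
    have := Real.Gamma_pos_of_pos (show 0 < a + n by positivity)
    positivity
  refine summable_of_ratio_test_tendsto_lt_one (l := 1 / 2) (by norm_num)
    (Filter.Eventually.of_forall fun n => (hpos n).ne') ?_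
  have h1 : Tendsto (fun n : ℕ => 1 / 2 * (1 + (a - 1) / ((n : ℝ) + 1))) atTop
      (𝓝 (1 / 2 * (1 + 0))) := by
    refine (tendsto_const_nhds.add (tendsto_const_nhds.div_atTop ?_)).const_mul _
    exact tendsto_atTop_add_const_right _ _ tendsto_natCast_atTop_atTop
  rw [add_zero, mul_one] at h1
  refine h1.congr fun n => ?_
  have := Real.Gamma_pos_of_pos (show 0 < a + n by positivity)
  rw [Real.norm_of_nonneg (hpos _).le, Real.norm_of_nonneg (hpos _).le, Nat.factorial_succ]
  push_cast
  rw [← add_assoc, Real.Gamma_add_one (by positivity)]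
  field_simp
  ring

/-- Expand the exponential. Bounding the Gamma denominators of the moments below by `1 / 2` leaves
the terms `2 ^ (-n) Γ(Q + 1 + n) / n!`, whose ratios tend to `1 / 2`. -/
theorem lintegral_exp_lengthLaw_lt_top (hg : IsMittagLefflerDensity γ g) (hγ : 0 < γ)
    (hQ : 0 < lengthExponent α γ k ℓ) :
    ∫⁻ s, ENNReal.ofReal (Real.exp (1 / 2 * s)) ∂(lengthLaw α γ k ℓ g) < ∞ := by
  have hG1 := Real.Gamma_pos_of_pos (show 0 < lengthExponent α γ k ℓ + 1 by linarith)
  have hG2 := Real.Gamma_pos_of_pos (show 0 < γ * lengthExponent α γ k ℓ + 1 by positivity)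
  have hexp : ∀ᵐ s ∂(lengthLaw α γ k ℓ g), ENNReal.ofReal (Real.exp (1 / 2 * s)) =
      ∑' n : ℕ, ENNReal.ofReal ((1 / 2) ^ n / n.factorial) * ENNReal.ofReal (s ^ n) := by
    filter_upwards [ae_lengthLaw] with s hs
    rw [ofReal_exp_eq_tsum (by positivity)]
    congr 1
    ext n
    rw [← ENNReal.ofReal_mul (by positivity)]
    congr 1
    ring
  rw [lintegral_congr_ae hexp, lintegral_tsum fun n => by fun_prop]
  set Q := lengthExponent α γ k ℓ with hQdef
  set C := Real.Gamma (γ * Q + 1) / Real.Gamma (Q + 1) with hC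
  have hCpos : 0 < C := by positivity
  have hle : ∀ n : ℕ, ∫⁻ s, ENNReal.ofReal ((1 / 2) ^ n / n.factorial) * ENNReal.ofReal (s ^ n)
      ∂(lengthLaw α γ k ℓ g) ≤
      ENNReal.ofReal (2 * C * ((1 / 2) ^ n / n.factorial * Real.Gamma (Q + 1 + n))) := by
    intro n
    rw [lintegral_const_mul _ (by fun_prop), lintegral_lengthLaw_pow hg hγ hQ, ← hQdef, ← hC,
      ← ENNReal.ofReal_mul (by positivity)]
    refine ENNReal.ofReal_le_ofReal ?_
    have h1 := half_le_Gamma (y := γ * (Q + n) + 1) (by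
      have : 0 ≤ γ * (Q + n) := by positivity
      linarith)
    have h2 := Real.Gamma_pos_of_pos (show 0 < Q + 1 + n by positivity)
    rw [show Q + n + 1 = Q + 1 + n by ring]
    calc (1 / 2 : ℝ) ^ n / n.factorial * (C * (Real.Gamma (Q + 1 + n) /
          Real.Gamma (γ * (Q + n) + 1)))
        ≤ (1 / 2 : ℝ) ^ n / n.factorial * (C * (Real.Gamma (Q + 1 + n) / (1 / 2))) := by gcongr
      _ = _ := by ring
  refine (ENNReal.tsum_le_tsum hle).trans_lt ?_
  rw [← ENNReal.ofReal_tsum_of_nonneg]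
  · exact ENNReal.ofReal_lt_top
  · intro n
    have h2 := Real.Gamma_pos_of_pos (show 0 < Q + 1 + n by positivity)
    positivity
  · exact (summable_Gamma_div_factorial (by linarith)).mul_left _

end StableMoments
end AlphaGamma

namespace AlphaGamma

/-! ### Convergence of means from bounded second moments -/

section UniformIntegrability

variable {ι Ω Ω₀ : Type*} [MeasurableSpace Ω] [MeasurableSpace Ω₀] {l : Filter ι}

theorem ofReal_integral_min {μ : Measure Ω} [IsProbabilityMeasure μ] {X : Ω → ℝ}
    (hX : AEMeasurable X μ) (hX0 : ∀ᵐ ω ∂μ, 0 ≤ X ω) (R : ℕ) :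
    ENNReal.ofReal (∫ ω, min (X ω) R ∂μ) = ∫⁻ ω, ENNReal.ofReal (min (X ω) R) ∂μ := by
  refine ofReal_integral_eq_lintegral_ofReal ?_ ?_
  · refine Integrable.mono' (integrable_const (R : ℝ))
      (hX.min aemeasurable_const).aestronglyMeasurable ?_
    filter_upwards [hX0] with ω hω
    rw [Real.norm_of_nonneg (le_min hω (Nat.cast_nonneg _))]
    exact min_le_right _ _
  · filter_upwards [hX0] with ω hω using le_min hω (Nat.cast_nonneg _)

/-- Convergence of the truncated means and bounded second moments imply convergence of the means. -/
theorem lintegral_eq_of_tendsto_trunc [l.NeBot] {μ : ι → Measure Ω} [∀ i, IsProbabilityMeasure (μ i)]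
    {X : ι → Ω → ℝ} (hX : ∀ i, AEMeasurable (X i) (μ i)) (hX0 : ∀ i, ∀ᵐ ω ∂(μ i), 0 ≤ X i ω)
    {μ₀ : Measure Ω₀} [IsProbabilityMeasure μ₀] {X₀ : Ω₀ → ℝ} (hX₀ : AEMeasurable X₀ μ₀)
    (hX₀0 : ∀ᵐ ω ∂μ₀, 0 ≤ X₀ ω)
    (h : ∀ R : ℕ, Tendsto (fun i => ∫ ω, min (X i ω) R ∂(μ i)) l (𝓝 (∫ ω, min (X₀ ω) R ∂μ₀)))
    {K C : ℝ} (h1 : Tendsto (fun i => ∫⁻ ω, ENNReal.ofReal (X i ω) ∂(μ i)) l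
      (𝓝 (ENNReal.ofReal K)))
    (h2 : ∀ᶠ i in l, ∫⁻ ω, ENNReal.ofReal (X i ω ^ 2) ∂(μ i) ≤ ENNReal.ofReal C) :
    ∫⁻ ω, ENNReal.ofReal (X₀ ω) ∂μ₀ = ENNReal.ofReal K := by
  have hR : ∀ R : ℕ, Tendsto (fun i => ∫⁻ ω, ENNReal.ofReal (min (X i ω) R) ∂(μ i)) l
      (𝓝 (∫⁻ ω, ENNReal.ofReal (min (X₀ ω) R) ∂μ₀)) := by
    intro R
    have := ENNReal.tendsto_ofReal (h R)
    rw [ofReal_integral_min hX₀ hX₀0] at this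
    refine this.congr fun i => ?_
    rw [ofReal_integral_min (hX i) (hX0 i)]
  have hmono : Tendsto (fun R : ℕ => ∫⁻ ω, ENNReal.ofReal (min (X₀ ω) R) ∂μ₀) atTop
      (𝓝 (∫⁻ ω, ENNReal.ofReal (X₀ ω) ∂μ₀)) := by
    refine lintegral_tendsto_of_tendsto_of_monotone
      (fun R => (hX₀.min aemeasurable_const).ennreal_ofReal) ?_ ?_
    · refine Filter.Eventually.of_forall fun ω R R' hRR' => ?_
      exact ENNReal.ofReal_le_ofReal (min_le_min_left _ (by exact_mod_cast hRR'))
    · refine Filter.Eventually.of_forall fun ω => ?_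
      refine tendsto_const_nhds.congr' ?_
      filter_upwards [eventually_ge_atTop ⌈X₀ ω⌉₊] with R hR'
      rw [min_eq_left (Nat.ceil_le.1 hR')]
  refine le_antisymm ?_ ?_
  · refine le_of_tendsto' hmono fun R => ?_
    refine le_of_tendsto_of_tendsto' (hR R) h1 fun i => ?_
    exact lintegral_mono fun ω => ENNReal.ofReal_le_ofReal (min_le_left _ _)
  -- For the lower bound use `X ≤ min X R + X ^ 2 / R`, so that truncation at `R` costs at most `C /
  -- R`.
  · have hle : ∀ R : ℕ, 1 ≤ R → ENNReal.ofReal K ≤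
        ∫⁻ ω, ENNReal.ofReal (min (X₀ ω) R) ∂μ₀ + ENNReal.ofReal (C / R) := by
      intro R hR1
      have hRpos : (0 : ℝ) < R := by exact_mod_cast hR1
      refine le_of_tendsto_of_tendsto h1 ((hR R).add tendsto_const_nhds) ?_
      filter_upwards [h2] with i hi
      calc ∫⁻ ω, ENNReal.ofReal (X i ω) ∂(μ i)
          ≤ ∫⁻ ω, (ENNReal.ofReal (min (X i ω) R) +
            ENNReal.ofReal (1 / R) * ENNReal.ofReal (X i ω ^ 2)) ∂(μ i) := by
            refine lintegral_mono_ae ?_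
            filter_upwards [hX0 i] with ω hω
            rw [← ENNReal.ofReal_mul (by positivity), ← ENNReal.ofReal_add
              (le_min hω hRpos.le) (by positivity)]
            refine ENNReal.ofReal_le_ofReal ?_
            rcases le_total (X i ω) R with hle | hle
            · rw [min_eq_left hle]
              have : 0 ≤ 1 / (R : ℝ) * X i ω ^ 2 := by positivity
              linarith
            · have : X i ω ≤ 1 / (R : ℝ) * X i ω ^ 2 := by
                rw [one_div, inv_mul_eq_div, le_div_iff₀ hRpos]
                nlinarith
              have h3 := le_min hω hRpos.le
              linarith
        _ = ∫⁻ ω, ENNReal.ofReal (min (X i ω) R) ∂(μ i) +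
            ENNReal.ofReal (1 / R) * ∫⁻ ω, ENNReal.ofReal (X i ω ^ 2) ∂(μ i) := by
            rw [lintegral_add_left' ((hX i).min aemeasurable_const).ennreal_ofReal,
              lintegral_const_mul'' _ ((hX i).pow_const 2).ennreal_ofReal]
        _ ≤ ∫⁻ ω, ENNReal.ofReal (min (X i ω) R) ∂(μ i) + ENNReal.ofReal (C / R) := by
            gcongr
            refine (mul_le_mul_right hi _).trans ?_
            rw [← ENNReal.ofReal_mul (by positivity)]
            refine ENNReal.ofReal_le_ofReal (le_of_eq ?_)
            ring
    have hlim : Tendsto (fun R : ℕ => ∫⁻ ω, ENNReal.ofReal (min (X₀ ω) R) ∂μ₀ +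
        ENNReal.ofReal (C / R)) atTop (𝓝 (∫⁻ ω, ENNReal.ofReal (X₀ ω) ∂μ₀ + 0)) := by
      refine hmono.add ?_
      have := ENNReal.tendsto_ofReal (tendsto_const_div_atTop_nhds_zero_nat C)
      rwa [ENNReal.ofReal_zero] at this
    rw [add_zero] at hlim
    refine ge_of_tendsto hlim ?_
    filter_upwards [eventually_ge_atTop 1] with R hR1 using hle R hR1

end UniformIntegrability

/-! ### Existence of a measure with prescribed limiting moments -/

section Existence

/-- A sequence of probability measures on `[0, ∞)` with convergent moments has a limit point with the
limits as moments. -/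
theorem exists_measure_of_tendsto_moments {ν : ℕ → Measure ℝ} [∀ n, IsProbabilityMeasure (ν n)]
    (hν : ∀ n, ∀ᵐ x ∂(ν n), 0 ≤ x) {M : ℕ → ℝ} (hM : ∀ p, 0 ≤ M p)
    (h : ∀ p : ℕ, Tendsto (fun n => ∫⁻ x, ENNReal.ofReal (x ^ p) ∂(ν n)) atTop
      (𝓝 (ENNReal.ofReal (M p)))) :
    ∃ μ : Measure ℝ, IsProbabilityMeasure μ ∧ (∀ᵐ x ∂μ, 0 ≤ x) ∧
      ∀ p : ℕ, ∫⁻ x, ENNReal.ofReal (x ^ p) ∂μ = ENNReal.ofReal (M p) := by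
  set ν' : ℕ → ProbabilityMeasure ℝ := fun n => ⟨ν n, inferInstance⟩ with hν'
  have hlt : ∀ p, ENNReal.ofReal (M p) < ENNReal.ofReal (M p + 1) := fun p =>
    (ENNReal.ofReal_lt_ofReal_iff (by linarith [hM p])).2 (by linarith)
  obtain ⟨N, hN⟩ := eventually_atTop.1 ((h 1).eventually_lt_const (hlt 1))
  simp only [pow_one] at hN
  have htight : IsTightMeasureSet
      {((μ : ProbabilityMeasure ℝ) : Measure ℝ) | μ ∈ ν' '' Set.Ici N} := by
    rw [isTightMeasureSet_iff_exists_isCompact_measure_compl_le]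
    intro ε hε
    -- Markov's inequality: from time `N` on the first moment is below `M 1 + 1`, so the mass
    -- outside `[0, R]` is at most `(M 1 + 1) / R`.
    have h0 := ENNReal.tendsto_ofReal (tendsto_const_div_atTop_nhds_zero_nat (M 1 + 1))
    rw [ENNReal.ofReal_zero] at h0
    obtain ⟨R, hR0, hR⟩ := ((eventually_gt_atTop 0).and (h0.eventually_le_const hε)).exists
    refine ⟨Set.Icc 0 R, isCompact_Icc, ?_⟩
    rintro _ ⟨_, ⟨n, hn, rfl⟩, rfl⟩
    have hRpos : (0 : ℝ) < R := by exact_mod_cast hR0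
    have h1 : ν n (Set.Icc 0 (R : ℝ))ᶜ ≤ ν n {x | ENNReal.ofReal R ≤ ENNReal.ofReal x} := by
      refine measure_mono_ae ?_
      filter_upwards [hν n] with x hx hxR
      change x ∉ Set.Icc (0 : ℝ) R at hxR
      refine ENNReal.ofReal_le_ofReal ?_
      by_contra hlt
      exact hxR ⟨hx, (not_le.1 hlt).le⟩
    refine h1.trans ((meas_ge_le_lintegral_div (by fun_prop) (by simpa using hR0.ne')
      ENNReal.ofReal_ne_top).trans (le_trans ?_ hR))
    rw [ENNReal.ofReal_div_of_pos hRpos]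
    exact ENNReal.div_le_div_right (hN n hn).le _
  have hcomp := isCompact_closure_of_isTightMeasureSet htight
  -- Compactness is used through a nonprincipal ultrafilter, along which the laws converge without
  -- passing to a subsequence.
  set U : Ultrafilter ℕ := hyperfilter ℕ with hU
  have hUle : (U : Filter ℕ) ≤ atTop := Nat.hyperfilter_le_atTop
  obtain ⟨μ, -, hμ⟩ := hcomp.ultrafilter_le_nhds (U.map ν') (by
    rw [le_principal_iff]
    have : ∀ᶠ n in (U : Filter ℕ), ν' n ∈ closure (ν' '' Set.Ici N) := by
      filter_upwards [hUle (eventually_ge_atTop N)] with n hn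
      exact subset_closure ⟨n, hn, rfl⟩
    exact this)
  have hμ' : Tendsto ν' U (𝓝 μ) := hμ
  rw [ProbabilityMeasure.tendsto_iff_forall_integral_tendsto] at hμ'
  -- Mapping by `max x 0` places the limit on `[0, ∞)` by construction, and `min (max x 0 ^ p) R` is
  -- a bounded continuous test function on all of `ℝ`.
  have hm : Measurable fun x : ℝ => max x 0 := by fun_prop
  refine ⟨(μ : Measure ℝ).map fun x => max x 0, Measure.isProbabilityMeasure_map hm.aemeasurable, ?_,
    fun p => ?_⟩
  · rw [ae_map_iff hm.aemeasurable measurableSet_Ici]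
    exact Filter.Eventually.of_forall fun x => le_max_right _ _
  · rw [lintegral_map (by fun_prop) hm]
    have hae : ∀ n, ∀ᵐ x ∂(ν n), max x 0 = x := fun n => by
      filter_upwards [hν n] with x hx using max_eq_left hx
    refine lintegral_eq_of_tendsto_trunc (l := (U : Filter ℕ)) (μ := ν)
      (X := fun _ x => max x 0 ^ p) (C := M (2 * p) + 1) (fun n => by fun_prop)
      (fun n => Filter.Eventually.of_forall fun x => by positivity) (by fun_prop)
      (Filter.Eventually.of_forall fun x => by positivity) (fun R => ?_) ?_ ?_
    · have := hμ' (BoundedContinuousFunction.ofNormedAddCommGroup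
        (fun x : ℝ => min (max x 0 ^ p) R) (by fun_prop) R fun x => by
          rw [Real.norm_of_nonneg (by positivity)]
          exact min_le_right _ _)
      exact this
    · refine ((h p).mono_left hUle).congr fun n => lintegral_congr_ae ?_
      filter_upwards [hae n] with x hx
      rw [hx]
    · have h2 := ((h (2 * p)).mono_left hUle)
      filter_upwards [h2.eventually_lt_const (hlt _)] with n hn
      refine le_trans (le_of_eq (lintegral_congr_ae ?_)) hn.le
      filter_upwards [hae n] with x hx
      rw [hx, ← pow_mul, mul_comm]

end Existence
end AlphaGamma

namespace AlphaGamma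

/-! ### Existence of the stable law and of the Mittag-Leffler density -/

section StableLaw

variable {γ : ℝ}

/-- The distribution of `X ^ γ * Y` for independent `X` and `Y` with distributions `μ` and `ν`. -/
noncomputable def rpowMulLaw (γ : ℝ) (μ ν : Measure ℝ) : Measure ℝ :=
  (μ.prod ν).map fun p => p.1 ^ γ * p.2

theorem measurable_rpow_mul : Measurable fun p : ℝ × ℝ => p.1 ^ γ * p.2 := by fun_prop

instance {μ ν : Measure ℝ} [IsProbabilityMeasure μ] [IsProbabilityMeasure ν] :
    IsProbabilityMeasure (rpowMulLaw γ μ ν) :=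
  Measure.isProbabilityMeasure_map measurable_rpow_mul.aemeasurable

theorem ae_prod_of_ae {μ ν : Measure ℝ} [SFinite μ] [SFinite ν] {p q : ℝ → Prop}
    (hp : ∀ᵐ x ∂μ, p x) (hq : ∀ᵐ y ∂ν, q y) : ∀ᵐ z ∂(μ.prod ν), p z.1 ∧ q z.2 :=
  (Measure.quasiMeasurePreserving_fst.ae hp).and (Measure.quasiMeasurePreserving_snd.ae hq)

theorem ae_rpowMulLaw_nonneg {μ ν : Measure ℝ} [SFinite μ] [SFinite ν]
    (hμ : ∀ᵐ x ∂μ, 0 ≤ x) (hν : ∀ᵐ x ∂ν, 0 ≤ x) : ∀ᵐ x ∂(rpowMulLaw γ μ ν), 0 ≤ x := by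
  rw [rpowMulLaw, ae_map_iff measurable_rpow_mul.aemeasurable measurableSet_Ici]
  filter_upwards [ae_prod_of_ae hμ hν] with z hz
  exact mul_nonneg (Real.rpow_nonneg hz.1 _) hz.2

theorem lintegral_rpowMulLaw {μ ν : Measure ℝ} [SFinite μ] [SFinite ν]
    (hμ : ∀ᵐ x ∂μ, 0 ≤ x) (n : ℕ) :
    ∫⁻ x, ENNReal.ofReal (x ^ n) ∂(rpowMulLaw γ μ ν) =
      (∫⁻ x, ENNReal.ofReal (x ^ (γ * n)) ∂μ) * ∫⁻ x, ENNReal.ofReal (x ^ n) ∂ν := by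
  rw [rpowMulLaw, lintegral_map (by fun_prop) measurable_rpow_mul,
    ← lintegral_prod_mul (by fun_prop) (by fun_prop)]
  refine lintegral_congr_ae ?_
  filter_upwards [Measure.quasiMeasurePreserving_fst.ae hμ] with z hz
  rw [mul_pow, ENNReal.ofReal_mul (by positivity), Real.rpow_mul hz, Real.rpow_natCast]

/-- The product of independent powers of beta variables. -/
noncomputable def betaProductLaw (γ : ℝ) : ℕ → Measure ℝ
  | 0 => Measure.dirac 1
  | m + 1 => rpowMulLaw γ (betaLaw ((m + 2) * γ) (1 - γ)) (betaProductLaw γ m)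

theorem isProbabilityMeasure_betaProductLaw (hγ0 : 0 < γ) (hγ1 : γ < 1) (m : ℕ) :
    IsProbabilityMeasure (betaProductLaw γ m) := by
  induction m with
  | zero => rw [betaProductLaw]; infer_instance
  | succ m ih =>
    have := isProbabilityMeasure_betaLaw (a := (m + 2) * γ) (b := 1 - γ) (by positivity)
      (by linarith)
    rw [betaProductLaw]
    infer_instance

theorem ae_betaProductLaw (hγ0 : 0 < γ) (hγ1 : γ < 1) (m : ℕ) :
    ∀ᵐ x ∂(betaProductLaw γ m), 0 ≤ x := by
  induction m with
  | zero =>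
    rw [betaProductLaw, ae_dirac_iff measurableSet_Ici]
    exact zero_le_one
  | succ m ih =>
    have := isProbabilityMeasure_betaLaw (a := (m + 2) * γ) (b := 1 - γ) (by positivity)
      (by linarith)
    have := isProbabilityMeasure_betaProductLaw hγ0 hγ1 m
    rw [betaProductLaw]
    exact ae_rpowMulLaw_nonneg (ae_betaLaw.mono fun x hx => hx.1.le) ih

/-- The moments of `betaProductLaw`. -/
noncomputable def betaProductMoment (γ : ℝ) (m : ℕ) (p : ℝ) : ℝ :=
  (Real.Gamma (p + 2) * Real.Gamma (γ + 1) / Real.Gamma ((1 + p) * γ + 1)) *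
    (Real.Gamma ((m + 1) * γ + 1 + γ * p) / Real.Gamma ((m + 1) * γ + 1)) *
    (Real.Gamma (m + 2) / Real.Gamma (m + 2 + p))

/-- The parameters `((m + 2) γ, 1 - γ)` are chosen so that `(m + 2) γ + (1 - γ) = (m + 1) γ + 1`;
the Gamma factors of consecutive beta moments then telescope up to linear factors. -/
theorem lintegral_betaProductLaw (hγ0 : 0 < γ) (hγ1 : γ < 1) (m p : ℕ) :
    ∫⁻ x, ENNReal.ofReal (x ^ p) ∂(betaProductLaw γ m) =
      ENNReal.ofReal (betaProductMoment γ m p) := by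
  have hp : (0 : ℝ) ≤ p := Nat.cast_nonneg p
  have h1 := Real.Gamma_pos_of_pos (show 0 < (p : ℝ) + 2 by positivity)
  have h2 := Real.Gamma_pos_of_pos (show 0 < (1 + p) * γ + 1 by positivity)
  have h3 := Real.Gamma_pos_of_pos (show 0 < γ + 1 by positivity)
  induction m with
  | zero =>
    rw [betaProductLaw, lintegral_dirac' _ (by fun_prop), betaProductMoment, one_pow]
    congr 1
    simp only [Nat.cast_zero, zero_add, one_mul, Real.Gamma_two]
    rw [show γ + 1 + γ * p = (1 + p) * γ + 1 by ring, show (2 : ℝ) + p = p + 2 by ring]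
    field_simp
  | succ m ih =>
    have := isProbabilityMeasure_betaLaw (a := (m + 2) * γ) (b := 1 - γ) (by positivity)
      (by linarith)
    have := isProbabilityMeasure_betaProductLaw hγ0 hγ1 m
    rw [betaProductLaw, lintegral_rpowMulLaw (ae_betaLaw.mono fun x hx => hx.1.le), ih,
      lintegral_betaLaw_rpow (by positivity) (by linarith) (by positivity)]
    have e1 : 0 < ((m : ℝ) + 2) * γ := by positivity
    have e2 : 0 < ((m : ℝ) + 2) * γ + γ * p := by positivity
    have g1 := Real.Gamma_pos_of_pos e1
    have g2 := Real.Gamma_pos_of_pos e2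
    have g3 := Real.Gamma_pos_of_pos (show 0 < ((m : ℝ) + 1) * γ + 1 by positivity)
    have g4 := Real.Gamma_pos_of_pos (show 0 < ((m : ℝ) + 1) * γ + 1 + γ * p by positivity)
    have g5 := Real.Gamma_pos_of_pos (show 0 < (m : ℝ) + 2 by positivity)
    have g6 := Real.Gamma_pos_of_pos (show 0 < (m : ℝ) + 2 + p by positivity)
    rw [← ENNReal.ofReal_mul (by
      rw [show ((m : ℝ) + 2) * γ + (1 - γ) = (m + 1) * γ + 1 by ring]
      positivity)]
    congr 1
    rw [betaProductMoment, betaProductMoment,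
      show ((m : ℝ) + 2) * γ + (1 - γ) = (m + 1) * γ + 1 by ring]
    push_cast
    rw [show ((m : ℝ) + 1 + 1) * γ + 1 + γ * p = ((m + 2) * γ + γ * p) + 1 by ring,
      show ((m : ℝ) + 1 + 1) * γ + 1 = (m + 2) * γ + 1 by ring,
      show (m : ℝ) + 1 + 2 + p = m + 2 + p + 1 by ring,
      show (m : ℝ) + 1 + 2 = m + 2 + 1 by ring, Real.Gamma_add_one e1.ne',
      Real.Gamma_add_one e2.ne', Real.Gamma_add_one (s := (m : ℝ) + 2 + p) (by positivity),
      Real.Gamma_add_one (s := (m : ℝ) + 2) (by positivity)]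
    field_simp

/-- The scaling constants for `betaProductLaw`. -/
noncomputable def betaProductScale (γ : ℝ) (m : ℕ) : ℝ := (m + 2) / ((m + 1) * γ + 1) ^ γ

theorem tendsto_betaProductMoment (hγ0 : 0 < γ) (p : ℕ) :
    Tendsto (fun m => betaProductScale γ m ^ p * betaProductMoment γ m p) atTop
      (𝓝 (Real.Gamma (p + 2) * Real.Gamma (γ + 1) / Real.Gamma ((1 + p) * γ + 1))) := by
  have t1 : Tendsto (fun m : ℕ => ((m : ℝ) + 1) * γ + 1) atTop atTop :=
    tendsto_atTop_add_const_right _ _ ((tendsto_atTop_add_const_right _ _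
      tendsto_natCast_atTop_atTop).atTop_mul_const hγ0)
  have t2 : Tendsto (fun m : ℕ => (m : ℝ) + 2) atTop atTop :=
    tendsto_atTop_add_const_right _ _ tendsto_natCast_atTop_atTop
  have l1 := (tendsto_Gamma_ratio (s := γ * p) (by positivity)).comp t1
  have l2 := (tendsto_Gamma_ratio (s := (p : ℝ)) (by positivity)).comp t2
  have l3 := (l1.div l2 one_ne_zero).const_mul
    (Real.Gamma (p + 2) * Real.Gamma (γ + 1) / Real.Gamma ((1 + p) * γ + 1))
  rw [div_one, mul_one] at l3
  refine l3.congr fun m => ?_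
  simp only [Function.comp_apply, Pi.div_apply, betaProductMoment, betaProductScale]
  have g3 := Real.Gamma_pos_of_pos (show 0 < ((m : ℝ) + 1) * γ + 1 by positivity)
  have g5 := Real.Gamma_pos_of_pos (show 0 < (m : ℝ) + 2 by positivity)
  have g6 := Real.Gamma_pos_of_pos (show 0 < (m : ℝ) + 2 + p by positivity)
  have g7 : 0 < (((m : ℝ) + 1) * γ + 1) := by positivity
  rw [div_pow, Real.rpow_mul g7.le, Real.rpow_natCast, Real.rpow_natCast]
  have g8 := Real.rpow_pos_of_pos g7 γ
  field_simp

/-- The limiting moments are those of order `p + 1` of the Mittag-Leffler law divided by its mean,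
so `μ` is the size-biased Mittag-Leffler law. A further beta factor later undoes the bias and
supplies absolute continuity. -/
theorem exists_betaProduct_limit (hγ0 : 0 < γ) (hγ1 : γ < 1) :
    ∃ μ : Measure ℝ, IsProbabilityMeasure μ ∧ (∀ᵐ x ∂μ, 0 ≤ x) ∧
      ∀ p : ℕ, ∫⁻ x, ENNReal.ofReal (x ^ p) ∂μ = ENNReal.ofReal
        (Real.Gamma (p + 2) * Real.Gamma (γ + 1) / Real.Gamma ((1 + p) * γ + 1)) := by
  have hprob := isProbabilityMeasure_betaProductLaw hγ0 hγ1
  have hm : ∀ m, Measurable fun x => betaProductScale γ m * x := fun m => by fun_prop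
  have hs : ∀ m, 0 ≤ betaProductScale γ m := fun m => by rw [betaProductScale]; positivity
  have : ∀ m, IsProbabilityMeasure ((betaProductLaw γ m).map fun x => betaProductScale γ m * x) :=
    fun m => Measure.isProbabilityMeasure_map (hm m).aemeasurable
  refine exists_measure_of_tendsto_moments
    (ν := fun m => (betaProductLaw γ m).map fun x => betaProductScale γ m * x)
    (fun m => ?_) (fun p => ?_) fun p => ?_
  · rw [ae_map_iff (hm m).aemeasurable measurableSet_Ici]
    filter_upwards [ae_betaProductLaw hγ0 hγ1 m] with x hx using mul_nonneg (hs m) hx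
  · have h1 := Real.Gamma_pos_of_pos (show 0 < (p : ℝ) + 2 by positivity)
    have h2 := Real.Gamma_pos_of_pos (show 0 < (1 + p) * γ + 1 by positivity)
    have h3 := Real.Gamma_pos_of_pos (show 0 < γ + 1 by positivity)
    positivity
  · refine (ENNReal.tendsto_ofReal (tendsto_betaProductMoment hγ0 p)).congr fun m => ?_
    rw [lintegral_map (by fun_prop) (hm m), ENNReal.ofReal_mul (pow_nonneg (hs m) _),
      ← lintegral_betaProductLaw hγ0 hγ1, ← lintegral_const_mul _ (by fun_prop)]
    refine lintegral_congr fun x => ?_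
    rw [mul_pow, ENNReal.ofReal_mul (pow_nonneg (hs m) _)]

/-- The exponential distribution with mean `1`. -/
noncomputable def expLaw : Measure ℝ :=
  (volume.restrict (Set.Ioi 0)).withDensity fun x => ENNReal.ofReal (Real.exp (-x))

theorem expLaw_Ioi {s : ℝ} (hs : 0 ≤ s) :
    expLaw (Set.Ioi s) = ENNReal.ofReal (Real.exp (-s)) := by
  rw [expLaw, withDensity_apply _ measurableSet_Ioi, Measure.restrict_restrict measurableSet_Ioi,
    Set.Ioi_inter_Ioi, sup_eq_left.2 hs]
  exact lintegral_ofReal_of_integral_eq (Filter.Eventually.of_forall fun x => (Real.exp_pos _).le)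
    (Real.exp_pos _).ne' (integral_exp_neg_Ioi s)

theorem ae_expLaw : ∀ᵐ x ∂expLaw, 0 < x :=
  (withDensity_absolutelyContinuous _ _).ae_le (ae_restrict_mem measurableSet_Ioi)

instance : IsProbabilityMeasure expLaw := by
  constructor
  have h : expLaw Set.univ = expLaw (Set.Ioi 0) := by
    refine measure_congr ?_
    filter_upwards [ae_expLaw] with x hx
    exact propext ⟨fun _ => hx, fun _ => trivial⟩
  rw [h, expLaw_Ioi le_rfl]
  simp

theorem lintegral_expLaw_rpow {s : ℝ} (hs : 0 ≤ s) :
    ∫⁻ x, ENNReal.ofReal (x ^ s) ∂expLaw = ENNReal.ofReal (Real.Gamma (s + 1)) := by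
  rw [expLaw, lintegral_withDensity_eq_lintegral_mul _ (by fun_prop) (by fun_prop)]
  have hG := Real.Gamma_eq_integral (show 0 < s + 1 by linarith)
  have hpos := Real.Gamma_pos_of_pos (show 0 < s + 1 by linarith)
  rw [← lintegral_ofReal_of_integral_eq _ hpos.ne' hG.symm]
  · refine setLIntegral_congr_fun measurableSet_Ioi fun x hx => ?_
    rw [Pi.mul_apply, ← ENNReal.ofReal_mul (Real.exp_pos _).le, add_sub_cancel_right]
  · filter_upwards [ae_restrict_mem measurableSet_Ioi] with x hx
    exact mul_nonneg (Real.exp_pos _).le (Real.rpow_nonneg (le_of_lt hx) _)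

theorem lintegral_exp_expLaw_lt_top :
    ∫⁻ x, ENNReal.ofReal (Real.exp (1 / 2 * x)) ∂expLaw < ∞ := by
  rw [expLaw, lintegral_withDensity_eq_lintegral_mul _ (by fun_prop) (by fun_prop)]
  have h := (integrableOn_exp_mul_Ioi (a := -(1 / 2 : ℝ)) (by norm_num) 0).lintegral_lt_top
  refine lt_of_le_of_lt (le_of_eq (lintegral_congr fun x => ?_)) h
  rw [Pi.mul_apply, ← ENNReal.ofReal_mul (Real.exp_pos _).le, ← Real.exp_add]
  congr 2
  ring

/-- A measure with the Mittag-Leffler moments, multiplied by an independent power of an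
exponential variable, is exponentially distributed. -/
theorem rpowMulLaw_expLaw (hγ : 0 < γ) {μ : Measure ℝ} [IsProbabilityMeasure μ]
    (hμ : ∀ᵐ x ∂μ, 0 ≤ x) (h : ∀ p : ℕ, ∫⁻ x, ENNReal.ofReal (x ^ p) ∂μ =
      ENNReal.ofReal (Real.Gamma (p + 1) / Real.Gamma (γ * p + 1))) :
    rpowMulLaw γ expLaw μ = expLaw := by
  have he := ae_expLaw.mono fun x hx => hx.le
  refine ext_of_lintegral_pow (ae_rpowMulLaw_nonneg he hμ) he (fun n => ?_)
    (s := 1 / 2) (by norm_num) lintegral_exp_expLaw_lt_top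
  have hG := Real.Gamma_pos_of_pos (show 0 < γ * n + 1 by positivity)
  have h2 := lintegral_expLaw_rpow (s := n) (Nat.cast_nonneg _)
  simp only [Real.rpow_natCast] at h2
  rw [lintegral_rpowMulLaw he, lintegral_expLaw_rpow (by positivity), h, h2,
    ← ENNReal.ofReal_mul hG.le]
  congr 1
  field_simp

/-- A zero of the second factor would make the product zero, while an exponential variable is almost
surely positive. -/
theorem ae_pos_of_rpowMulLaw_expLaw {μ : Measure ℝ} [IsProbabilityMeasure μ]
    (hμ : ∀ᵐ x ∂μ, 0 ≤ x) (h : rpowMulLaw γ expLaw μ = expLaw) : ∀ᵐ x ∂μ, 0 < x := by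
  have h1 := ae_expLaw
  rw [← h, rpowMulLaw, ae_map_iff measurable_rpow_mul.aemeasurable measurableSet_Ioi] at h1
  have h2 : ∀ᵐ z ∂(expLaw.prod μ), z.2 ≠ 0 := by
    filter_upwards [h1] with z hz h0
    rw [h0, mul_zero] at hz
    exact lt_irrefl _ hz
  have h3 : ∀ᵐ x ∂((expLaw.prod μ).map Prod.snd), x ≠ 0 := by
    rw [ae_map_iff measurable_snd.aemeasurable (by measurability)]
    exact h2
  rw [← Measure.snd, Measure.snd_prod] at h3
  filter_upwards [hμ, h3] with x hx hx' using lt_of_le_of_ne hx (Ne.symm hx')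

/-- For an exponential `E` independent of `X`, conditioning on `X` turns the Laplace transform of `X
^ (-1/γ)` at `x` into the probability of `E > x X ^ (-1/γ)`. This event is `E ^ γ X > x ^ γ`, and `E
^ γ X` is again exponential, so its probability is `exp (-x ^ γ)`. -/
theorem isStableLaw_of_rpowMulLaw_expLaw (hγ : 0 < γ) {μ : Measure ℝ} [IsProbabilityMeasure μ]
    (hμ : ∀ᵐ x ∂μ, 0 < x) (h : rpowMulLaw γ expLaw μ = expLaw) :
    IsStableLaw γ (μ.map fun x => x ^ (-γ⁻¹)) where
  prob := Measure.isProbabilityMeasure_map (by fun_prop)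
  nonneg := by
    rw [Measure.map_apply (by fun_prop) measurableSet_Iio, measure_eq_zero_iff_ae_notMem]
    filter_upwards [hμ] with x hx
    simpa using Real.rpow_nonneg hx.le _
  laplace x hx := by
    have hs : 0 ≤ x ^ γ := Real.rpow_nonneg hx _
    have h1 := expLaw_Ioi hs
    rw [← h, rpowMulLaw, Measure.map_apply measurable_rpow_mul measurableSet_Ioi,
      Measure.prod_apply_symm (measurable_rpow_mul measurableSet_Ioi)] at h1
    rw [integral_map (by fun_prop) (by fun_prop), integral_eq_lintegral_of_nonneg_ae
      (Filter.Eventually.of_forall fun y => (Real.exp_pos _).le) (by fun_prop)]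
    rw [← ENNReal.toReal_ofReal (Real.exp_pos (-x ^ γ)).le, ← h1]
    congr 1
    refine lintegral_congr_ae ?_
    filter_upwards [hμ] with m hm
    have hxm : 0 ≤ x * m ^ (-γ⁻¹) := mul_nonneg hx (Real.rpow_nonneg hm.le _)
    rw [← expLaw_Ioi hxm]
    refine measure_congr ?_
    filter_upwards [ae_expLaw] with y hy
    refine propext ?_
    change x * m ^ (-γ⁻¹) < y ↔ x ^ γ < y ^ γ * m
    rw [← Real.rpow_lt_rpow_iff hxm hy.le hγ, Real.mul_rpow hx (Real.rpow_nonneg hm.le _),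
      ← Real.rpow_mul hm.le, neg_mul, inv_mul_cancel₀ hγ.ne', Real.rpow_neg_one, ← div_eq_mul_inv,
      div_lt_iff₀ hm]

/-- For fixed second factor `z` the preimage of a null set `N` is, almost surely, contained in its
image under `y ↦ (y / z) ^ (1/γ)`, and differentiable maps send null sets to null sets. -/
theorem rpowMulLaw_absolutelyContinuous (hγ : 0 < γ) {μ ν : Measure ℝ} [IsProbabilityMeasure μ]
    [IsProbabilityMeasure ν] (hμ : ∀ᵐ x ∂μ, 0 < x) (hν : ∀ᵐ x ∂ν, 0 < x) (hac : μ ≪ volume) :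
    rpowMulLaw γ μ ν ≪ volume.restrict (Set.Ioi 0) := by
  refine Measure.AbsolutelyContinuous.mk fun N hN hN0 => ?_
  rw [Measure.restrict_apply hN] at hN0
  rw [rpowMulLaw, Measure.map_apply measurable_rpow_mul hN,
    Measure.prod_apply_symm (measurable_rpow_mul hN), lintegral_eq_zero_iff'
      (measurable_measure_prodMk_right (measurable_rpow_mul hN)).aemeasurable]
  filter_upwards [hν] with z hz
  have hsub : volume ((fun y : ℝ => (y / z) ^ γ⁻¹) '' (N ∩ Set.Ioi 0)) = 0 := by
    refine addHaar_image_eq_zero_of_differentiableOn_of_addHaar_eq_zero volume ?_ hN0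
    intro y hy
    have : y / z ≠ 0 := (div_pos hy.2 hz).ne'
    refine DifferentiableAt.differentiableWithinAt ?_
    exact (differentiableAt_id.div_const z).rpow_const (Or.inl this)
  refine measure_mono_null_ae ?_ (hac hsub)
  filter_upwards [hμ] with x hx hxN
  refine ⟨x ^ γ * z, ⟨hxN, mul_pos (Real.rpow_pos_of_pos hx _) hz⟩, ?_⟩
  simp only
  rw [mul_div_cancel_right₀ _ hz.ne', ← Real.rpow_mul hx.le, mul_inv_cancel₀ hγ.ne', Real.rpow_one]

/-- If `Y` has the law obtained in `exists_betaProduct_limit` and `β` is independent with law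
`beta(γ, 1 - γ)`, then `β ^ γ Y` has the moments `Γ(p + 1) / Γ(γ p + 1)`. It is absolutely
continuous because `β` is, and `(β ^ γ Y) ^ (-1/γ)` is stable. The density is the Radon–Nikodym
derivative. -/
theorem exists_isMittagLefflerDensity (hγ0 : 0 < γ) (hγ1 : γ < 1) :
    ∃ g, IsMittagLefflerDensity γ g := by
  obtain ⟨ν, hν, hν0, hνm⟩ := exists_betaProduct_limit hγ0 hγ1
  have hβ := isProbabilityMeasure_betaLaw hγ0 (sub_pos.2 hγ1).le
  set μ := rpowMulLaw γ (betaLaw γ (1 - γ)) ν with hμdef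
  have hβ0 : ∀ᵐ x ∂(betaLaw γ (1 - γ)), 0 < x := ae_betaLaw.mono fun x hx => hx.1
  have hμm : ∀ p : ℕ, ∫⁻ x, ENNReal.ofReal (x ^ p) ∂μ =
      ENNReal.ofReal (Real.Gamma (p + 1) / Real.Gamma (γ * p + 1)) := by
    intro p
    have e1 : (0 : ℝ) < p + 1 := by positivity
    have e2 : 0 < γ + γ * p := by positivity
    have g1 := Real.Gamma_pos_of_pos e1
    have g2 := Real.Gamma_pos_of_pos e2
    have g3 := Real.Gamma_pos_of_pos hγ0
    have g4 := Real.Gamma_pos_of_pos (show 0 < γ * p + 1 by positivity)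
    rw [lintegral_rpowMulLaw (hβ0.mono fun x hx => hx.le), hνm,
      lintegral_betaLaw_rpow hγ0 (by linarith) (by positivity), ← ENNReal.ofReal_mul (by
        rw [show γ + (1 - γ) = 1 by ring, show 1 + γ * p = γ * p + 1 by ring]
        simp only [Real.Gamma_one]
        positivity)]
    congr 1
    rw [show γ + (1 - γ) = 1 by ring, show (p : ℝ) + 2 = p + 1 + 1 by ring,
      show (1 + (p : ℝ)) * γ + 1 = γ + γ * p + 1 by ring, show 1 + γ * p = γ * p + 1 by ring,
      Real.Gamma_add_one e1.ne', Real.Gamma_add_one e2.ne', Real.Gamma_add_one hγ0.ne',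
      Real.Gamma_one]
    field_simp
    ring
  have hμ0 : ∀ᵐ x ∂μ, 0 ≤ x := ae_rpowMulLaw_nonneg (hβ0.mono fun x hx => hx.le) hν0
  have hexp := rpowMulLaw_expLaw hγ0 hμ0 hμm
  have hμpos := ae_pos_of_rpowMulLaw_expLaw hμ0 hexp
  have hνpos : ∀ᵐ x ∂ν, 0 < x := by
    have h1 := hμpos
    rw [hμdef, rpowMulLaw, ae_map_iff measurable_rpow_mul.aemeasurable measurableSet_Ioi] at h1
    have h3 : ∀ᵐ x ∂(((betaLaw γ (1 - γ)).prod ν).map Prod.snd), x ≠ 0 := by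
      rw [ae_map_iff measurable_snd.aemeasurable (by measurability)]
      filter_upwards [h1] with z hz h0
      rw [h0, mul_zero] at hz
      exact lt_irrefl _ hz
    rw [← Measure.snd, Measure.snd_prod] at h3
    filter_upwards [hν0, h3] with x hx hx' using lt_of_le_of_ne hx (Ne.symm hx')
  have hac : μ ≪ volume.restrict (Set.Ioi 0) := by
    refine rpowMulLaw_absolutelyContinuous hγ0 hβ0 hνpos ?_
    rw [betaLaw, if_neg (sub_pos.2 hγ1).ne', betaMeasure]
    exact withDensity_absolutelyContinuous _ _
  refine ⟨fun s => (μ.rnDeriv (volume.restrict (Set.Ioi 0)) s).toReal,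
    (Measure.measurable_rnDeriv _ _).ennreal_toReal, fun s => ENNReal.toReal_nonneg,
    μ.map fun x => x ^ (-γ⁻¹), isStableLaw_of_rpowMulLaw_expLaw hγ0 hμpos hexp, ?_⟩
  have h1 : (μ.map fun x => x ^ (-γ⁻¹)).map (fun y => y ^ (-γ)) = μ := by
    rw [Measure.map_map (by fun_prop) (by fun_prop)]
    conv_rhs => rw [← Measure.map_id (μ := μ)]
    refine Measure.map_congr ?_
    filter_upwards [hμpos] with x hx
    rw [Function.comp_apply, ← Real.rpow_mul hx.le, neg_mul_neg, inv_mul_cancel₀ hγ0.ne',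
      Real.rpow_one, id]
  rw [h1]
  conv_lhs => rw [← Measure.withDensity_rnDeriv_eq _ _ hac]
  refine withDensity_congr_ae ?_
  filter_upwards [Measure.rnDeriv_lt_top μ (volume.restrict (Set.Ioi 0))] with x hx
  rw [ENNReal.ofReal_toReal hx.ne]

end StableLaw
end AlphaGamma

namespace AlphaGamma

/-! ### Rising factorials and the eigenfunctions of the growth rules -/

section Functionals

/-- The rising factorial `x (x + 1) ⋯ (x + c - 1)`. -/
noncomputable def rising (x : ℝ) (c : ℕ) : ℝ := ∏ i ∈ Finset.range c, (x + i)

/-- Both sides are the product of the factors `x, …, x + c`. In urn terms: a selection with weight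
`x` that raises `x` by one multiplies the rising factorial by `(x + c) / x`. -/
theorem mul_rising_add_one (x : ℝ) (c : ℕ) : x * rising (x + 1) c = rising x c * (x + c) := by
  rw [rising, rising, ← Finset.prod_range_succ (fun i : ℕ => x + (i : ℝ)), Finset.prod_range_succ']
  push_cast
  rw [mul_comm]
  simp only [add_zero, add_assoc, add_comm (1 : ℝ)]

@[simp]
theorem rising_zero (x : ℝ) : rising x 0 = 1 := by simp [rising]

@[simp]
theorem rising_one (x : ℝ) : rising x 1 = x := by simp [rising]

theorem rising_nonneg {x : ℝ} (hx : 0 ≤ x) (c : ℕ) : 0 ≤ rising x c :=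
  Finset.prod_nonneg fun i _ => by positivity

theorem rising_eq_Gamma {x : ℝ} (hx : 0 < x) (c : ℕ) :
    rising x c = Real.Gamma (x + c) / Real.Gamma x := by
  have hG := Real.Gamma_pos_of_pos hx
  induction c with
  | zero => simp [hG.ne']
  | succ c ih =>
    rw [rising, Finset.prod_range_succ, ← rising, ih]
    push_cast
    rw [← add_assoc, Real.Gamma_add_one (by positivity)]
    ring

/-- The last `c` factors of the longer product dominate the first `c`. So squares of the
eigenfunctions are bounded by members of the same family. -/
theorem rising_sq_le {x y : ℝ} (hx : 0 ≤ x) (hxy : x ≤ y) (c : ℕ) :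
    rising x c ^ 2 ≤ rising y (2 * c) := by
  have hy : 0 ≤ y := hx.trans hxy
  rw [two_mul, rising, rising, Finset.prod_range_add, sq]
  refine mul_le_mul ?_ ?_ (Finset.prod_nonneg fun i _ => by positivity)
    (Finset.prod_nonneg fun i _ => by positivity)
  · exact Finset.prod_le_prod (fun i _ => by positivity) fun i _ => by linarith
  · refine Finset.prod_le_prod (fun i _ => by positivity) fun i _ => ?_
    push_cast
    linarith [(Nat.cast_nonneg c : (0 : ℝ) ≤ c)]

variable {B K : Finset ℕ} {t : Finset (Finset ℕ)} {α γ : ℝ}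

/-- The number of edges of `t` that form the edge `C` of the reduced tree, shifted so that it is
`1 / γ` times their total weight. -/
noncomputable def edgeVar (α γ : ℝ) (K C : Finset ℕ) (t : Finset (Finset ℕ)) : ℝ :=
  edgeParam α γ C + (reducedLength t K C - 1)

theorem mul_edgeParam (hγ : γ ≠ 0) (A : Finset ℕ) : γ * edgeParam α γ A = edgeWeight α γ A := by
  rw [edgeParam, edgeWeight]
  split_ifs
  · field_simp
  · ring

theorem edgeParam_pos (hα1 : α < 1) (hγ : 0 < γ) (A : Finset ℕ) : 0 < edgeParam α γ A := by
  have := edgeWeight_pos (α := α) hα1 hγ A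
  rw [← mul_edgeParam hγ.ne'] at this
  exact pos_of_mul_pos_right this hγ.le

/-- The total weight of the edges and branch points at which an insertion leads to a leaf attached
to an edge of the reduced tree. -/
noncomputable def groupVar (α γ : ℝ) (K B : Finset ℕ) (t : Finset (Finset ℕ)) : ℝ :=
  ∑ C ∈ reducedShape t K, edgeWeight α γ C + edgeLeafCount t B K

/-- A polynomial in the variables `edgeVar` and `groupVar` that is an eigenfunction of the growth
rules. -/
noncomputable def growthPoly (α γ : ℝ) (K : Finset ℕ) (c : Finset ℕ → ℕ) (m : ℕ) (B : Finset ℕ)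
    (t : Finset (Finset ℕ)) : ℝ :=
  (∏ C ∈ reducedShape t K, rising (edgeVar α γ K C t) (c C)) *
    rising (groupVar α γ K B t + γ * ∑ C ∈ reducedShape t K, (c C : ℝ)) m

/-- The weighted sum of `f` over the trees that result from the insertion of the leaf `j`. -/
noncomputable def growthSum (α γ : ℝ) (t : Finset (Finset ℕ)) (j : ℕ)
    (f : Finset (Finset ℕ) → ℝ) : ℝ :=
  ∑ A ∈ t, edgeWeight α γ A * f (insertAtEdge t A j) +
    ∑ v ∈ branchPoints t, vertexWeight α γ t v * f (insertAtVertex t v j)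

theorem IsFragTree.nonempty_of_mem_reducedShape (h : IsFragTree B t) (hK : K ⊆ B) {C : Finset ℕ}
    (hC : C ∈ reducedShape t K) : C.Nonempty := by
  rw [h.reducedShape_eq hK, Finset.mem_erase] at hC
  exact Finset.nonempty_iff_ne_empty.2 hC.1

theorem IsFragTree.one_le_reducedLength (h : IsFragTree B t) (hK : K ⊆ B) {C : Finset ℕ}
    (hC : C ∈ reducedShape t K) : 1 ≤ reducedLength t K C := by
  rw [h.reducedLength_eq hK (h.nonempty_of_mem_reducedShape hK hC)]
  rw [h.reducedShape_eq hK, Finset.mem_erase] at hC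
  obtain ⟨A, hA, rfl⟩ := Finset.mem_image.1 hC.2
  exact Finset.card_pos.2 ⟨A, by simp [hA]⟩

theorem IsFragTree.edgeVar_pos (h : IsFragTree B t) (hK : K ⊆ B) (hα1 : α < 1) (hγ : 0 < γ)
    {C : Finset ℕ} (hC : C ∈ reducedShape t K) : 0 < edgeVar α γ K C t := by
  have h1 : (1 : ℝ) ≤ reducedLength t K C := by exact_mod_cast h.one_le_reducedLength hK hC
  have := edgeParam_pos hα1 hγ C
  rw [edgeVar]
  linarith

theorem groupVar_nonneg (hα1 : α < 1) (hγ : 0 < γ) : 0 ≤ groupVar α γ K B t :=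
  add_nonneg (Finset.sum_nonneg fun C _ => (edgeWeight_pos hα1 hγ C).le) (Nat.cast_nonneg _)

theorem IsFragTree.trace_mem_reducedShape (h : IsFragTree B t) (hK : K ⊆ B) {A : Finset ℕ}
    (hA : A ∈ t) (hAK : (A ∩ K).Nonempty) : A ∩ K ∈ reducedShape t K := by
  rw [h.reducedShape_eq hK, Finset.mem_erase]
  exact ⟨hAK.ne_empty, Finset.mem_image.2 ⟨A, hA, rfl⟩⟩

open Classical in
theorem IsFragTree.growthPoly_insertAtVertex (h : IsFragTree B t) (hK : K ⊆ B) {j : ℕ}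
    (hj : j ∉ B) {v : Finset ℕ} (hv : v ∈ branchPoints t) (c : Finset ℕ → ℕ) (m : ℕ) :
    growthPoly α γ K c m (insert j B) (AlphaGamma.insertAtVertex t v j) =
      (∏ C ∈ reducedShape t K, rising (edgeVar α γ K C t) (c C)) *
        rising (groupVar α γ K B t + γ * ∑ C ∈ reducedShape t K, (c C : ℝ) +
          if OnEdge t K v then 1 else 0) m := by
  rw [growthPoly, groupVar, groupVar, h.reducedShape_insertAtVertex hK hj hv,
    h.edgeLeafCount_insertAtVertex hK hj hv]
  refine congrArg₂ HMul.hMul ?_ (congrArg (fun y => rising y m) ?_)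
  · refine Finset.prod_congr rfl fun C hC => ?_
    rw [edgeVar, edgeVar, h.reducedLength_insertAtVertex hK hj hv
      (h.nonempty_of_mem_reducedShape hK hC)]
  · push_cast
    ring

open Classical in
theorem IsFragTree.growthPoly_insertAtEdge (h : IsFragTree B t) (hK : K ⊆ B) {j : ℕ}
    (hj : j ∉ B) {A : Finset ℕ} (hA : A ∈ t) (c : Finset ℕ → ℕ) (m : ℕ) :
    growthPoly α γ K c m (insert j B) (AlphaGamma.insertAtEdge t A j) =
      (∏ C ∈ reducedShape t K, rising (edgeVar α γ K C t + if A ∩ K = C then 1 else 0) (c C)) *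
        rising (groupVar α γ K B t + γ * ∑ C ∈ reducedShape t K, (c C : ℝ) +
          if (A ∩ K).Nonempty ∨ OnEdge t K A then 1 else 0) m := by
  rw [growthPoly, groupVar, groupVar, h.reducedShape_insertAtEdge hK hj hA,
    h.edgeLeafCount_insertAtEdge hK hj hA]
  refine congrArg₂ HMul.hMul ?_ (congrArg (fun y => rising y m) ?_)
  · refine Finset.prod_congr rfl fun C hC => ?_
    rw [edgeVar, edgeVar, h.reducedLength_insertAtEdge hK hj hA
      (h.nonempty_of_mem_reducedShape hK hC)]
    push_cast
    congr 1
    ring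
  · push_cast
    ring

theorem mul_prod_rising (s : Finset (Finset ℕ)) (x : Finset ℕ → ℝ) (c : Finset ℕ → ℕ)
    {C : Finset ℕ} (hC : C ∈ s) :
    x C * ∏ D ∈ s, rising (x D + if C = D then 1 else 0) (c D) =
      (x C + c C) * ∏ D ∈ s, rising (x D) (c D) := by
  rw [← Finset.mul_prod_erase s _ hC, ← Finset.mul_prod_erase s (fun D => rising (x D) (c D)) hC,
    if_pos rfl, ← mul_assoc, mul_rising_add_one, ← mul_assoc, mul_comm (rising _ _)]
  congr 1
  refine Finset.prod_congr rfl fun D hD => ?_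
  rw [if_neg (Finset.ne_of_mem_erase hD).symm, add_zero]

/-- `growthPoly` is an eigenfunction of the growth rules. -/
theorem IsFragTree.growthSum_growthPoly (h : IsFragTree B t) (hK : K ⊆ B) (hγ : γ ≠ 0) {j : ℕ}
    (hj : j ∉ B) (c : Finset ℕ → ℕ) (m : ℕ) :
    growthSum α γ t j (growthPoly α γ K c m (insert j B)) =
      (B.card - α + (m + γ * ∑ C ∈ reducedShape t K, (c C : ℝ))) *
        growthPoly α γ K c m B t := by
  classical
  set x : Finset ℕ → ℝ := fun C => edgeVar α γ K C t with hx
  set Y := groupVar α γ K B t with hY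
  set s := γ * ∑ C ∈ reducedShape t K, (c C : ℝ) with hs
  set Q := ∏ C ∈ reducedShape t K, rising (x C) (c C) with hQ
  set QC : Finset ℕ → ℝ := fun C => ∏ D ∈ reducedShape t K,
    rising (x D + if C = D then 1 else 0) (c D) with hQC
  set R0 := rising (Y + s) m with hR0
  set R1 := rising (Y + s + 1) m with hR1
  have hv : ∀ v ∈ branchPoints t, vertexWeight α γ t v *
      growthPoly α γ K c m (insert j B) (AlphaGamma.insertAtVertex t v j) =
      vertexWeight α γ t v * (Q * R0) +
        if OnEdge t K v then vertexWeight α γ t v * (Q * R1 - Q * R0) else 0 := by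
    intro v hv
    rw [h.growthPoly_insertAtVertex hK hj hv]
    split_ifs
    · ring
    · rw [add_zero, add_zero]
  -- Three contributions: the unchanged value `Q * R0`, the increment when `Y` rises by one, and the
  -- further increment when the inserted edge lies in the spanned subtree and lengthens an edge of
  -- the reduced tree.
  have he : ∀ A ∈ t, edgeWeight α γ A *
      growthPoly α γ K c m (insert j B) (AlphaGamma.insertAtEdge t A j) =
      edgeWeight α γ A * (Q * R0) +
        (if (A ∩ K).Nonempty ∨ OnEdge t K A then edgeWeight α γ A * (Q * R1 - Q * R0) else 0) +
        if (A ∩ K).Nonempty then edgeWeight α γ A * ((QC (A ∩ K) - Q) * R1) else 0 := by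
    intro A hA
    rw [h.growthPoly_insertAtEdge hK hj hA]
    by_cases hAK : (A ∩ K).Nonempty
    · simp only [hAK, true_or, if_true, hQC, hR1, hx]
      ring
    · have : (∏ C ∈ reducedShape t K,
          rising (edgeVar α γ K C t + if A ∩ K = C then 1 else 0) (c C)) = Q := by
        refine Finset.prod_congr rfl fun C hC => ?_
        rw [if_neg, add_zero]
        rintro rfl
        exact hAK (h.nonempty_of_mem_reducedShape hK hC)
      rw [this]
      simp only [hAK, false_or, if_false]
      split_ifs
      · ring
      · rw [add_zero, add_zero, add_zero]
  -- The edges of trace `C` have total weight `γ x_C`, and `x_C (QC C - Q) = c_C Q`. Summed over `C`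
  -- this gives `γ ∑ c_C = s` times `Q * R1`.
  have hskel : ∑ A ∈ t, (if (A ∩ K).Nonempty then
      edgeWeight α γ A * ((QC (A ∩ K) - Q) * R1) else 0) = s * Q * R1 := by
    rw [← Finset.sum_filter]
    change ∑ A ∈ skeleton t K, _ = _
    rw [← Finset.sum_fiberwise_of_maps_to (t := reducedShape t K) (g := fun A => A ∩ K)
      (fun A hA => h.trace_mem_reducedShape hK (mem_skeleton.1 hA).1 (mem_skeleton.1 hA).2),
      hs, Finset.mul_sum, Finset.sum_mul, Finset.sum_mul]
    refine Finset.sum_congr rfl fun C hC => ?_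
    have h1 : ∑ A ∈ (skeleton t K).filter (fun A => A ∩ K = C),
        edgeWeight α γ A * ((QC (A ∩ K) - Q) * R1) =
        (∑ A ∈ t.filter (fun A => A ∩ K = C), edgeWeight α γ A) * ((QC C - Q) * R1) := by
      rw [Finset.sum_mul, skeleton, Finset.filter_filter]
      have h2 : t.filter (fun A => (A ∩ K).Nonempty ∧ A ∩ K = C) =
          t.filter (fun A => A ∩ K = C) := by
        refine Finset.filter_congr fun A _ => ⟨fun h => h.2, ?_⟩
        rintro rfl
        exact ⟨h.nonempty_of_mem_reducedShape hK hC, rfl⟩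
      rw [h2]
      refine Finset.sum_congr rfl fun A hA => ?_
      rw [(Finset.mem_filter.1 hA).2]
    rw [h1, h.sum_edgeWeight_trace hK hC, ← mul_edgeParam hγ, ← mul_add]
    have h3 := mul_prod_rising (reducedShape t K) x c hC
    change x C * QC C = _ at h3
    change γ * x C * _ = _
    linear_combination γ * R1 * h3
  have hg := h.sum_weight_onEdge (α := α) (γ := γ) hK
  have ht := h.totalWeight_eq (α := α) (γ := γ)
  rw [totalWeight] at ht
  change _ = Y at hg
  -- The shift of `Y` by `s` makes everything close up: `Y (R1 - R0) + s R1 = (Y + s) R1 - Y R0 = (s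
  -- + m) R0`.
  have hrise : (Y + s) * R1 = R0 * (Y + s + m) := mul_rising_add_one _ _
  rw [growthSum, Finset.sum_congr rfl he, Finset.sum_congr rfl hv, Finset.sum_add_distrib,
    Finset.sum_add_distrib, Finset.sum_add_distrib, hskel, ← Finset.sum_filter,
    ← Finset.sum_filter, ← Finset.sum_mul, ← Finset.sum_mul, ← Finset.sum_mul, ← Finset.sum_mul,
    growthPoly]
  change _ = _ * (Q * R0)
  linear_combination (Q * R0) * ht + (Q * R1 - Q * R0) * hg + Q * hrise

end Functionals

/-! ### One step of the growth rules as a transition kernel -/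

section Step

variable {B : Finset ℕ} {t : Finset (Finset ℕ)} {α γ : ℝ}

theorem sum_mul_growthProb (s : Finset (Finset (Finset ℕ))) {j : ℕ}
    (hE : ∀ A ∈ t, insertAtEdge t A j ∈ s) (hV : ∀ v ∈ branchPoints t, insertAtVertex t v j ∈ s)
    (f : Finset (Finset ℕ) → ℝ) :
    ∑ t' ∈ s, growthProb α γ t j t' * f t' = growthSum α γ t j f / totalWeight α γ t := by
  simp only [growthProb, div_mul_eq_mul_div]
  rw [← Finset.sum_div, growthSum]
  congr 1
  simp only [add_mul, Finset.sum_mul, ite_mul, zero_mul]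
  rw [Finset.sum_add_distrib, Finset.sum_comm, Finset.sum_comm (s := s)]
  congr 1
  · refine Finset.sum_congr rfl fun A hA => ?_
    rw [Finset.sum_ite_eq, if_pos (hE A hA)]
  · refine Finset.sum_congr rfl fun v hv => ?_
    rw [Finset.sum_ite_eq, if_pos (hV v hv)]

theorem IsFragTree.mem_powerset (h : IsFragTree B t) : t ∈ B.powerset.powerset := by
  rw [Finset.mem_powerset]
  exact fun A hA => Finset.mem_powerset.2 (h.subset A hA)

theorem IsFragTree.totalWeight_pos (h : IsFragTree B t) (hB : B.Nonempty) (hα1 : α < 1) :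
    0 < totalWeight α γ t := by
  have : (1 : ℝ) ≤ B.card := by exact_mod_cast hB.card_pos
  rw [h.totalWeight_eq]
  linarith

theorem IsFragTree.growthProb_nonneg (h : IsFragTree B t) (hB : B.Nonempty) (hα0 : 0 < α)
    (hα1 : α < 1) (hγ0 : 0 < γ) (hγα : γ ≤ α) (j : ℕ) (t' : Finset (Finset ℕ)) :
    0 ≤ growthProb α γ t j t' := by
  refine div_nonneg (add_nonneg (Finset.sum_nonneg fun A _ => ?_)
    (Finset.sum_nonneg fun v hv => ?_)) (h.totalWeight_pos hB hα1).le
  · split_ifs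
    exacts [(edgeWeight_pos hα1 hγ0 A).le, le_rfl]
  · split_ifs
    exacts [h.vertexWeight_nonneg hα0.le hγα hv, le_rfl]

theorem IsFragTree.sum_mul_growthProb (h : IsFragTree B t) {j : ℕ} (hj : j ∉ B)
    (f : Finset (Finset ℕ) → ℝ) :
    ∑ t' ∈ (insert j B).powerset.powerset, growthProb α γ t j t' * f t' =
      growthSum α γ t j f / totalWeight α γ t :=
  AlphaGamma.sum_mul_growthProb _ (fun _ hA => (h.insertAtEdge hj hA).mem_powerset)
    (fun _ hv => (h.insertAtVertex hj hv).mem_powerset) f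

end Step
end AlphaGamma

namespace AlphaGamma

/-! ### The tree process, its conditioning and its martingales -/

section TreeProcess

variable {Ω : Type*} [MeasurableSpace Ω] {α γ : ℝ} {k : ℕ} {P : Measure Ω}
  {T : ℕ → Ω → Finset (Finset ℕ)}

theorem insert_Icc_one (n : ℕ) : insert (n + 1) (Finset.Icc 1 n) = Finset.Icc 1 (n + 1) := by
  ext i
  simp only [Finset.mem_insert, Finset.mem_Icc]
  omega

theorem add_one_notMem_Icc (n : ℕ) : n + 1 ∉ Finset.Icc 1 n := by simp

/-- The event that the first `n` trees of the sequence `T` are those of the sequence `t`. -/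
def history (T : ℕ → Ω → Finset (Finset ℕ)) (n : ℕ) (t : ℕ → Finset (Finset ℕ)) : Set Ω :=
  {ω | ∀ i ∈ Finset.Icc 1 n, T i ω = t i}

/-- The sequence of trees `T` follows the alpha-gamma growth rules from time `k` on. -/
structure IsGrowthFrom (α γ : ℝ) (k : ℕ) (P : Measure Ω) (T : ℕ → Ω → Finset (Finset ℕ)) :
    Prop where
  tree : ∀ n, 1 ≤ n → ∀ ω, IsFragTree (Finset.Icc 1 n) (T n ω)
  measurable : ∀ n, 1 ≤ n → ∀ t, MeasurableSet (T n ⁻¹' {t})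
  growth : ∀ n, k ≤ n → ∀ t : ℕ → Finset (Finset ℕ),
    P (history T (n + 1) t) =
      P (history T n t) * ENNReal.ofReal (growthProb α γ (t n) (n + 1) (t (n + 1)))

theorem IsFragTree.eq_of_Icc_one {t : Finset (Finset ℕ)} (h : IsFragTree (Finset.Icc 1 1) t) :
    t = {{1}} := by
  ext A
  rw [Finset.mem_singleton]
  refine ⟨fun hA => ?_, ?_⟩
  · have h1 := h.subset A hA
    rw [Finset.Icc_self] at h1
    exact (Finset.subset_singleton_iff.1 h1).resolve_left (h.nonempty A hA).ne_empty
  · rintro rfl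
    exact h.ancestor_mem

theorem IsFragTree.eq_of_Icc_two {t : Finset (Finset ℕ)} (h : IsFragTree (Finset.Icc 1 2) t) :
    t = {{1}, {2}, {1, 2}} := by
  have key : ∀ A ∈ (Finset.Icc 1 2).powerset, A = ∅ ∨ A = {1} ∨ A = {2} ∨ A = {1, 2} := by decide
  ext A
  simp only [Finset.mem_insert, Finset.mem_singleton]
  refine ⟨fun hA => ?_, ?_⟩
  · exact (key A (Finset.mem_powerset.2 (h.subset A hA))).resolve_left (h.nonempty A hA).ne_empty
  · rintro (rfl | rfl | rfl)
    · exact h.leaf_mem 1 (by simp)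
    · exact h.leaf_mem 2 (by simp)
    · exact h.ancestor_mem

theorem isFragTree_one : IsFragTree (Finset.Icc 1 1) {{1}} where
  nonempty := by simp
  subset := by simp
  ancestor_mem := by simp
  leaf_mem := by simp
  laminar := by simp

theorem growthProb_one (hα1 : α < 1) (t' : Finset (Finset ℕ)) :
    growthProb α γ {{1}} 2 t' = if t' = {{1}, {2}, {1, 2}} then 1 else 0 := by
  have h1 := isFragTree_one.insertAtEdge (j := 2) (c := {1}) (by simp) (by simp)
  have h2 : insertAtEdge {{1}} {1} 2 = {{1}, {2}, {1, 2}} := by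
    refine IsFragTree.eq_of_Icc_two ?_
    rwa [insert_Icc_one] at h1
  have hb : branchPoints ({{1}} : Finset (Finset ℕ)) = ∅ := by decide
  have hα : (1 : ℝ) - α ≠ 0 := by linarith
  rw [growthProb, totalWeight, hb, Finset.sum_singleton, h2]
  simp only [Finset.sum_empty, add_zero, Finset.sum_singleton, edgeWeight, Finset.card_singleton,
    if_true]
  by_cases h : t' = {{1}, {2}, {1, 2}}
  · rw [if_pos h, if_pos h.symm, div_self hα]
  · rw [if_neg h, if_neg (Ne.symm h), zero_div]

/-- `T 1` and `T 2` are deterministic, and the only weighted object of `T 1` is its single edge, so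
the growth rule also holds at `n = 1`. -/
theorem IsAlphaGammaSequence.isGrowthFrom_one (hα1 : α < 1) (hT : IsAlphaGammaSequence α γ P T) :
    IsGrowthFrom α γ 1 P T where
  tree := hT.tree
  measurable := hT.measurable
  growth n hn t := by
    rcases hn.eq_or_lt with rfl | hn
    · have e1 : ∀ ω, T 1 ω = {{1}} := fun ω => (hT.tree 1 le_rfl ω).eq_of_Icc_one
      have e2 : ∀ ω, T 2 ω = {{1}, {2}, {1, 2}} := fun ω => (hT.tree 2 (by norm_num) ω).eq_of_Icc_two
      have h1 : history T 1 t = {ω | {{1}} = t 1} := by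
        ext ω
        simp [history, e1]
      have h2 : history T (1 + 1) t = {ω | {{1}} = t 1 ∧ {{1}, {2}, {1, 2}} = t 2} := by
        ext ω
        simp only [history, Set.mem_ofPred_eq]
        rw [← insert_Icc_one, Finset.Icc_self]
        simp only [Finset.mem_insert, Finset.mem_singleton, forall_eq_or_imp, forall_eq]
        rw [e1, show (1 + 1) = 2 from rfl, e2]
        exact and_comm
      rw [h1, h2]
      by_cases ht : {{1}} = t 1
      · rw [← ht, growthProb_one hα1]
        by_cases ht2 : t 2 = {{1}, {2}, {1, 2}}
        · simp [ht2]
        · simp [ht2, Ne.symm ht2]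
      · simp [ht]
    · exact hT.growth n hn t

/-- The event `T k = t₀` is decided by every history of length at least `k`, so conditioning on it
keeps or discards histories whole and leaves the transition probabilities alone. -/
theorem IsAlphaGammaSequence.isGrowthFrom_cond (hα1 : α < 1) (hT : IsAlphaGammaSequence α γ P T)
    (hk : 1 ≤ k) (t₀ : Finset (Finset ℕ)) : IsGrowthFrom α γ k P[|T k ⁻¹' {t₀}] T where
  tree := hT.tree
  measurable := hT.measurable
  growth n hn t := by
    have h1 := (hT.isGrowthFrom_one hα1).growth n (hk.trans hn) t
    have key : ∀ n, k ≤ n → T k ⁻¹' {t₀} ∩ history T n t =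
        if t k = t₀ then history T n t else ∅ := by
      intro n hn
      have hkn : k ∈ Finset.Icc 1 n := Finset.mem_Icc.2 ⟨hk, hn⟩
      split_ifs with h
      · refine Set.inter_eq_right.2 fun ω hω => ?_
        rw [Set.mem_preimage, Set.mem_singleton_iff, hω k hkn, h]
      · refine Set.eq_empty_of_forall_notMem fun ω hω => h ?_
        rw [← hω.2 k hkn]
        exact hω.1
    rw [cond_apply (hT.measurable k hk t₀), cond_apply (hT.measurable k hk t₀), key n hn,
      key (n + 1) (by omega)]
    split_ifs
    · rw [h1, mul_assoc]
    · simp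

namespace IsGrowthFrom

variable (hT : IsGrowthFrom α γ k P T)
include hT

theorem measurable_comp {β : Type*} [MeasurableSpace β] (f : Finset (Finset ℕ) → β) {n : ℕ}
    (hn : 1 ≤ n) : Measurable fun ω => f (T n ω) := by
  let _ : MeasurableSpace (Finset (Finset ℕ)) := ⊤
  exact measurable_from_top.comp (measurable_to_countable' (hT.measurable n hn))

theorem measurableSet_history (n : ℕ) (t : ℕ → Finset (Finset ℕ)) :
    MeasurableSet (history T n t) := by
  have : history T n t = ⋂ i ∈ Finset.Icc 1 n, T i ⁻¹' {t i} := by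
    ext ω
    simp [history]
  rw [this]
  exact Finset.measurableSet_biInter _ fun i hi => hT.measurable i (Finset.mem_Icc.1 hi).1 _

/-- `T n` takes only finitely many values, so any function of it is bounded and integrability is
automatic. -/
theorem abs_comp_le (f : Finset (Finset ℕ) → ℝ) {n : ℕ} (hn : 1 ≤ n) (ω : Ω) :
    |f (T n ω)| ≤ ∑ t ∈ (Finset.Icc 1 n).powerset.powerset, |f t| :=
  Finset.single_le_sum (f := fun t => |f t|) (fun _ _ => abs_nonneg _)
    (hT.tree n hn ω).mem_powerset

theorem integrable_comp [IsFiniteMeasure P] (f : Finset (Finset ℕ) → ℝ) {n : ℕ} (hn : 1 ≤ n) :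
    Integrable (fun ω => f (T n ω)) P :=
  .of_bound (hT.measurable_comp f hn).aestronglyMeasurable _
    (.of_forall fun ω => (Real.norm_eq_abs _).trans_le (hT.abs_comp_le f hn ω))

theorem setIntegral_history [IsFiniteMeasure P] (hα0 : 0 < α) (hα1 : α < 1) (hγ0 : 0 < γ)
    (hγα : γ ≤ α) {n : ℕ} (hn : 1 ≤ n) (hkn : k ≤ n) {t : ℕ → Finset (Finset ℕ)}
    (ht : IsFragTree (Finset.Icc 1 n) (t n)) (f : Finset (Finset ℕ) → ℝ) :
    ∫ ω in history T n t, f (T (n + 1) ω) ∂P =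
      P.real (history T n t) * (growthSum α γ (t n) (n + 1) f / totalWeight α γ (t n)) := by
  rw [← ht.sum_mul_growthProb (add_one_notMem_Icc n)]
  generalize hS : (insert (n + 1) (Finset.Icc 1 n)).powerset.powerset = S
  have h1 : ∀ ω, f (T (n + 1) ω) = ∑ t' ∈ S, (T (n + 1) ⁻¹' {t'}).indicator (fun _ => f t') ω := by
    intro ω
    have hmem : T (n + 1) ω ∈ S := by
      rw [← hS, insert_Icc_one]
      exact (hT.tree (n + 1) (by omega) ω).mem_powerset
    refine ((Finset.sum_eq_single_of_mem _ hmem fun t' _ h => ?_).trans ?_).symm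
    · exact Set.indicator_of_notMem (fun h' => h (Eq.symm h')) _
    · exact Set.indicator_of_mem (s := T (n + 1) ⁻¹' {T (n + 1) ω}) (Set.mem_singleton _) _
  rw [funext h1]
  have hmeas := fun t' => hT.measurable (n + 1) (by omega) t'
  rw [integral_finsetSum _ fun t' _ => (integrable_const _).indicator (hmeas t'),
    Finset.mul_sum]
  refine Finset.sum_congr rfl fun t' _ => ?_
  rw [setIntegral_indicator (hmeas t'), setIntegral_const, smul_eq_mul, ← mul_assoc]
  congr 1
  have h2 : history T n t ∩ T (n + 1) ⁻¹' {t'} =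
      history T (n + 1) (Function.update t (n + 1) t') := by
    ext ω
    simp only [history, ← insert_Icc_one, Finset.forall_mem_insert, Set.mem_inter_iff,
      Set.mem_ofPred_eq, Set.mem_preimage, Set.mem_singleton_iff, Function.update_self]
    rw [and_comm]
    refine and_congr_right fun _ => forall₂_congr fun i hi => ?_
    rw [Function.update_of_ne]
    rintro rfl
    exact add_one_notMem_Icc n hi
  have h3 : history T n (Function.update t (n + 1) t') = history T n t := by
    ext ω
    refine forall₂_congr fun i hi => ?_
    rw [Function.update_of_ne]
    rintro rfl
    exact add_one_notMem_Icc n hi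
  rw [h2, measureReal_def, hT.growth n hkn, h3, Function.update_self,
    Function.update_of_ne (by omega), ENNReal.toReal_mul, ENNReal.toReal_ofReal, measureReal_def]
  exact ht.growthProb_nonneg (Finset.nonempty_Icc.2 hn) hα0 hα1 hγ0 hγα _ _

/-- The filtration generated by the trees. -/
def filtration : Filtration ℕ ‹MeasurableSpace Ω› where
  seq m := MeasurableSpace.comap (fun ω (i : Finset.Icc 1 (k + m)) => T i ω) ⊤
  mono' := by
    intro m m' hm
    have h : (fun ω (i : Finset.Icc 1 (k + m)) => T i ω) =
        (fun (x : Finset.Icc 1 (k + m') → Finset (Finset ℕ)) (i : Finset.Icc 1 (k + m)) =>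
          x ⟨i, Finset.Icc_subset_Icc_right (by omega) i.2⟩) ∘
          fun ω (i : Finset.Icc 1 (k + m')) => T i ω := rfl
    change MeasurableSpace.comap (fun ω (i : Finset.Icc 1 (k + m)) => T i ω) ⊤ ≤ _
    rw [h, ← MeasurableSpace.comap_comp]
    exact MeasurableSpace.comap_mono le_top
  le' m := by
    rintro _ ⟨S, -, rfl⟩
    rw [← Set.biUnion_preimage_singleton]
    refine MeasurableSet.biUnion (Set.to_countable _) fun x _ => ?_
    have : (fun ω (i : Finset.Icc 1 (k + m)) => T i ω) ⁻¹' {x} =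
        ⋂ i : Finset.Icc 1 (k + m), T i ⁻¹' {x i} := by
      ext ω
      simp [funext_iff]
    rw [this]
    exact MeasurableSet.iInter fun i => hT.measurable i (Finset.mem_Icc.1 i.2).1 _

/-- The filtration is generated by countably many histories, so the martingale property needs
checking only on each of them, where it is the one-step identity `hf`. -/
theorem martingale_comp [IsFiniteMeasure P] (hα0 : 0 < α) (hα1 : α < 1) (hγ0 : 0 < γ)
    (hγα : γ ≤ α) (hk : 1 ≤ k) {f : ℕ → Finset (Finset ℕ) → ℝ}
    (hf : ∀ n, k ≤ n → ∀ t, IsFragTree (Finset.Icc 1 n) t →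
      growthSum α γ t (n + 1) (f (n + 1)) = totalWeight α γ t * f n t) :
    Martingale (fun m ω => f (k + m) (T (k + m) ω)) hT.filtration P := by
  refine martingale_of_setIntegral_eq_succ (fun m => ?_)
    (fun m => hT.integrable_comp (f (k + m)) (by omega)) fun m s hs => ?_
  · refine Measurable.stronglyMeasurable fun U _ => ?_
    exact ⟨{x | f (k + m) (x ⟨k + m, Finset.mem_Icc.2 ⟨by omega, le_rfl⟩⟩) ∈ U}, trivial, rfl⟩
  · obtain ⟨S, -, rfl⟩ := hs
    have hkm : k + m ∈ Finset.Icc 1 (k + m) := Finset.mem_Icc.2 ⟨by omega, le_rfl⟩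
    set e : (Finset.Icc 1 (k + m) → Finset (Finset ℕ)) → ℕ → Finset (Finset ℕ) :=
      fun x i => if h : i ∈ Finset.Icc 1 (k + m) then x ⟨i, h⟩ else ∅ with he
    have hx : ∀ x, (fun ω (i : Finset.Icc 1 (k + m)) => T i ω) ⁻¹' {x} =
        history T (k + m) (e x) := by
      intro x
      ext ω
      simp only [Set.mem_preimage, Set.mem_singleton_iff, funext_iff, Subtype.forall, history,
        Set.mem_ofPred_eq]
      refine forall₂_congr fun i hi => ?_
      rw [he]
      simp only [dif_pos hi]
    have hU : (fun ω (i : Finset.Icc 1 (k + m)) => T i ω) ⁻¹' S =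
        ⋃ x : S, history T (k + m) (e x) := by
      rw [← Set.biUnion_preimage_singleton, Set.biUnion_eq_iUnion]
      exact Set.iUnion_congr fun x => hx x
    have hd : Pairwise (Function.onFun Disjoint fun x : S => history T (k + m) (e x)) := by
      intro x y hxy
      rw [Function.onFun, ← hx, ← hx]
      exact Disjoint.preimage _ (Set.disjoint_singleton.2 (Subtype.coe_injective.ne hxy))
    rw [hU, integral_iUnion (fun x => hT.measurableSet_history _ _) hd
      (hT.integrable_comp _ (by omega)).integrableOn,
      integral_iUnion (fun x => hT.measurableSet_history _ _) hd
      (hT.integrable_comp _ (by omega)).integrableOn]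
    refine tsum_congr fun x => ?_
    -- A history that contains no outcome may involve families that are not trees; a nonempty one
    -- ends in an actual value of `T (k + m)`.
    rcases (history T (k + m) (e x)).eq_empty_or_nonempty with h0 | ⟨ω₀, hω₀⟩
    · rw [h0]
      simp
    · have ht : IsFragTree (Finset.Icc 1 (k + m)) (e x (k + m)) := by
        rw [← hω₀ _ hkm]
        exact hT.tree _ (by omega) _
      have h1 := hT.setIntegral_history hα0 hα1 hγ0 hγα (by omega) (by omega) ht (f (k + m + 1))
      rw [← add_assoc, h1, hf _ (by omega) _ ht, mul_div_cancel_left₀ _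
        (ht.totalWeight_pos (Finset.nonempty_Icc.2 (by omega)) hα1).ne',
        setIntegral_congr_fun (hT.measurableSet_history _ _)
          (g := fun _ => f (k + m) (e x (k + m))), setIntegral_const, smul_eq_mul]
      intro ω hω
      simp only [hω _ hkm]

theorem integral_comp_eq [IsFiniteMeasure P] (hα0 : 0 < α) (hα1 : α < 1) (hγ0 : 0 < γ)
    (hγα : γ ≤ α) (hk : 1 ≤ k) {f : ℕ → Finset (Finset ℕ) → ℝ}
    (hf : ∀ n, k ≤ n → ∀ t, IsFragTree (Finset.Icc 1 n) t →
      growthSum α γ t (n + 1) (f (n + 1)) = totalWeight α γ t * f n t) {n : ℕ} (hn : k ≤ n) :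
    ∫ ω, f n (T n ω) ∂P = ∫ ω, f k (T k ω) ∂P := by
  obtain ⟨m, rfl⟩ := Nat.exists_eq_add_of_le hn
  have := (hT.martingale_comp hα0 hα1 hγ0 hγα hk hf).setIntegral_eq (Nat.zero_le m) MeasurableSet.univ
  simpa using this.symm

end IsGrowthFrom

end TreeProcess
end AlphaGamma

namespace AlphaGamma

/-! ### Normalised eigenfunctions and their scaling limits -/

section Eigenfunctions

variable {t : Finset (Finset ℕ)} {α γ : ℝ} {k n : ℕ}

theorem IsFragTree.reducedShape_self {B : Finset ℕ} (h : IsFragTree B t) :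
    reducedShape t B = t := by
  rw [h.reducedShape_eq subset_rfl,
    Finset.image_congr (f := fun A => A ∩ B) (g := id)
      fun A hA => Finset.inter_eq_left.2 (h.subset A hA), Finset.image_id, Finset.erase_eq_of_notMem fun h0 => (h.nonempty ∅ h0).ne_empty rfl]

theorem IsFragTree.edgeVar_self {B : Finset ℕ} (h : IsFragTree B t) {C : Finset ℕ} (hC : C ∈ t) :
    edgeVar α γ B C t = edgeParam α γ C := by
  have h1 : t.filter (fun E => E ∩ B = C) = {C} := by
    ext E
    rw [Finset.mem_filter, Finset.mem_singleton]
    refine ⟨fun hE => ?_, ?_⟩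
    · rw [← hE.2, Finset.inter_eq_left.2 (h.subset E hE.1)]
    · rintro rfl
      exact ⟨hC, Finset.inter_eq_left.2 (h.subset E hC)⟩
  rw [edgeVar, h.reducedLength_eq subset_rfl (h.nonempty C hC), h1]
  simp

theorem IsFragTree.groupVar_self {B : Finset ℕ} (h : IsFragTree B t) :
    groupVar α γ B B t = ∑ C ∈ t, edgeWeight α γ C := by
  rw [groupVar, h.reducedShape_self, edgeLeafCount, Finset.sdiff_self]
  simp

theorem growthSum_eq_mul_const {j : ℕ} {f g : Finset (Finset ℕ) → ℝ} {b : ℝ}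
    (hE : ∀ A ∈ t, f (insertAtEdge t A j) = g (insertAtEdge t A j) * b)
    (hV : ∀ v ∈ branchPoints t, f (insertAtVertex t v j) = g (insertAtVertex t v j) * b) :
    growthSum α γ t j f = growthSum α γ t j g * b := by
  rw [growthSum, growthSum, add_mul, Finset.sum_mul, Finset.sum_mul]
  congr 1
  · exact Finset.sum_congr rfl fun A hA => by rw [hE A hA, mul_assoc]
  · exact Finset.sum_congr rfl fun v hv => by rw [hV v hv, mul_assoc]

theorem growthSum_const (j : ℕ) (b : ℝ) :
    growthSum α γ t j (fun _ => b) = totalWeight α γ t * b := by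
  rw [growthSum, totalWeight, add_mul, Finset.sum_mul, Finset.sum_mul]

/-- A function of shapes of reduced trees is invariant under the growth rules. -/
theorem IsFragTree.growthSum_shape (hkn : k ≤ n) (h : IsFragTree (Finset.Icc 1 n) t)
    (f : Finset (Finset ℕ) → ℝ) :
    growthSum α γ t (n + 1) (fun t' => f (reducedShape t' (Finset.Icc 1 k))) =
      totalWeight α γ t * f (reducedShape t (Finset.Icc 1 k)) := by
  have hK : Finset.Icc 1 k ⊆ Finset.Icc 1 n := Finset.Icc_subset_Icc_right hkn
  rw [growthSum_eq_mul_const (g := fun _ => 1) (b := f (reducedShape t (Finset.Icc 1 k))),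
    growthSum_const, mul_one]
  · intro A hA
    rw [h.reducedShape_insertAtEdge hK (add_one_notMem_Icc n) hA, one_mul]
  · intro v hv
    rw [h.reducedShape_insertAtVertex hK (add_one_notMem_Icc n) hv, one_mul]

/-- The multiple of `growthPoly` that the growth rules leave invariant, restricted to the trees
with reduced tree of shape `t₀`. -/
noncomputable def eigenfun (α γ : ℝ) (k : ℕ) (t₀ : Finset (Finset ℕ)) (c : Finset ℕ → ℕ) (m n : ℕ)
    (t : Finset (Finset ℕ)) : ℝ :=
  if reducedShape t (Finset.Icc 1 k) = t₀ then
    growthPoly α γ (Finset.Icc 1 k) c m (Finset.Icc 1 n) t *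
      (Real.Gamma (n - α) / Real.Gamma (n - α + (m + γ * ∑ C ∈ t₀, (c C : ℝ))))
  else 0

/-- The value of `eigenfun` at the tree `t₀`. -/
noncomputable def eigenval (α γ : ℝ) (k : ℕ) (t₀ : Finset (Finset ℕ)) (c : Finset ℕ → ℕ) (m : ℕ) :
    ℝ :=
  (∏ C ∈ t₀, rising (edgeParam α γ C) (c C)) *
    rising (∑ C ∈ t₀, edgeWeight α γ C + γ * ∑ C ∈ t₀, (c C : ℝ)) m *
    (Real.Gamma (k - α) / Real.Gamma (k - α + (m + γ * ∑ C ∈ t₀, (c C : ℝ))))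

/-- With `s = m + γ ∑ c_C` the polynomial is multiplied on average by `(n - α + s) / (n - α)`, and
this is exactly the factor that the Gamma ratio loses from `n` to `n + 1`. The shape restriction is
harmless because insertions preserve the shape. -/
theorem IsFragTree.growthSum_eigenfun (hα1 : α < 1) (hγ : 0 < γ) (hn : 1 ≤ n) (hkn : k ≤ n)
    (h : IsFragTree (Finset.Icc 1 n) t) (t₀ : Finset (Finset ℕ)) (c : Finset ℕ → ℕ) (m : ℕ) :
    growthSum α γ t (n + 1) (eigenfun α γ k t₀ c m (n + 1)) =
      totalWeight α γ t * eigenfun α γ k t₀ c m n t := by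
  have hK : Finset.Icc 1 k ⊆ Finset.Icc 1 n := Finset.Icc_subset_Icc_right hkn
  have hj := add_one_notMem_Icc n
  have hE := fun A hA => h.reducedShape_insertAtEdge (c := A) hK hj hA
  have hV := fun v hv => h.reducedShape_insertAtVertex (v := v) hK hj hv
  by_cases hs : reducedShape t (Finset.Icc 1 k) = t₀
  · rw [growthSum_eq_mul_const (g := growthPoly α γ (Finset.Icc 1 k) c m (Finset.Icc 1 (n + 1)))
      (b := Real.Gamma ((n + 1 : ℕ) - α) /
        Real.Gamma ((n + 1 : ℕ) - α + (m + γ * ∑ C ∈ t₀, (c C : ℝ)))),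
      ← insert_Icc_one, h.growthSum_growthPoly hK hγ.ne' hj, eigenfun, if_pos hs, hs,
      h.totalWeight_eq, Nat.card_Icc, Nat.add_sub_cancel]
    · have h1 : (1 : ℝ) ≤ n := by exact_mod_cast hn
      have h2 : 0 < (n : ℝ) - α := by linarith
      have h3 : 0 < (n : ℝ) - α + (m + γ * ∑ C ∈ t₀, (c C : ℝ)) := by positivity
      have h4 : ((n + 1 : ℕ) : ℝ) - α = (n - α) + 1 := by push_cast; ring
      have h5 : (n : ℝ) - α + 1 + (m + γ * ∑ C ∈ t₀, (c C : ℝ)) =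
          n - α + (m + γ * ∑ C ∈ t₀, (c C : ℝ)) + 1 := by ring
      rw [h4, h5, Real.Gamma_add_one h2.ne', Real.Gamma_add_one h3.ne']
      have h6 := (Real.Gamma_pos_of_pos h3).ne'
      field_simp
    · intro A hA
      rw [eigenfun, if_pos ((hE A hA).trans hs)]
    · intro v hv
      rw [eigenfun, if_pos ((hV v hv).trans hs)]
  · rw [growthSum_eq_mul_const (g := fun _ => 0) (b := 0), eigenfun, if_neg hs, mul_zero, mul_zero]
    · intro A hA
      rw [eigenfun, if_neg fun h' => hs ((hE A hA).symm.trans h'), mul_zero]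
    · intro v hv
      rw [eigenfun, if_neg fun h' => hs ((hV v hv).symm.trans h'), mul_zero]

theorem IsFragTree.eigenfun_self (h : IsFragTree (Finset.Icc 1 k) t) (c : Finset ℕ → ℕ) (m : ℕ) :
    eigenfun α γ k t c m k t = eigenval α γ k t c m := by
  rw [eigenfun, eigenval, if_pos h.reducedShape_self, growthPoly, h.reducedShape_self,
    h.groupVar_self, Finset.prod_congr rfl fun C hC => by rw [h.edgeVar_self hC]]

theorem IsFragTree.growthPoly_nonneg {B K : Finset ℕ} (h : IsFragTree B t) (hK : K ⊆ B)
    (hα1 : α < 1) (hγ : 0 < γ) (c : Finset ℕ → ℕ) (m : ℕ) : 0 ≤ growthPoly α γ K c m B t :=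
  mul_nonneg (Finset.prod_nonneg fun _ hC => rising_nonneg (h.edgeVar_pos hK hα1 hγ hC).le _)
    (rising_nonneg (add_nonneg (groupVar_nonneg hα1 hγ) (by positivity)) _)

theorem IsFragTree.eigenfun_nonneg (h : IsFragTree (Finset.Icc 1 n) t) (hα1 : α < 1) (hγ : 0 < γ)
    (hn : 1 ≤ n) (hkn : k ≤ n) (t₀ : Finset (Finset ℕ)) (c : Finset ℕ → ℕ) (m : ℕ) :
    0 ≤ eigenfun α γ k t₀ c m n t := by
  rw [eigenfun]
  split_ifs
  · have h1 : (1 : ℝ) ≤ n := by exact_mod_cast hn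
    have h2 : 0 < (n : ℝ) - α := by linarith
    exact mul_nonneg (h.growthPoly_nonneg (Finset.Icc_subset_Icc_right hkn) hα1 hγ c m)
      (div_nonneg (Real.Gamma_pos_of_pos h2).le (Real.Gamma_pos_of_pos (by positivity)).le)
  · exact le_rfl

theorem IsFragTree.growthPoly_sq_le {B K : Finset ℕ} (h : IsFragTree B t) (hK : K ⊆ B)
    (hα1 : α < 1) (hγ : 0 < γ) (c : Finset ℕ → ℕ) (m : ℕ) :
    growthPoly α γ K c m B t ^ 2 ≤ growthPoly α γ K (fun C => 2 * c C) (2 * m) B t := by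
  have hg : 0 ≤ groupVar α γ K B t := groupVar_nonneg hα1 hγ
  rw [growthPoly, growthPoly, mul_pow, ← Finset.prod_pow]
  refine mul_le_mul (Finset.prod_le_prod (fun C _ => sq_nonneg _) fun C hC =>
    rising_sq_le (h.edgeVar_pos hK hα1 hγ hC).le le_rfl _) (rising_sq_le (by positivity) ?_ _)
    (sq_nonneg _) (Finset.prod_nonneg fun C hC => rising_nonneg (h.edgeVar_pos hK hα1 hγ hC).le _)
  gcongr with C
  linarith [(Nat.cast_nonneg (c C) : (0 : ℝ) ≤ c C)]

theorem rpow_neg_add_mul_sum {x : ℝ} (hx : 0 < x) (s : Finset (Finset ℕ)) (c : Finset ℕ → ℕ)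
    (m : ℕ) : x ^ (-(m + γ * ∑ C ∈ s, (c C : ℝ))) = (∏ C ∈ s, (x ^ (-γ)) ^ c C) * x⁻¹ ^ m := by
  rw [Finset.prod_pow_eq_pow_sum, ← Real.rpow_natCast, ← Real.rpow_mul hx.le, neg_add,
    Real.rpow_add hx, Real.rpow_neg hx.le, Real.rpow_natCast, inv_pow, mul_comm]
  push_cast
  rw [neg_mul]

/-- The value of `growthPoly` rescaled by a power of `n`. -/
noncomputable def scaledPoly (α γ : ℝ) (k : ℕ) (t₀ : Finset (Finset ℕ)) (c : Finset ℕ → ℕ)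
    (m n : ℕ) (t : Finset (Finset ℕ)) : ℝ :=
  (n : ℝ) ^ (-(m + γ * ∑ C ∈ t₀, (c C : ℝ))) *
    growthPoly α γ (Finset.Icc 1 k) c m (Finset.Icc 1 n) t

theorem scaledPoly_eq (hn : 0 < n) (c : Finset ℕ → ℕ) (m : ℕ) :
    scaledPoly α γ k (reducedShape t (Finset.Icc 1 k)) c m n t =
      (∏ C ∈ reducedShape t (Finset.Icc 1 k),
        ((n : ℝ) ^ (-γ)) ^ c C * rising (edgeVar α γ (Finset.Icc 1 k) C t) (c C)) *
      ((n : ℝ)⁻¹ ^ m * rising (groupVar α γ (Finset.Icc 1 k) (Finset.Icc 1 n) t +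
        γ * ∑ C ∈ reducedShape t (Finset.Icc 1 k), (c C : ℝ)) m) := by
  have hn' : (0 : ℝ) < n := by positivity
  rw [scaledPoly, rpow_neg_add_mul_sum hn', growthPoly, Finset.prod_mul_distrib]
  ring

/-- Each of the `c` factors is `a n * x n + a n * i`, and the shifts `a n * i` vanish in the limit.
-/
theorem tendsto_pow_mul_rising {x a : ℕ → ℝ} {y : ℝ} (ha : Tendsto a atTop (𝓝 0))
    (h : Tendsto (fun n => a n * x n) atTop (𝓝 y)) (c : ℕ) :
    Tendsto (fun n => a n ^ c * rising (x n) c) atTop (𝓝 (y ^ c)) := by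
  have h1 : ∀ n, a n ^ c * rising (x n) c = ∏ i ∈ Finset.range c, (a n * x n + a n * i) := by
    intro n
    simp only [rising, ← mul_add, Finset.prod_mul_distrib, Finset.prod_const, Finset.card_range]
  simp only [h1]
  have h2 : Tendsto (fun n => ∏ i ∈ Finset.range c, (a n * x n + a n * i)) atTop
      (𝓝 (∏ _i ∈ Finset.range c, y)) := by
    refine tendsto_finsetProd _ fun i _ => ?_
    simpa using h.add (ha.mul_const (i : ℝ))
  simpa using h2

theorem tendsto_natCast_rpow_neg (hγ : 0 < γ) : Tendsto (fun n : ℕ => (n : ℝ) ^ (-γ)) atTop (𝓝 0) :=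
  (tendsto_rpow_neg_atTop hγ).comp tendsto_natCast_atTop_atTop

/-- The ratio between `n ^ (-s) * growthPoly` and `eigenfun` tends to one. -/
theorem tendsto_rpow_neg_mul_Gamma_ratio (α : ℝ) {s : ℝ} (hs : 0 ≤ s) :
    Tendsto (fun n : ℕ => (n : ℝ) ^ (-s) * (Real.Gamma (n - α + s) / Real.Gamma (n - α)))
      atTop (𝓝 1) := by
  have h1 : Tendsto (fun n : ℕ => (n : ℝ) - α) atTop atTop :=
    tendsto_atTop_add_const_right _ _ tendsto_natCast_atTop_atTop
  have h2 : Tendsto (fun n : ℕ => ((n : ℝ) - α) / n) atTop (𝓝 1) := by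
    have : Tendsto (fun n : ℕ => 1 - α / (n : ℝ)) atTop (𝓝 (1 - 0)) :=
      tendsto_const_nhds.sub (tendsto_const_nhds.div_atTop tendsto_natCast_atTop_atTop)
    rw [sub_zero] at this
    refine this.congr' ?_
    filter_upwards [eventually_gt_atTop 0] with n hn
    have : (n : ℝ) ≠ 0 := by positivity
    field_simp
  have h3 := ((tendsto_Gamma_ratio hs).comp h1).mul (h2.rpow_const (p := s) (by simp))
  rw [Real.one_rpow, mul_one] at h3
  refine h3.congr' ?_
  filter_upwards [eventually_gt_atTop 0, h1.eventually_gt_atTop 0] with n hn hn2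
  have hn' : (0 : ℝ) < n := by positivity
  have h4 := Real.rpow_pos_of_pos hn2 s
  have h5 := Real.rpow_pos_of_pos hn' s
  have h6 := Real.Gamma_pos_of_pos hn2
  rw [Function.comp_apply, Real.div_rpow hn2.le hn'.le, Real.rpow_neg hn'.le]
  field_simp

/-- The power of `n` splits into `n ^ (-γ)` for each factor belonging to an edge and `n⁻¹` for each
factor belonging to the mass. All constant shifts disappear, so the eigenfunctions turn into
monomials of the limits. -/
theorem tendsto_scaledPoly (hγ : 0 < γ) (hk : 1 ≤ k) {T : ℕ → Finset (Finset ℕ)}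
    {t₀ : Finset (Finset ℕ)} (hs : ∀ n, k ≤ n → reducedShape (T n) (Finset.Icc 1 k) = t₀) {η : Finset ℕ → ℝ} {w : ℝ}
    (hη : ∀ C ∈ t₀, Tendsto
      (fun n : ℕ => (n : ℝ) ^ (-γ) * reducedLength (T n) (Finset.Icc 1 k) C) atTop (𝓝 (η C)))
    (hw : Tendsto
      (fun n : ℕ => (n : ℝ)⁻¹ * edgeLeafCount (T n) (Finset.Icc 1 n) (Finset.Icc 1 k))
      atTop (𝓝 w)) (c : Finset ℕ → ℕ) (m : ℕ) :
    Tendsto (fun n => scaledPoly α γ k t₀ c m n (T n)) atTop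
      (𝓝 ((∏ C ∈ t₀, η C ^ c C) * w ^ m)) := by
  have ha := tendsto_natCast_rpow_neg hγ
  have hb : Tendsto (fun n : ℕ => (n : ℝ)⁻¹) atTop (𝓝 0) :=
    tendsto_inv_atTop_zero.comp tendsto_natCast_atTop_atTop
  have h1 : ∀ C ∈ t₀, Tendsto (fun n : ℕ => ((n : ℝ) ^ (-γ)) ^ c C *
      rising (edgeVar α γ (Finset.Icc 1 k) C (T n)) (c C)) atTop (𝓝 (η C ^ c C)) := by
    intro C hC
    refine tendsto_pow_mul_rising ha ?_ _
    have := (hη C hC).add (ha.mul_const (edgeParam α γ C - 1))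
    rw [zero_mul, add_zero] at this
    refine this.congr fun n => ?_
    rw [edgeVar]
    ring
  set b := ∑ C ∈ t₀, edgeWeight α γ C + γ * ∑ C ∈ t₀, (c C : ℝ) with hbdef
  have h2 : Tendsto (fun n : ℕ => (n : ℝ)⁻¹ ^ m * rising
      (edgeLeafCount (T n) (Finset.Icc 1 n) (Finset.Icc 1 k) + b) m) atTop (𝓝 (w ^ m)) := by
    refine tendsto_pow_mul_rising hb ?_ _
    have := hw.add (hb.mul_const b)
    rw [zero_mul, add_zero] at this
    refine this.congr fun n => ?_
    ring
  refine ((tendsto_finsetProd _ h1).mul h2).congr' ?_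
  filter_upwards [eventually_ge_atTop k] with n hn
  have h3 := scaledPoly_eq (α := α) (γ := γ) (k := k) (t := T n) (show 0 < n by omega) c m
  rw [hs n hn] at h3
  rw [h3, groupVar, hs n hn, hbdef]
  congr 3
  ring

end Eigenfunctions

/-! ### Almost sure limits and their joint moments, given `T k = t₀` -/

namespace IsGrowthFrom

variable {Ω : Type*} [MeasurableSpace Ω] {α γ : ℝ} {k : ℕ} {P : Measure Ω}
  {T : ℕ → Ω → Finset (Finset ℕ)} {t₀ : Finset (Finset ℕ)}

variable [IsProbabilityMeasure P] (hT : IsGrowthFrom α γ k P T) (hα0 : 0 < α) (hα1 : α < 1)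
  (hγ0 : 0 < γ) (hγα : γ ≤ α) (hk : 1 ≤ k) (h0 : ∀ᵐ ω ∂P, T k ω = t₀)

include hT hα0 hα1 hγ0 hγα hk h0

/-- The indicator that the shape differs from `t₀` is invariant under the growth rules and vanishes
at time `k`, so its mean is `0` at all later times. -/
theorem ae_reducedShape : ∀ᵐ ω ∂P, ∀ n, k ≤ n → reducedShape (T n ω) (Finset.Icc 1 k) = t₀ := by
  rw [ae_all_iff]
  intro n
  rw [ae_all_iff]
  intro hn
  set u : Finset (Finset ℕ) → ℝ := fun s => if s = t₀ then 0 else 1 with hu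
  have h1 := hT.integral_comp_eq hα0 hα1 hγ0 hγα hk
    (f := fun _ t => u (reducedShape t (Finset.Icc 1 k)))
    (fun n hn t ht => ht.growthSum_shape hn u) hn
  have h2 : ∫ ω, u (reducedShape (T k ω) (Finset.Icc 1 k)) ∂P = 0 := by
    refine integral_eq_zero_of_ae ?_
    filter_upwards [h0] with ω hω
    rw [(hT.tree k hk ω).reducedShape_self, hω, hu]
    simp
  rw [h2, integral_eq_zero_iff_of_nonneg _
    (hT.integrable_comp (fun t => u (reducedShape t (Finset.Icc 1 k))) (hk.trans hn))] at h1
  · filter_upwards [h1] with ω hω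
    by_contra hne
    simp [hu, hne] at hω
  · intro ω
    simp only [hu, Pi.zero_apply]
    split_ifs <;> simp

theorem integral_eigenfun (c : Finset ℕ → ℕ) (m : ℕ) {n : ℕ} (hn : k ≤ n) :
    ∫ ω, eigenfun α γ k t₀ c m n (T n ω) ∂P = eigenval α γ k t₀ c m := by
  rw [hT.integral_comp_eq hα0 hα1 hγ0 hγα hk
    (fun n hn t ht => ht.growthSum_eigenfun hα1 hγ0 (hk.trans hn) hn t₀ c m) hn]
  have h1 : ∀ᵐ ω ∂P, eigenfun α γ k t₀ c m k (T k ω) = eigenval α γ k t₀ c m := by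
    filter_upwards [h0] with ω hω
    have := hT.tree k hk ω
    rw [hω] at this ⊢
    exact this.eigenfun_self c m
  rw [integral_congr_ae h1]
  simp

theorem ae_scaledPoly_eq : ∀ᵐ ω ∂P, ∀ c m n, k ≤ n → scaledPoly α γ k t₀ c m n (T n ω) =
    eigenfun α γ k t₀ c m n (T n ω) * ((n : ℝ) ^ (-(m + γ * ∑ C ∈ t₀, (c C : ℝ))) *
      (Real.Gamma (n - α + (m + γ * ∑ C ∈ t₀, (c C : ℝ))) / Real.Gamma (n - α))) := by
  filter_upwards [hT.ae_reducedShape hα0 hα1 hγ0 hγα hk h0] with ω hω c m n hn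
  have h1 : (1 : ℝ) ≤ n := by exact_mod_cast hk.trans hn
  have h2 : 0 < (n : ℝ) - α := by linarith
  have h3 : 0 < (n : ℝ) - α + (m + γ * ∑ C ∈ t₀, (c C : ℝ)) := by positivity
  have h4 := (Real.Gamma_pos_of_pos h2).ne'
  have h5 := (Real.Gamma_pos_of_pos h3).ne'
  rw [eigenfun, if_pos (hω n hn), scaledPoly]
  field_simp

/-- `eigenfun` gives a nonnegative martingale with constant mean `eigenval`, hence one bounded in
`L¹`, and `scaledPoly` differs from it by a deterministic factor tending to `1`. -/
theorem ae_exists_tendsto_scaledPoly (c : Finset ℕ → ℕ) (m : ℕ) : ∀ᵐ ω ∂P, ∃ x,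
    Tendsto (fun n => scaledPoly α γ k t₀ c m n (T n ω)) atTop (𝓝 x) := by
  have hmart := hT.martingale_comp hα0 hα1 hγ0 hγα hk
    (fun n hn t ht => ht.growthSum_eigenfun hα1 hγ0 (hk.trans hn) hn t₀ c m)
  have hbdd : ∀ i, eLpNorm (fun ω => eigenfun α γ k t₀ c m (k + i) (T (k + i) ω)) 1 P ≤
      (eigenval α γ k t₀ c m).toNNReal := by
    intro i
    have hnn := fun ω => (hT.tree (k + i) (by omega) ω).eigenfun_nonneg hα1 hγ0 (by omega)
      (Nat.le_add_right k i) t₀ c m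
    rw [eLpNorm_one_eq_lintegral_enorm, ← ENNReal.ofReal,
      ← hT.integral_eigenfun hα0 hα1 hγ0 hγα hk h0 c m (Nat.le_add_right k i),
      ofReal_integral_eq_lintegral_ofReal (hT.integrable_comp _ (by omega)) (.of_forall hnn)]
    refine (lintegral_congr fun ω => ?_).le
    rw [Real.enorm_eq_ofReal (hnn ω)]
  filter_upwards [hmart.submartingale.exists_ae_tendsto_of_bdd hbdd,
    hT.ae_scaledPoly_eq hα0 hα1 hγ0 hγα hk h0] with ω ⟨x, hx⟩ hω
  refine ⟨x * 1, ?_⟩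
  have h1 : Tendsto (fun n => eigenfun α γ k t₀ c m n (T n ω)) atTop (𝓝 x) := by
    rw [← tendsto_add_atTop_iff_nat k]
    simpa only [add_comm] using hx
  have hs : 0 ≤ (m + γ * ∑ C ∈ t₀, (c C : ℝ)) := by positivity
  refine (h1.mul (tendsto_rpow_neg_mul_Gamma_ratio α hs)).congr' ?_
  filter_upwards [eventually_ge_atTop k] with n hn
  exact (hω c m n hn).symm

/-- Apply the convergence to the polynomial linear in the length of `C` alone, with `c = Pi.single C
1` and `m = 0`. The mass is handled in the same way by `c = 0` and `m = 1`. -/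
theorem ae_exists_tendsto_reducedLength : ∀ᵐ ω ∂P, ∀ C ∈ t₀, ∃ x,
    Tendsto (fun n : ℕ => (n : ℝ) ^ (-γ) * reducedLength (T n ω) (Finset.Icc 1 k) C)
      atTop (𝓝 x) := by
  have h1 : ∀ᵐ ω ∂P, ∀ C : Finset ℕ, ∃ x,
      Tendsto (fun n => scaledPoly α γ k t₀ (Pi.single C 1) 0 n (T n ω)) atTop (𝓝 x) :=
    ae_all_iff.2 fun C =>
      hT.ae_exists_tendsto_scaledPoly hα0 hα1 hγ0 hγα hk h0 (Pi.single C 1) 0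
  filter_upwards [h1, hT.ae_reducedShape hα0 hα1 hγ0 hγα hk h0] with ω hω hs C hC
  obtain ⟨x, hx⟩ := hω C
  refine ⟨x - 0 * (edgeParam α γ C - 1),
    (hx.sub ((tendsto_natCast_rpow_neg hγ0).mul_const _)).congr' ?_⟩
  filter_upwards [eventually_ge_atTop k] with n hn
  rw [← hs n hn, scaledPoly_eq (by omega), hs n hn, Finset.prod_eq_single_of_mem C hC, edgeVar]
  · simp
    ring
  · intro D _ hD
    simp [Pi.single_eq_of_ne hD]

theorem ae_exists_tendsto_edgeLeafCount : ∀ᵐ ω ∂P, ∃ x,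
    Tendsto (fun n : ℕ => (n : ℝ)⁻¹ * edgeLeafCount (T n ω) (Finset.Icc 1 n) (Finset.Icc 1 k))
      atTop (𝓝 x) := by
  filter_upwards [hT.ae_exists_tendsto_scaledPoly hα0 hα1 hγ0 hγα hk h0 0 1,
    hT.ae_reducedShape hα0 hα1 hγ0 hγα hk h0] with ω ⟨x, hx⟩ hs
  refine ⟨x - 0 * ∑ C ∈ t₀, edgeWeight α γ C,
    (hx.sub ((tendsto_inv_atTop_zero.comp tendsto_natCast_atTop_atTop).mul_const _)).congr' ?_⟩
  filter_upwards [eventually_ge_atTop k] with n hn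
  rw [← hs n hn, scaledPoly_eq (by omega), groupVar, hs n hn]
  simp
  ring

theorem integral_scaledPoly (c : Finset ℕ → ℕ) (m : ℕ) {n : ℕ} (hn : k ≤ n) :
    ∫ ω, scaledPoly α γ k t₀ c m n (T n ω) ∂P = eigenval α γ k t₀ c m *
      ((n : ℝ) ^ (-(m + γ * ∑ C ∈ t₀, (c C : ℝ))) *
        (Real.Gamma (n - α + (m + γ * ∑ C ∈ t₀, (c C : ℝ))) / Real.Gamma (n - α))) := by
  rw [← hT.integral_eigenfun hα0 hα1 hγ0 hγα hk h0 c m hn, ← integral_mul_const]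
  refine integral_congr_ae ?_
  filter_upwards [hT.ae_scaledPoly_eq hα0 hα1 hγ0 hγα hk h0] with ω hω using hω c m n hn

omit [IsProbabilityMeasure P] hα0 hγα h0 in
theorem scaledPoly_nonneg (c : Finset ℕ → ℕ) (m : ℕ) {n : ℕ} (hn : k ≤ n) (ω : Ω) :
    0 ≤ scaledPoly α γ k t₀ c m n (T n ω) :=
  mul_nonneg (by positivity) ((hT.tree n (hk.trans hn) ω).growthPoly_nonneg
    (Finset.Icc_subset_Icc_right hn) hα1 hγ0 c m)

omit hα0 hγα h0 in
theorem lintegral_scaledPoly (c : Finset ℕ → ℕ) (m : ℕ) {n : ℕ} (hn : k ≤ n) :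
    ∫⁻ ω, ENNReal.ofReal (scaledPoly α γ k t₀ c m n (T n ω)) ∂P =
      ENNReal.ofReal (∫ ω, scaledPoly α γ k t₀ c m n (T n ω) ∂P) :=
  (ofReal_integral_eq_lintegral_ofReal (hT.integrable_comp _ (hk.trans hn))
    (.of_forall (hT.scaledPoly_nonneg hα1 hγ0 hk c m hn))).symm

omit [IsProbabilityMeasure P] hα0 hγα h0 in
theorem scaledPoly_sq_le (c : Finset ℕ → ℕ) (m : ℕ) {n : ℕ} (hn : k ≤ n) (ω : Ω) :
    scaledPoly α γ k t₀ c m n (T n ω) ^ 2 ≤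
      scaledPoly α γ k t₀ (fun C => 2 * c C) (2 * m) n (T n ω) := by
  have hn0 : (0 : ℝ) ≤ n := Nat.cast_nonneg n
  rw [scaledPoly, scaledPoly, mul_pow, ← Real.rpow_mul_natCast hn0]
  have h1 : -(m + γ * ∑ C ∈ t₀, (c C : ℝ)) * (2 : ℕ) =
      -((2 * m : ℕ) + γ * ∑ C ∈ t₀, ((2 * c C : ℕ) : ℝ)) := by
    push_cast
    rw [← Finset.mul_sum]
    ring
  rw [h1]
  exact mul_le_mul_of_nonneg_left ((hT.tree n (hk.trans hn) ω).growthPoly_sq_le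
    (Finset.Icc_subset_Icc_right hn) hα1 hγ0 c m) (by positivity)

/-- The joint moments of the limits. -/
theorem lintegral_limit {η : Finset ℕ → Ω → ℝ} {w : Ω → ℝ}
    (hη : ∀ C ∈ t₀, AEMeasurable (η C) P) (hw : AEMeasurable w P)
    (hηlim : ∀ᵐ ω ∂P, ∀ C ∈ t₀, Tendsto
      (fun n : ℕ => (n : ℝ) ^ (-γ) * reducedLength (T n ω) (Finset.Icc 1 k) C)
      atTop (𝓝 (η C ω)))
    (hwlim : ∀ᵐ ω ∂P, Tendsto
      (fun n : ℕ => (n : ℝ)⁻¹ * edgeLeafCount (T n ω) (Finset.Icc 1 n) (Finset.Icc 1 k))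
      atTop (𝓝 (w ω))) (c : Finset ℕ → ℕ) (m : ℕ) :
    ∫⁻ ω, ENNReal.ofReal ((∏ C ∈ t₀, η C ω ^ c C) * w ω ^ m) ∂P =
      ENNReal.ofReal (eigenval α γ k t₀ c m) := by
  have hkadd : Tendsto (fun i => k + i) atTop atTop := tendsto_atTop_mono (fun i => Nat.le_add_left i k) tendsto_id
  have hmeas : ∀ i, AEMeasurable (fun ω => scaledPoly α γ k t₀ c m (k + i) (T (k + i) ω)) P :=
    fun i => (hT.measurable_comp _ (by omega)).aemeasurable
  have hnn := fun i ω => hT.scaledPoly_nonneg (t₀ := t₀) hα1 hγ0 hk c m (Nat.le_add_right k i) ω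
  have hlim : ∀ᵐ ω ∂P, Tendsto (fun i => scaledPoly α γ k t₀ c m (k + i) (T (k + i) ω)) atTop
      (𝓝 ((∏ C ∈ t₀, η C ω ^ c C) * w ω ^ m)) := by
    filter_upwards [hηlim, hwlim, hT.ae_reducedShape hα0 hα1 hγ0 hγα hk h0] with ω h1 h2 hs
    exact (tendsto_scaledPoly hγ0 hk hs (η := fun C => η C ω) h1 h2 c m).comp hkadd
  have hratio : ∀ (c : Finset ℕ → ℕ) (m : ℕ),
      Tendsto (fun i => ∫ ω, scaledPoly α γ k t₀ c m (k + i) (T (k + i) ω) ∂P) atTop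
        (𝓝 (eigenval α γ k t₀ c m)) := by
    intro c m
    have hs : 0 ≤ (m + γ * ∑ C ∈ t₀, (c C : ℝ)) := by positivity
    have h1 := ((tendsto_rpow_neg_mul_Gamma_ratio α hs).comp hkadd).const_mul
      (eigenval α γ k t₀ c m)
    rw [mul_one] at h1
    refine h1.congr fun i => ?_
    rw [hT.integral_scaledPoly hα0 hα1 hγ0 hγα hk h0 c m (Nat.le_add_right k i)]
    rfl
  have hmeas0 : AEMeasurable (fun ω => (∏ C ∈ t₀, η C ω ^ c C) * w ω ^ m) P :=
    (Finset.aemeasurable_fun_prod _ fun C hC => (hη C hC).pow_const _).mul (hw.pow_const _)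
  -- Truncated means converge by dominated convergence. The second moments are bounded because the
  -- square is at most the polynomial with doubled exponents, whose means converge.
  refine lintegral_eq_of_tendsto_trunc (l := atTop) (μ := fun _ : ℕ => P) hmeas
    (fun i => .of_forall (hnn i)) hmeas0 ?_ (fun R => ?_)
    (C := eigenval α γ k t₀ (fun C => 2 * c C) (2 * m) + 1) ?_ ?_
  · filter_upwards [hlim] with ω hω
    exact ge_of_tendsto' hω fun i => hnn i ω
  · refine tendsto_integral_of_dominated_convergence (fun _ => (R : ℝ))
      (fun i => ((hmeas i).min aemeasurable_const).aestronglyMeasurable) (integrable_const _)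
      (fun i => .of_forall fun ω => ?_) ?_
    · rw [Real.norm_eq_abs, abs_of_nonneg (le_min (hnn i ω) (Nat.cast_nonneg R))]
      exact min_le_right _ _
    · filter_upwards [hlim] with ω hω using hω.min tendsto_const_nhds
  · refine (ENNReal.tendsto_ofReal (hratio c m)).congr fun i => ?_
    rw [hT.lintegral_scaledPoly hα1 hγ0 hk c m (Nat.le_add_right k i)]
  · filter_upwards [(hratio (fun C => 2 * c C) (2 * m)).eventually_le_const (lt_add_one _)]
      with i hi
    refine le_trans (lintegral_mono fun ω => ENNReal.ofReal_le_ofReal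
      (hT.scaledPoly_sq_le hα1 hγ0 hk c m (Nat.le_add_right k i) ω)) ?_
    rw [hT.lintegral_scaledPoly hα1 hγ0 hk _ _ (Nat.le_add_right k i)]
    exact ENNReal.ofReal_le_ofReal hi

end IsGrowthFrom
end AlphaGamma

namespace AlphaGamma

/-! ### Gromov–Hausdorff distance of trees of the same shape -/

section GromovHausdorff

variable {t : Finset (Finset ℕ)} {η η' : Finset ℕ → ℝ}

theorem rootedGHDist_nonneg {X Y : Type} [MetricSpace X] [MetricSpace Y] (x₀ : X) (y₀ : Y) :
    0 ≤ rootedGHDist x₀ y₀ := by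
  refine Real.sInf_nonneg ?_
  rintro r ⟨E, _, f, g, -, -, -, rfl⟩
  exact Metric.hausdorffDist_nonneg

/-- The inclusions into the common ambient space compete in the infimum. Both trees lie in `ℓ¹` with
root `0`, so no gluing is needed. -/
theorem rootedGHDist_le_hausdorffDist {E : Type} [MetricSpace E] {s u : Set E} (x₀ : s) (y₀ : u)
    (h : (x₀ : E) = y₀) : rootedGHDist x₀ y₀ ≤ Metric.hausdorffDist s u := by
  refine csInf_le ⟨0, ?_⟩ ⟨E, inferInstance, Subtype.val, Subtype.val, isometry_subtype_coe,
    isometry_subtype_coe, h, by rw [Subtype.range_coe, Subtype.range_coe]⟩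
  rintro r ⟨E, _, f, g, -, -, -, rfl⟩
  exact Metric.hausdorffDist_nonneg

/-- Points on the same edge differ only in the coordinates of that edge and of those between it and
the root, each by at most the difference of the edge lengths. -/
theorem dist_edgePoint_le {A : Finset ℕ} (hA : A ∈ t) {s s' : ℝ} (hs : |s - s'| ≤ |η A - η' A|) :
    dist (edgePoint t η A s) (edgePoint t η' A s') ≤ ∑ C ∈ t, |η C - η' C| := by
  have h1 : edgePoint t η A s - edgePoint t η' A s' =
      ∑ C ∈ t.filter (fun C => A ⊂ C), lp.single 1 C (η C - η' C) + lp.single 1 A (s - s') := by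
    simp only [edgePoint, lp.single_sub, Finset.sum_sub_distrib]
    abel
  have hn : ∀ (C : Finset ℕ) (x : ℝ),
      ‖(lp.single 1 C x : lp (fun _ : Finset ℕ => ℝ) 1)‖ = |x| := fun C x => by
    rw [lp.norm_single one_pos, Real.norm_eq_abs]
  rw [dist_eq_norm, h1]
  refine (norm_add_le _ _).trans ?_
  rw [hn]
  refine (add_le_add ((norm_sum_le _ _).trans_eq (Finset.sum_congr rfl fun C _ => hn C _)) hs).trans
    ?_
  have hA' : A ∉ t.filter (fun C => A ⊂ C) := by simp
  rw [add_comm, ← Finset.sum_insert (f := fun C => |η C - η' C|) hA']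
  exact Finset.sum_le_sum_of_subset_of_nonneg
    (Finset.insert_subset hA (Finset.filter_subset _ _)) fun _ _ _ => abs_nonneg _

theorem exists_mem_realTree_dist_le (hη' : ∀ A ∈ t, 0 ≤ η' A) {x : EllOne}
    (hx : x ∈ realTree t η) : ∃ y ∈ realTree t η', dist x y ≤ ∑ C ∈ t, |η C - η' C| := by
  rcases hx with rfl | ⟨A, hA, s, hs, rfl⟩
  · refine ⟨0, Set.mem_insert _ _, ?_⟩
    rw [dist_self]
    exact Finset.sum_nonneg fun _ _ => abs_nonneg _
  -- The partner point sits at the same height on the same edge, cut off at the other length of that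
  -- edge.
  · refine ⟨_, Or.inr ⟨A, hA, min s (η' A), ⟨le_min hs.1 (hη' A hA), min_le_right _ _⟩, rfl⟩,
      dist_edgePoint_le hA ?_⟩
    rcases le_total s (η' A) with h | h
    · rw [min_eq_left h, sub_self, abs_zero]
      exact abs_nonneg _
    · rw [min_eq_right h, abs_of_nonneg (by linarith)]
      exact le_trans (by linarith [hs.2]) (le_abs_self _)

theorem rootedGHDist_treeRoot_le (hη : ∀ A ∈ t, 0 ≤ η A) (hη' : ∀ A ∈ t, 0 ≤ η' A) :
    rootedGHDist (treeRoot t η) (treeRoot t η') ≤ ∑ C ∈ t, |η C - η' C| := by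
  refine (rootedGHDist_le_hausdorffDist (treeRoot t η) (treeRoot t η') rfl).trans
    (Metric.hausdorffDist_le_of_mem_dist (Finset.sum_nonneg fun _ _ => abs_nonneg _)
      (fun x hx => exists_mem_realTree_dist_le hη' hx) fun x hx => ?_)
  simp only [abs_sub_comm (η _)]
  exact exists_mem_realTree_dist_le hη hx

/-- Trees of the same shape converge if their edge lengths do. -/
theorem tendsto_rootedGHDist_treeRoot {ι : Type*} {l : Filter ι} {s : ι → Finset (Finset ℕ)}
    (hs : ∀ᶠ i in l, s i = t) {η : ι → Finset ℕ → ℝ} (hη : ∀ i, ∀ A ∈ t, 0 ≤ η i A)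
    (hη' : ∀ A ∈ t, 0 ≤ η' A) (h : ∀ A ∈ t, Tendsto (fun i => η i A) l (𝓝 (η' A))) :
    Tendsto (fun i => rootedGHDist (treeRoot (s i) (η i)) (treeRoot t η')) l (𝓝 0) := by
  have h1 : Tendsto (fun i => ∑ C ∈ t, |η i C - η' C|) l (𝓝 (∑ C ∈ t, 0)) := by
    refine tendsto_finsetSum _ fun C hC => ?_
    simpa using ((h C hC).sub_const (η' C)).abs
  rw [Finset.sum_const_zero] at h1
  refine tendsto_of_tendsto_of_tendsto_of_le_of_le' tendsto_const_nhds h1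
    (.of_forall fun i => rootedGHDist_nonneg _ _) ?_
  filter_upwards [hs] with i hi
  rw [hi]
  exact rootedGHDist_treeRoot_le (hη i) hη'

end GromovHausdorff
end AlphaGamma

namespace AlphaGamma

/-! ### The joint law of mass and edge lengths -/

section JointLaw

variable {ι : Type*} [Fintype ι] {α γ k ℓ a b : ℝ} {p : ι → ℝ} {i₀ : ι} {g : ℝ → ℝ}

/-- The mass `w` and the edge lengths `l * w ^ γ * d i`. -/
noncomputable def massAndLengths (γ : ℝ) (z : ℝ × ℝ × (ι → ℝ)) : Option ι → ℝ :=
  fun o => o.elim z.1 fun i => z.2.1 * z.1 ^ γ * z.2.2 i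

/-- Recovers the mass, the total length and the proportions from `massAndLengths`. -/
noncomputable def massLengthProportions (γ : ℝ) (x : Option ι → ℝ) : ℝ × ℝ × (ι → ℝ) :=
  (x none, (∑ i, x (some i)) / x none ^ γ, fun i => x (some i) / ∑ j, x (some j))

omit [Fintype ι] in
theorem measurable_massAndLengths : Measurable (massAndLengths (ι := ι) γ) := by
  refine measurable_pi_iff.2 fun o => ?_
  cases o with
  | none => exact measurable_fst
  | some i =>
    change Measurable fun z : ℝ × ℝ × (ι → ℝ) => z.2.1 * z.1 ^ γ * z.2.2 i
    fun_prop

theorem measurable_massLengthProportions : Measurable (massLengthProportions (ι := ι) γ) := by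
  unfold massLengthProportions
  fun_prop

theorem sum_massAndLengths {z : ℝ × ℝ × (ι → ℝ)} (hz : ∑ i, z.2.2 i = 1) :
    ∑ i, massAndLengths γ z (some i) = z.2.1 * z.1 ^ γ := by
  change ∑ i, z.2.1 * z.1 ^ γ * z.2.2 i = _
  rw [← Finset.mul_sum, hz, mul_one]

theorem massLengthProportions_massAndLengths {z : ℝ × ℝ × (ι → ℝ)} (h1 : 0 < z.1)
    (h2 : 0 < z.2.1) (hz : ∑ i, z.2.2 i = 1) :
    massLengthProportions γ (massAndLengths γ z) = z := by
  have h3 : 0 < z.1 ^ γ := Real.rpow_pos_of_pos h1 _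
  rw [massLengthProportions, sum_massAndLengths hz]
  refine Prod.ext rfl (Prod.ext ?_ (funext fun i => ?_))
  · change z.2.1 * z.1 ^ γ / z.1 ^ γ = z.2.1
    field_simp
  · change z.2.1 * z.1 ^ γ * z.2.2 i / (z.2.1 * z.1 ^ γ) = z.2.2 i
    field_simp

/-- The joint law of independent variables with beta, tilted Mittag-Leffler and Dirichlet
distributions. -/
noncomputable def jointLaw (α γ k ℓ a b : ℝ) (g : ℝ → ℝ) (p : ι → ℝ) (i₀ : ι) :
    Measure (ℝ × ℝ × (ι → ℝ)) :=
  (betaLaw a b).prod ((lengthLaw α γ k ℓ g).prod (dirichletLaw p i₀))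

variable (hg : IsMittagLefflerDensity γ g) (hγ : 0 < γ) (hp : ∀ i, 0 < p i)
  (hQ : ∑ i, p i = lengthExponent α γ k ℓ) (ha : a = γ * ∑ i, p i) (hb : 0 ≤ b)

include hg hγ hp hQ ha hb

omit ha hb hγ hg hQ in
theorem sum_param_pos (i₀ : ι) : 0 < ∑ i, p i :=
  Finset.sum_pos (fun i _ => hp i) ⟨i₀, Finset.mem_univ _⟩

theorem isProbabilityMeasure_jointLaw (i₀ : ι) :
    IsProbabilityMeasure (jointLaw α γ k ℓ a b g p i₀) := by
  have hS := sum_param_pos hp i₀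
  have := isProbabilityMeasure_betaLaw (a := a) (b := b) (by rw [ha]; positivity) hb
  have := isProbabilityMeasure_lengthLaw hg hγ (hQ ▸ hS)
  have := isProbabilityMeasure_dirichletLaw (i₀ := i₀) hp
  rw [jointLaw]
  infer_instance

theorem ae_jointLaw (i₀ : ι) : ∀ᵐ z ∂(jointLaw α γ k ℓ a b g p i₀),
    (0 < z.1 ∧ z.1 ≤ 1) ∧ 0 < z.2.1 ∧ (∀ i, 0 < z.2.2 i) ∧ ∑ i, z.2.2 i = 1 := by
  have hS := sum_param_pos hp i₀
  have := isProbabilityMeasure_betaLaw (a := a) (b := b) (by rw [ha]; positivity) hb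
  have := isProbabilityMeasure_lengthLaw hg hγ (hQ ▸ hS)
  have := isProbabilityMeasure_dirichletLaw (i₀ := i₀) hp
  have h1 : ∀ᵐ z ∂((lengthLaw α γ k ℓ g).prod (dirichletLaw p i₀)),
      0 < z.1 ∧ (∀ i, 0 < z.2 i) ∧ ∑ i, z.2 i = 1 :=
    (Measure.quasiMeasurePreserving_fst.ae ae_lengthLaw).and
      (Measure.quasiMeasurePreserving_snd.ae ae_dirichletLaw)
  exact (Measure.quasiMeasurePreserving_fst.ae ae_betaLaw).and
    (Measure.quasiMeasurePreserving_snd.ae h1)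

theorem lintegral_jointLaw_mul {u v : ℝ → ℝ≥0∞} {q : (ι → ℝ) → ℝ≥0∞} (hu : Measurable u)
    (hv : Measurable v) (hq : Measurable q) (i₀ : ι) :
    ∫⁻ z, u z.1 * (v z.2.1 * q z.2.2) ∂(jointLaw α γ k ℓ a b g p i₀) =
      (∫⁻ x, u x ∂(betaLaw a b)) * ((∫⁻ x, v x ∂(lengthLaw α γ k ℓ g)) *
        ∫⁻ x, q x ∂(dirichletLaw p i₀)) := by
  have hS := sum_param_pos hp i₀
  have := isProbabilityMeasure_betaLaw (a := a) (b := b) (by rw [ha]; positivity) hb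
  have := isProbabilityMeasure_lengthLaw hg hγ (hQ ▸ hS)
  have := isProbabilityMeasure_dirichletLaw (i₀ := i₀) hp
  rw [jointLaw, lintegral_prod_mul (f := u) (g := fun y : ℝ × (ι → ℝ) => v y.1 * q y.2)
    hu.aemeasurable (by fun_prop), lintegral_prod_mul hv.aemeasurable hq.aemeasurable]

/-- The coordinates add up to `w + l w ^ γ ≤ 1 + l`, so the exponential moment of the length law
suffices. -/
theorem lintegral_exp_massAndLengths_lt_top (i₀ : ι) :
    ∫⁻ x, ENNReal.ofReal (Real.exp (1 / 2 * ∑ o, x o))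
      ∂((jointLaw α γ k ℓ a b g p i₀).map (massAndLengths γ)) < ∞ := by
  have hS := sum_param_pos hp i₀
  have := isProbabilityMeasure_betaLaw (a := a) (b := b) (by rw [ha]; positivity) hb
  have := isProbabilityMeasure_dirichletLaw (i₀ := i₀) hp
  rw [lintegral_map (by fun_prop) measurable_massAndLengths]
  have h1 := lintegral_jointLaw_mul hg hγ hp hQ ha hb
    (u := fun _ => ENNReal.ofReal (Real.exp (1 / 2)))
    (v := fun x => ENNReal.ofReal (Real.exp (1 / 2 * x))) (q := fun _ => 1)
    (by fun_prop) (by fun_prop) (by fun_prop) i₀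
  refine lt_of_le_of_lt (lintegral_mono_ae ?_) (h1.trans_lt ?_)
  · filter_upwards [ae_jointLaw hg hγ hp hQ ha hb i₀] with z ⟨⟨hz1, hz2⟩, hz3, _, hz4⟩
    rw [Fintype.sum_option, sum_massAndLengths hz4, mul_one, ← ENNReal.ofReal_mul (by positivity),
      ← Real.exp_add]
    refine ENNReal.ofReal_le_ofReal (Real.exp_le_exp.2 ?_)
    have h2 : z.2.1 * z.1 ^ γ ≤ z.2.1 * 1 :=
      mul_le_mul_of_nonneg_left (Real.rpow_le_one hz1.le hz2 hγ.le) hz3.le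
    change 1 / 2 * (z.1 + z.2.1 * z.1 ^ γ) ≤ 1 / 2 + 1 / 2 * z.2.1
    linarith
  · simp only [lintegral_const, measure_univ, mul_one]
    exact ENNReal.mul_lt_top ENNReal.ofReal_lt_top
      (lintegral_exp_lengthLaw_lt_top hg hγ (hQ ▸ hS))

/-- With `n` the total exponent of the edge lengths, a monomial factorises into `w ^ (m + γ n)`, `l
^ n` and a monomial of the proportions. By independence its mean is the product of three known
moments. -/
theorem lintegral_monomial_massAndLengths (i₀ : ι) (c : Option ι → ℕ) :
    ∫⁻ x, ENNReal.ofReal (∏ o, x o ^ c o)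
      ∂((jointLaw α γ k ℓ a b g p i₀).map (massAndLengths γ)) =
    ENNReal.ofReal ((∏ i, rising (p i) (c (some i))) *
      rising (a + γ * ∑ i, (c (some i) : ℝ)) (c none) *
      (Real.Gamma (a + b) / Real.Gamma (a + b + (c none + γ * ∑ i, (c (some i) : ℝ))))) := by
  have hS := sum_param_pos hp i₀
  have ha0 : 0 < a := by rw [ha]; positivity
  rw [lintegral_map (by fun_prop) measurable_massAndLengths]
  set n := ∑ i, c (some i) with hn
  have hn' : ∑ i, (c (some i) : ℝ) = n := by rw [hn]; push_cast; rfl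
  set m := c none with hm
  have h1 := lintegral_jointLaw_mul hg hγ hp hQ ha hb
    (u := fun x => ENNReal.ofReal (x ^ (m + γ * n)))
    (v := fun x => ENNReal.ofReal (x ^ n))
    (q := fun x => ENNReal.ofReal (∏ i, x i ^ c (some i)))
    (by fun_prop) (by fun_prop) (by fun_prop) i₀
  rw [lintegral_betaLaw_rpow ha0 hb (by positivity), lintegral_lengthLaw_pow hg hγ (hQ ▸ hS),
    lintegral_dirichletLaw hp, ← hQ, ← ha, mul_add, ← ha, Finset.sum_add_distrib, hn'] at h1
  have hGa := Real.Gamma_pos_of_pos ha0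
  have hGab := Real.Gamma_pos_of_pos (show 0 < a + b by positivity)
  have hGabn := Real.Gamma_pos_of_pos (show 0 < a + b + (m + γ * n) by positivity)
  have hGan := Real.Gamma_pos_of_pos (show 0 < a + γ * n by positivity)
  have hGanm := Real.Gamma_pos_of_pos (show 0 < a + (m + γ * n) by positivity)
  have hGS := Real.Gamma_pos_of_pos hS
  have hGSn := Real.Gamma_pos_of_pos (show 0 < ∑ i, p i + n by positivity)
  have hP1 : 0 < ∏ i, Real.Gamma (p i) := Finset.prod_pos fun i _ => Real.Gamma_pos_of_pos (hp i)
  have hP2 : 0 < ∏ i, Real.Gamma (p i + c (some i)) := Finset.prod_pos fun i _ =>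
    Real.Gamma_pos_of_pos (add_pos_of_pos_of_nonneg (hp i) (Nat.cast_nonneg _))
  have hGa1 : Real.Gamma (a + 1) = a * Real.Gamma a := Real.Gamma_add_one ha0.ne'
  have hGS1 := Real.Gamma_add_one hS.ne'
  have hGSn1 := Real.Gamma_add_one (show ∑ i, p i + (n : ℝ) ≠ 0 by positivity)
  have hGan1 := Real.Gamma_add_one (show a + γ * (n : ℝ) ≠ 0 by positivity)
  rw [hGa1, hGS1, hGSn1, hGan1, ← ENNReal.ofReal_mul (by positivity),
    ← ENNReal.ofReal_mul (by positivity)] at h1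
  refine (lintegral_congr_ae ?_).trans (h1.trans ?_)
  · filter_upwards [ae_jointLaw hg hγ hp hQ ha hb i₀] with z ⟨⟨hz1, hz2⟩, hz3, hz4, hz5⟩
    have h2 : 0 ≤ z.2.1 ^ n := by positivity
    have h3 : 0 ≤ z.1 ^ (m + γ * n) := by positivity
    rw [← ENNReal.ofReal_mul h2, ← ENNReal.ofReal_mul h3, Fintype.prod_option]
    congr 1
    change z.1 ^ m * ∏ i, (z.2.1 * z.1 ^ γ * z.2.2 i) ^ c (some i) = _
    simp only [mul_pow, Finset.prod_mul_distrib]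
    rw [Finset.prod_pow_eq_pow_sum, Finset.prod_pow_eq_pow_sum, ← hn, Real.rpow_add hz1,
      Real.rpow_natCast, Real.rpow_mul_natCast hz1.le]
    ring
  · congr 1
    rw [Finset.prod_congr rfl fun i _ => rising_eq_Gamma (hp i) (c (some i)),
      Finset.prod_div_distrib, hn', rising_eq_Gamma (by positivity),
      show a + γ * (n : ℝ) + m = a + (m + γ * n) by ring]
    have hSn : ∑ i, p i + (n : ℝ) ≠ 0 := by positivity
    have han : a + γ * (n : ℝ) ≠ 0 := by positivity
    field_simp
    -- The length moment contributes `(a / S) * ((S + n) / (a + γ n))` besides Gamma functions that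
    -- cancel with the beta and Dirichlet ones, where `S = ∑ p i`. This factor is `1` because `a = γ
    -- S`.
    rw [ha]
    ring

/-- A nonnegative random vector with the moments of `massAndLengths` has the joint law. -/
theorem map_massLengthProportions {Ω : Type*} [MeasurableSpace Ω] {P : Measure Ω}
    [IsProbabilityMeasure P] {X : Ω → Option ι → ℝ} (hX : AEMeasurable X P)
    (hX0 : ∀ᵐ ω ∂P, ∀ o, 0 ≤ X ω o) (i₀ : ι)
    (h : ∀ c : Option ι → ℕ, ∫⁻ ω, ENNReal.ofReal (∏ o, X ω o ^ c o) ∂P =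
      ENNReal.ofReal ((∏ i, rising (p i) (c (some i))) *
        rising (a + γ * ∑ i, (c (some i) : ℝ)) (c none) *
        (Real.Gamma (a + b) / Real.Gamma (a + b + (c none + γ * ∑ i, (c (some i) : ℝ)))))) :
    P.map (fun ω => massLengthProportions γ (X ω)) = jointLaw α γ k ℓ a b g p i₀ := by
  have := isProbabilityMeasure_jointLaw hg hγ hp hQ ha hb i₀
  have hΨ : Measurable (massAndLengths (ι := ι) γ) := measurable_massAndLengths
  have hmap : P.map X = (jointLaw α γ k ℓ a b g p i₀).map (massAndLengths γ) := by
    have := Measure.isProbabilityMeasure_map (μ := P) hX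
    have := Measure.isProbabilityMeasure_map (μ := jointLaw α γ k ℓ a b g p i₀) hΨ.aemeasurable
    have hms : MeasurableSet {x : Option ι → ℝ | ∀ o, 0 ≤ x o} := by
      simp only [Set.ofPred_forall]
      exact MeasurableSet.iInter fun o => measurableSet_le measurable_const (measurable_pi_apply o)
    refine ext_of_lintegral_monomial ((ae_map_iff hX hms).2 hX0)
      ((ae_map_iff hΨ.aemeasurable hms).2 ?_) (fun c => ?_) (s := 1 / 2) (by norm_num)
      (lintegral_exp_massAndLengths_lt_top hg hγ hp hQ ha hb i₀)
    · filter_upwards [ae_jointLaw hg hγ hp hQ ha hb i₀] with z ⟨⟨hz1, _⟩, hz3, hz4, _⟩ o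
      cases o with
      | none => exact hz1.le
      | some i =>
        have := hz4 i
        change 0 ≤ z.2.1 * z.1 ^ γ * z.2.2 i
        positivity
    · rw [lintegral_monomial_massAndLengths hg hγ hp hQ ha hb, lintegral_map' (Measurable.aemeasurable (by fun_prop)) hX]
      exact h c
  have hΦ : Measurable (massLengthProportions (ι := ι) γ) := measurable_massLengthProportions
  change P.map (massLengthProportions γ ∘ X) = _
  -- Once the laws of the vectors agree, apply the inverse map. It undoes `massAndLengths` almost
  -- surely, where mass and length are positive and the proportions sum to `1`.
  rw [← AEMeasurable.map_map_of_aemeasurable hΦ.aemeasurable hX, hmap, Measure.map_map hΦ hΨ]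
  refine (Measure.map_congr ?_).trans Measure.map_id
  filter_upwards [ae_jointLaw hg hγ hp hQ ha hb i₀] with z ⟨⟨hz1, _⟩, hz3, _, hz4⟩
  exact massLengthProportions_massAndLengths hz1 hz3 hz4

end JointLaw
end AlphaGamma

namespace AlphaGamma

/-! ### Identification of the limit law -/

section Limit

variable {Ω : Type*} [MeasurableSpace Ω] {α γ : ℝ} {k : ℕ} {P : Measure Ω}

/-- `X` has countably many values, and values of probability zero do not matter. This transfers
statements proved given `T k = t` back to `P`. -/
theorem ae_of_forall_cond [IsFiniteMeasure P] {ι : Type*} [Countable ι] {X : Ω → ι}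
    (hX : ∀ i, MeasurableSet (X ⁻¹' {i})) {p : Ω → Prop}
    (h : ∀ i, P (X ⁻¹' {i}) ≠ 0 → ∀ᵐ ω ∂P[|X ⁻¹' {i}], p ω) : ∀ᵐ ω ∂P, p ω := by
  have h1 : {ω | ¬ p ω} ⊆ ⋃ i, X ⁻¹' {i} ∩ {ω | ¬ p ω} := fun ω hω =>
    Set.mem_iUnion.2 ⟨X ω, rfl, hω⟩
  refine measure_mono_null h1 (measure_iUnion_null fun i => ?_)
  by_cases hi : P (X ⁻¹' {i}) = 0
  · exact measure_mono_null Set.inter_subset_left hi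
  · have h2 := h i hi
    rw [ae_iff, cond_apply (hX i), mul_eq_zero] at h2
    exact h2.resolve_left (ENNReal.inv_ne_zero.2 (measure_ne_top P _))

theorem IsFragTree.sum_edgeWeight_eq {t : Finset (Finset ℕ)} (h : IsFragTree (Finset.Icc 1 k) t)
    {ℓ : ℝ} (hℓ : (t.card : ℝ) = k + ℓ) :
    ∑ A ∈ t, edgeWeight α γ A = k * (1 - α) + ℓ * γ := by
  have h1 := Finset.card_filter_add_card_filter_not (s := t) (fun A => A.card = 1)
  rw [h.card_leaves, Nat.card_Icc, Nat.add_sub_cancel] at h1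
  rw [← h1, Nat.cast_add] at hℓ
  rw [sum_edgeWeight, h.card_leaves, Nat.card_Icc, Nat.add_sub_cancel, add_left_cancel hℓ]

/-- The second beta parameter is the total weight of the branch points of `t`. It is `0` exactly in
the degenerate case where the beta law is the point mass at `1`. -/
theorem IsFragTree.vertexWeight_sum_nonneg {t : Finset (Finset ℕ)}
    (h : IsFragTree (Finset.Icc 1 k) t) (hα : 0 ≤ α) (hγα : γ ≤ α) {ℓ : ℝ}
    (hℓ : (t.card : ℝ) = k + ℓ) : 0 ≤ (k - 1) * α - ℓ * γ := by
  have h1 := h.totalWeight_eq (α := α) (γ := γ)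
  rw [totalWeight, h.sum_edgeWeight_eq hℓ, Nat.card_Icc, Nat.add_sub_cancel] at h1
  have h2 : 0 ≤ ∑ v ∈ branchPoints t, vertexWeight α γ t v :=
    Finset.sum_nonneg fun v hv => h.vertexWeight_nonneg hα hγα hv
  linarith

theorem IsFragTree.mul_sum_edgeParam {t : Finset (Finset ℕ)} (h : IsFragTree (Finset.Icc 1 k) t)
    (hγ : γ ≠ 0) {ℓ : ℝ} (hℓ : (t.card : ℝ) = k + ℓ) :
    k * (1 - α) + ℓ * γ = γ * ∑ e : {A // A ∈ t}, edgeParam α γ e := by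
  rw [Finset.sum_coe_sort t (edgeParam α γ), ← h.sum_edgeWeight_eq hℓ, Finset.mul_sum]
  exact Finset.sum_congr rfl fun A _ => (mul_edgeParam hγ A).symm

theorem IsFragTree.sum_edgeParam {t : Finset (Finset ℕ)} (h : IsFragTree (Finset.Icc 1 k) t)
    (hγ : γ ≠ 0) {ℓ : ℝ} (hℓ : (t.card : ℝ) = k + ℓ) :
    ∑ e : {A // A ∈ t}, edgeParam α γ e = lengthExponent α γ k ℓ := by
  have h1 := h.mul_sum_edgeParam (α := α) hγ hℓ
  refine mul_left_cancel₀ hγ (h1.symm.trans ?_)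
  rw [lengthExponent]
  field_simp
  ring

/-- The joint law of the limits. -/
theorem IsGrowthFrom.map_massLengthProportions [IsProbabilityMeasure P]
    {T : ℕ → Ω → Finset (Finset ℕ)} {t₀ : Finset (Finset ℕ)} (hT : IsGrowthFrom α γ k P T)
    (hα0 : 0 < α) (hα1 : α < 1) (hγ0 : 0 < γ) (hγα : γ ≤ α) (hk : 1 ≤ k)
    (h0 : ∀ᵐ ω ∂P, T k ω = t₀) {g : ℝ → ℝ} (hg : IsMittagLefflerDensity γ g)
    {η : Finset ℕ → Ω → ℝ} {w : Ω → ℝ} (hη : ∀ C, Measurable (η C)) (hw : Measurable w)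
    (hηlim : ∀ᵐ ω ∂P, ∀ C ∈ t₀, Tendsto
      (fun n : ℕ => (n : ℝ) ^ (-γ) * reducedLength (T n ω) (Finset.Icc 1 k) C)
      atTop (𝓝 (η C ω)))
    (hwlim : ∀ᵐ ω ∂P, Tendsto
      (fun n : ℕ => (n : ℝ)⁻¹ * edgeLeafCount (T n ω) (Finset.Icc 1 n) (Finset.Icc 1 k))
      atTop (𝓝 (w ω))) (e₀ : {A // A ∈ t₀}) {ℓ : ℝ} (hℓ : (t₀.card : ℝ) = k + ℓ) :
    P.map (fun ω => massLengthProportions γ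
        (fun o : Option {A // A ∈ t₀} => o.elim (w ω) fun A => η A ω)) =
      jointLaw α γ k ℓ (k * (1 - α) + ℓ * γ) ((k - 1) * α - ℓ * γ) g
        (fun e : {A // A ∈ t₀} => edgeParam α γ e) e₀ := by
  have ht₀ : IsFragTree (Finset.Icc 1 k) t₀ := by
    obtain ⟨ω, hω⟩ := h0.exists
    exact hω ▸ hT.tree k hk ω
  have hX : Measurable fun ω => fun o : Option {A // A ∈ t₀} => o.elim (w ω) fun A => η A ω := by
    refine measurable_pi_iff.2 fun o => ?_
    cases o with
    | none => exact hw
    | some A => exact hη A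
  refine AlphaGamma.map_massLengthProportions (p := fun e : {A // A ∈ t₀} => edgeParam α γ e)
    hg hγ0 (fun e => edgeParam_pos hα1 hγ0 e) (ht₀.sum_edgeParam hγ0.ne' hℓ)
    (ht₀.mul_sum_edgeParam hγ0.ne' hℓ) (ht₀.vertexWeight_sum_nonneg hα0.le hγα hℓ) hX.aemeasurable ?_ e₀ fun c => ?_
  · filter_upwards [hηlim, hwlim] with ω h1 h2 o
    cases o with
    | none => exact ge_of_tendsto' h2 fun n => by positivity
    | some A => exact ge_of_tendsto' (h1 A A.2) fun n => by positivity
  -- Exponents are indexed by all finite sets in the moment formula, so they are extended by `0` off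
  -- `t₀`.
  · set c' : Finset ℕ → ℕ := fun A => if h : A ∈ t₀ then c (some ⟨A, h⟩) else 0 with hc'
    have hc : ∀ A : {A // A ∈ t₀}, c (some A) = c' A := fun A => by rw [hc']; simp
    have h1 := hT.lintegral_limit hα0 hα1 hγ0 hγα hk h0 (fun C _ => (hη C).aemeasurable)
      hw.aemeasurable hηlim hwlim c' (c none)
    rw [eigenval, ht₀.sum_edgeWeight_eq hℓ] at h1
    simp only [Fintype.prod_option, Option.elim, hc]
    -- The two beta parameters add up to `k - α`, the argument of the Gamma functions in `eigenval`.
    rw [Finset.sum_coe_sort t₀ (fun A => (c' A : ℝ)),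
      Finset.prod_coe_sort t₀ (fun A => rising (edgeParam α γ A) (c' A)),
      show (k : ℝ) * (1 - α) + ℓ * γ + ((k - 1) * α - ℓ * γ) = k - α by ring, ← h1]
    refine lintegral_congr fun ω => ?_
    rw [Finset.prod_coe_sort t₀ (fun A => η A ω ^ c' A), mul_comm]

end Limit
end AlphaGamma

/-! ### Assembly of the limits -/

theorem mainTheorem9 {Ω : Type*} [MeasurableSpace Ω] (P : Measure Ω) [IsProbabilityMeasure P]
    (α γ : ℝ) (hα0 : 0 < α) (hα1 : α < 1) (hγ0 : 0 < γ) (hγα : γ ≤ α)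
    (T : ℕ → Ω → Finset (Finset ℕ)) (hT : AlphaGamma.IsAlphaGammaSequence α γ P T)
    (k : ℕ) (hk : 1 ≤ k) :
    ∃ (g : ℝ → ℝ) (W L : Ω → ℝ) (D : Ω → Finset ℕ → ℝ),
      AlphaGamma.IsMittagLefflerDensity γ g ∧
      Measurable W ∧ Measurable L ∧ (∀ A, Measurable fun ω => D ω A) ∧
      -- conditionally given the tree `T k`, which has `k + ℓ` edges, the variables are independent
      -- with the beta, tilted Mittag-Leffler and Dirichlet distributions
      (∀ t : Finset (Finset ℕ), P (T k ⁻¹' {t}) ≠ 0 → ∀ (e₀ : {A // A ∈ t}) (ℓ : ℝ),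
        (t.card : ℝ) = k + ℓ →
        Measure.map (fun ω => (W ω, L ω, fun e : {A // A ∈ t} => D ω e)) P[|T k ⁻¹' {t}] =
          (AlphaGamma.betaLaw (k * (1 - α) + ℓ * γ) ((k - 1) * α - ℓ * γ)).prod
            ((AlphaGamma.lengthLaw α γ k ℓ g).prod
              (AlphaGamma.dirichletLaw (fun e : {A // A ∈ t} => AlphaGamma.edgeParam α γ e) e₀))) ∧
      -- almost sure convergence
      ∀ᵐ ω ∂P,
        -- the reduced tree has shape `T k`, and its edge lengths converge
        (∀ n, k ≤ n → AlphaGamma.reducedShape (T n ω) (Finset.Icc 1 k) = T k ω) ∧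
        (∀ A ∈ T k ω, Tendsto
          (fun n : ℕ => (n : ℝ) ^ (-γ) * AlphaGamma.reducedLength (T n ω) (Finset.Icc 1 k) A)
          atTop (𝓝 (L ω * W ω ^ γ * D ω A))) ∧
        -- Gromov-Hausdorff convergence of the rescaled reduced trees to the tree with shape `T k`
        -- and edge lengths `L * W ^ γ * D`
        Tendsto
          (fun n : ℕ => AlphaGamma.rootedGHDist
            (AlphaGamma.treeRoot (AlphaGamma.reducedShape (T n ω) (Finset.Icc 1 k))
              (fun A => (n : ℝ) ^ (-γ) *
                AlphaGamma.reducedLength (T n ω) (Finset.Icc 1 k) A))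
            (AlphaGamma.treeRoot (T k ω) (fun A => L ω * W ω ^ γ * D ω A)))
          atTop (𝓝 0) ∧
        -- convergence of the proportion of leaves in subtrees attached to the edges
        Tendsto
          (fun n : ℕ => (n : ℝ)⁻¹ *
            AlphaGamma.edgeLeafCount (T n ω) (Finset.Icc 1 n) (Finset.Icc 1 k))
          atTop (𝓝 (W ω)) := by
  obtain ⟨g, hg⟩ := AlphaGamma.exists_isMittagLefflerDensity hγ0 (hγα.trans_lt hα1)
  set K := Finset.Icc 1 k with hK
  have hcond := hT.isGrowthFrom_cond hα1 hk
  have hgr := hT.isGrowthFrom_one hα1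
  have hprob : ∀ t, P (T k ⁻¹' {t}) ≠ 0 → IsProbabilityMeasure P[|T k ⁻¹' {t}] :=
    fun t ht => cond_isProbabilityMeasure ht
  have hTk : ∀ t, ∀ᵐ ω ∂P[|T k ⁻¹' {t}], T k ω = t := fun t =>
    ae_cond_mem (hT.measurable k hk t)
  have hshape : ∀ᵐ ω ∂P, ∀ n, k ≤ n → AlphaGamma.reducedShape (T n ω) K = T k ω := by
    refine AlphaGamma.ae_of_forall_cond (hT.measurable k hk) fun t ht => ?_
    have := hprob t ht
    filter_upwards [hTk t, (hcond t).ae_reducedShape hα0 hα1 hγ0 hγα hk (hTk t)] with ω h1 h2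
    rwa [h1]
  have hlenEx : ∀ᵐ ω ∂P, ∀ A ∈ T k ω, ∃ x, Tendsto
      (fun n : ℕ => (n : ℝ) ^ (-γ) * AlphaGamma.reducedLength (T n ω) K A) atTop (𝓝 x) := by
    refine AlphaGamma.ae_of_forall_cond (hT.measurable k hk) fun t ht => ?_
    have := hprob t ht
    filter_upwards [hTk t, (hcond t).ae_exists_tendsto_reducedLength hα0 hα1 hγ0 hγα hk (hTk t)]
      with ω h1 h2
    rwa [h1]
  have hmassEx : ∀ᵐ ω ∂P, ∃ x, Tendsto
      (fun n : ℕ => (n : ℝ)⁻¹ * AlphaGamma.edgeLeafCount (T n ω) (Finset.Icc 1 n) K)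
      atTop (𝓝 x) := by
    refine AlphaGamma.ae_of_forall_cond (hT.measurable k hk) fun t ht => ?_
    have := hprob t ht
    exact (hcond t).ae_exists_tendsto_edgeLeafCount hα0 hα1 hγ0 hγα hk (hTk t)
  -- The index is shifted to `n + 1` because nothing, not even measurability, is known about `T 0`.
  obtain ⟨W, hWm, hW⟩ := measurable_limit_of_tendsto_metrizable_ae (μ := P) (L := atTop)
    (f := fun (n : ℕ) ω => ((n + 1 : ℕ) : ℝ)⁻¹ *
      AlphaGamma.edgeLeafCount (T (n + 1) ω) (Finset.Icc 1 (n + 1)) K)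
    (fun n => (hgr.measurable_comp (fun t => ((n + 1 : ℕ) : ℝ)⁻¹ *
      AlphaGamma.edgeLeafCount t (Finset.Icc 1 (n + 1)) K) (by omega)).aemeasurable) (by
    filter_upwards [hmassEx] with ω ⟨x, hx⟩
    exact ⟨x, (tendsto_add_atTop_iff_nat 1).2 hx⟩)
  -- The indicator of `A ∈ T k` makes the sequence converge for every `A`, with limit `0` if `A` is
  -- not an edge of `T k`, so a single measurable limit serves all shapes.
  have hlenLim := fun A => measurable_limit_of_tendsto_metrizable_ae (μ := P) (L := atTop)
    (f := fun (n : ℕ) ω => (if A ∈ T k ω then 1 else 0 : ℝ) * (((n + 1 : ℕ) : ℝ) ^ (-γ) *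
      AlphaGamma.reducedLength (T (n + 1) ω) K A))
    (fun n => ((hgr.measurable_comp (fun t => (if A ∈ t then 1 else 0 : ℝ)) hk).mul
      (hgr.measurable_comp (fun t => ((n + 1 : ℕ) : ℝ) ^ (-γ) *
        AlphaGamma.reducedLength t K A) (by omega))).aemeasurable) (by
    filter_upwards [hlenEx] with ω hω
    by_cases hA : A ∈ T k ω
    · obtain ⟨x, hx⟩ := hω A hA
      refine ⟨x, ?_⟩
      simp only [if_pos hA, one_mul]
      exact (tendsto_add_atTop_iff_nat 1).2 hx
    · refine ⟨0, ?_⟩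
      simp only [if_neg hA, zero_mul]
      exact tendsto_const_nhds)
  choose η hηm hη using hlenLim
  have hmass : ∀ᵐ ω ∂P, Tendsto
      (fun n : ℕ => (n : ℝ)⁻¹ * AlphaGamma.edgeLeafCount (T n ω) (Finset.Icc 1 n) K)
      atTop (𝓝 (W ω)) := by
    filter_upwards [hW] with ω hω
    exact (tendsto_add_atTop_iff_nat 1).1 hω
  have hlen : ∀ᵐ ω ∂P, ∀ A, (A ∈ T k ω → Tendsto
      (fun n : ℕ => (n : ℝ) ^ (-γ) * AlphaGamma.reducedLength (T n ω) K A) atTop (𝓝 (η A ω))) ∧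
      (A ∉ T k ω → η A ω = 0) := by
    refine ae_all_iff.2 fun A => ?_
    filter_upwards [hη A] with ω hω
    refine ⟨fun hA => ?_, fun hA => ?_⟩
    · simp only [if_pos hA, one_mul] at hω
      exact (tendsto_add_atTop_iff_nat 1).1 hω
    · simp only [if_neg hA, zero_mul] at hω
      exact tendsto_nhds_unique hω tendsto_const_nhds
  -- The total length is summed over the deterministic set of all subsets of `K`, which makes it
  -- measurable; the additional terms vanish almost surely. The variables sought are `L = s / W ^ γ`
  -- and `D = η / s`.
  set s : Ω → ℝ := fun ω => ∑ A ∈ K.powerset, η A ω with hs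
  have hsm : Measurable s := Finset.measurable_fun_sum _ fun A _ => hηm A
  have hsum : ∀ᵐ ω ∂P, s ω = ∑ A ∈ T k ω, η A ω := by
    filter_upwards [hlen] with ω hω
    refine (Finset.sum_subset (fun A hA => ?_) fun A _ hA => (hω A).2 hA).symm
    exact Finset.mem_powerset.2 ((hT.tree k hk ω).subset A hA)
  have hlaw : ∀ t : Finset (Finset ℕ), P (T k ⁻¹' {t}) ≠ 0 → ∀ (e₀ : {A // A ∈ t}) (ℓ : ℝ),
      (t.card : ℝ) = k + ℓ →
      Measure.map (fun ω => (W ω, s ω / W ω ^ γ, fun e : {A // A ∈ t} => η e ω / s ω))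
        P[|T k ⁻¹' {t}] =
      AlphaGamma.jointLaw α γ k ℓ (k * (1 - α) + ℓ * γ) ((k - 1) * α - ℓ * γ) g
        (fun e : {A // A ∈ t} => AlphaGamma.edgeParam α γ e) e₀ := by
    intro t ht e₀ ℓ hℓ
    have := hprob t ht
    have hac : P[|T k ⁻¹' {t}] ≪ P := cond_absolutelyContinuous
    have hlen' : ∀ᵐ ω ∂P[|T k ⁻¹' {t}], ∀ A ∈ t, Tendsto
        (fun n : ℕ => (n : ℝ) ^ (-γ) * AlphaGamma.reducedLength (T n ω) K A)
        atTop (𝓝 (η A ω)) := by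
      filter_upwards [hTk t, hac.ae_le hlen] with ω h1 h2 A hA
      exact (h2 A).1 (h1.symm ▸ hA)
    rw [← (hcond t).map_massLengthProportions hα0 hα1 hγ0 hγα hk (hTk t) hg hηm hWm hlen'
      (hac.ae_le hmass) e₀ hℓ]
    refine Measure.map_congr ?_
    filter_upwards [hTk t, hac.ae_le hsum] with ω h1 h2
    rw [h1] at h2
    simp only [AlphaGamma.massLengthProportions, Option.elim]
    rw [Finset.sum_coe_sort t (fun A => η A ω), h2]
  -- Positivity is read off from the limit law. It is what allows `L W ^ γ D = η` to be recovered
  -- from the quotients.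
  have hpos : ∀ᵐ ω ∂P, 0 < W ω ∧ 0 < s ω := by
    refine AlphaGamma.ae_of_forall_cond (hT.measurable k hk) fun t ht => ?_
    have := hprob t ht
    obtain ⟨ω₀, hω₀⟩ := (hTk t).exists
    have htree : AlphaGamma.IsFragTree K t := hω₀ ▸ hT.tree k hk ω₀
    have hℓ : (t.card : ℝ) = k + (t.card - k) := by ring
    have hae := AlphaGamma.ae_jointLaw (ι := {A // A ∈ t}) (α := α) (k := k) (ℓ := t.card - k)
      (a := k * (1 - α) + (t.card - k) * γ) (b := (k - 1) * α - (t.card - k) * γ)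
      (p := fun e : {A // A ∈ t} => AlphaGamma.edgeParam α γ e) hg hγ0
      (fun e => AlphaGamma.edgeParam_pos hα1 hγ0 e) 
      (htree.sum_edgeParam hγ0.ne' hℓ) (htree.mul_sum_edgeParam hγ0.ne' hℓ)
      (htree.vertexWeight_sum_nonneg hα0.le hγα hℓ) ⟨K, htree.ancestor_mem⟩
    rw [← hlaw t ht ⟨K, htree.ancestor_mem⟩ _ hℓ] at hae
    filter_upwards [ae_of_ae_map (by fun_prop) hae] with ω hω
    have h1 : 0 < W ω := hω.1.1
    have h2 : 0 < s ω / W ω ^ γ := hω.2.1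
    exact ⟨h1, (div_pos_iff_of_pos_right (Real.rpow_pos_of_pos h1 γ)).1 h2⟩
  refine ⟨g, W, fun ω => s ω / W ω ^ γ, fun ω A => η A ω / s ω, hg, hWm,
    hsm.div (hWm.pow_const γ), fun A => (hηm A).div hsm, hlaw, ?_⟩
  filter_upwards [hshape, hlen, hmass, hpos] with ω h1 h2 h3 ⟨h4, h5⟩
  have h6 : ∀ A, s ω / W ω ^ γ * W ω ^ γ * (η A ω / s ω) = η A ω := by
    intro A
    have := Real.rpow_pos_of_pos h4 γ
    field_simp
  have h7 : ∀ A ∈ T k ω, Tendsto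
      (fun n : ℕ => (n : ℝ) ^ (-γ) * AlphaGamma.reducedLength (T n ω) K A) atTop
      (𝓝 (η A ω)) := fun A hA => (h2 A).1 hA
  refine ⟨h1, fun A hA => (h6 A).symm ▸ h7 A hA, ?_, h3⟩
  refine AlphaGamma.tendsto_rootedGHDist_treeRoot ?_ (fun n A _ => by positivity)
    (fun A hA => (h6 A).symm ▸ ge_of_tendsto' (h7 A hA) fun n => by positivity)
    fun A hA => (h6 A).symm ▸ h7 A hA
  filter_upwards [eventually_ge_atTop k] with n hn using h1 n hn
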